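/- **Setting.** Let $d\ge 2$, let $\Omega\subset\mathbb R^d$ be a bounded connected open set with convex closure, let $K_s,K_d\subset\Omega$ be disjoint compact sets (source, destination), and let $f:\overline\Omega\times S_1\to(0,\infty)$ be a continuous bounded speed, Lipschitz in each variable, with $\underline f\le f\le\overline f$, where $\underline f>0$. Trajectories solve $\dot y=f(y,\alpha)\alpha$ in $\overline\Omega$ with a measurable control $\alpha$ of norm one. Let $T_d(x)$ be the minimum time from $x$ to $K_d$, $T_s(x)$ the minimum time from $K_s$ to $x$, $v_d=1-e^{-T_d}$, $v_s=1-e^{-T_s}$, $F_v=v_s+v_d-v_sv_d$, $v^*=\inf_{K_s}v_d$, and $O_\eta=\{x\in\Omega\setminus(K_s\cup K_d): F_v(x)<\inf_\Omega F_v+\eta\}$. Assume that the set $\Gamma^*$ of points of optimal trajectories from $K_s$ to $K_d$ is nonempty and is the union of $n$ optimal paths, that $\overline{O_{\bar\eta}}\subset\Omega$ for some $\bar\eta>0$, and that every $x\in O_\eta$, $\eta>0$, is at distance at most $C_\beta\eta^\beta$ from $\Gamma^*$, where $0<\beta\le1$. Put $D=\sup\{\|x-y\|:x\in K_s,y\in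 K_d\}$ and $D_\Omega=\operatorname{diam}\overline\Omega$. For each $H>0$, let $X^H$ be the set of nodes in $\Omega$ of a Cartesian grid with mesh step $H$, and consider, for each of the two directions, an update operator that is monotone, causal, local (its neighbourhoods consist of grid offsets at most $L$ in each coordinate), equal to $\infty$ where no neighbour has a finite value, and otherwise with values in $[0,1]$. Let $V_d^{H,\Omega'},V_s^{H,\Omega'}$ be the results of the full fast marching method on $X^H\cap\Omega'$. Assume that for some $0<\gamma\le1$ and $C_s,C_d,C_O>0$: $v_s-V_s^{H,\Omega}\le C_sH^\gamma$ and $v_d-V_d^{H,\Omega}\le C_dH^\gamma$ on $X^H$; and, for all connected open $\Omega'\subset\Omega$ that contain $K_s\cup K_d$ and $\overline{O_\eta}$, where $\eta\ge C_OH^\gamma$, one has $V_s^{H,\Omega'}-v_s\le C_sH^\gamma$ and $V_d^{H,\Omega'}-v_d\le C_dH^\gamma$ at all nodes in $\overline{O_{\eta/2}}$ and at all nodes of $K_s\cup K_d$ with $F_v<\inf_\Omega F_v+\eta/2$. *Method.* At a level with grid $G$, mesh step $H$ and parameter $\eta$, run the partial fast marching method in $G$ from $K_d\cap G$ until the nodes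 at distance less than $\eta$ from $K_s$ are accepted, and likewise from $K_s\cap G$ towards $K_d$. The nodes accepted in both searches with $F_V\le\min_GF_V+\eta$ are active. The next grid, of mesh step $h$, consists of the nodes of $X^h$ at sup-norm distance at most $\max(H-h,h)$ from an active node. The first grid is $X^{H_1}$; on the last grid (mesh step $h$) one search is run, from $K_d$, until all nodes of $K_s$ in this grid are accepted. Let $V$ be its result and $W$ the smallest value of $V$ at the nodes of $K_s$. The cost is the number of elementary operations: an evaluation of an update operator costs the number of neighbours plus one, a heap or search-tree operation with $m$ elements costs $\lfloor\log_2m\rfloor+1$, and the selection of the active nodes and the construction of the grids are counted. **Theorem.** Let $C_\gamma=C_s+C_d$, $\nu=\gamma\beta(1-\frac1d)<1$, and $h=(\varepsilon/C_\gamma)^{1/\gamma}$. There are constants $C_m,K,\theta>0$ and $q\in\mathbb N$ that depend only on $\gamma,\beta,C_s,C_d,C_O,C_\beta,\underline f,\overline f,D,D_\Omega,L$ (not on $d$), and constants $C_\eta,C'>0$ that depend only on these and on $d$, such that the following holds. Write $g=\widetilde O(\varphi)$ for $g\le nK\varphi|\log\varphi|^q$. Say that a method has error $\varepsilon$ if,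 with $\eta$ the parameter of its last but one level: * the final grid contains all $x\in X^h$ with $F_v(x)<\inf_\Omega F_v+\theta\eta$; all accepted ones among these nodes satisfy $|V(x)-v_d(x)|\le\varepsilon$; and those of them that are in $K_s$ or have $v_d(x)+2\varepsilon<v^*$ are accepted; * $|W-\min_{K_s\cap X^h}v_d|\le\varepsilon$; if a minimum point of $v_d$ on $K_s$ is a node of $X^h$, then $|W-v^*|\le\varepsilon$; and always $|W-v^*|\le C'\varepsilon$. 1. For all small enough $\varepsilon>0$, the two-level method with $H=h^{1/(\nu+1)}$ and $\eta_H=C_\eta H^\gamma$ has error $\varepsilon$ and cost $\widetilde O\big(C_m^d\,\varepsilon^{-d/(\gamma(\nu+1))}\big)$. 2. For every $N\ge2$ and all small enough $\varepsilon>0$ (depending on $N$), the $N$-level method with $H_l=h^{(1-\nu^l)/(1-\nu^N)}$ and $\eta_l=C_\eta H_l^\gamma$ has error $\varepsilon$ and cost $\widetilde O\big(N\,C_m^d\,\varepsilon^{-\frac{1-\nu}{1-\nu^N}\frac d\gamma}\big)$. 3. Let $0<c\le1$ satisfy $e^{\gamma/c}>\frac52$ and $C_\eta e^{-\gamma/c}<\bar\eta$,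 where $\overline{O_{\bar\eta}}\subset\Omega$ (this holds for all small enough $c$). Then for all small enough $\varepsilon>0$, the $N$-level method with $N=\lfloor\frac c\gamma\log\frac1\varepsilon\rfloor$, $H_l=h^{l/N}$ and $\eta_l=C_\eta H_l^\gamma$ has error $\varepsilon$ and cost $\widetilde O\big((C_me^{1/c})^d\varepsilon^{-(1-\nu)d/\gamma}\big)=\widetilde O\big((C_me^{1/c})^d\varepsilon^{-(1+(d-1)(1-\gamma\beta))/\gamma}\big)$, which is $\widetilde O\big((C_me^{1/c})^d\varepsilon^{-1}\big)$ if $\gamma=\beta=1$. -/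

import Mathlib

open Set MeasureTheory
open scoped ENNReal

noncomputable section

namespace FastMarching

/-- Points of `ℝ^d`, with the Euclidean norm. -/
abbrev Pt (d : ℕ) : Type := EuclideanSpace ℝ (Fin d)

/-- The closed ball of radius `r` for the sup-norm. -/
def SupClose {d : ℕ} (r : ℝ) (x y : Pt d) : Prop := ∀ i, |x i - y i| ≤ r

/-! ### The minimum time problem -/

/-- A minimum time problem: a bounded domain, disjoint compact source and destination sets in it,
and a continuous, bounded, Lipschitz, positive speed `f x α` on `closure Ω × sphere`. -/
structure Problem (d : ℕ) where
  Ω : Set (Pt d)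
  Ksrc : Set (Pt d)
  Kdst : Set (Pt d)
  f : Pt d → Pt d → ℝ
  isOpen : IsOpen Ω
  isConnected : IsConnected Ω
  isBounded : Bornology.IsBounded Ω
  isCompact_src : IsCompact Ksrc
  isCompact_dst : IsCompact Kdst
  src_subset : Ksrc ⊆ Ω
  dst_subset : Kdst ⊆ Ω
  disjoint : Disjoint Ksrc Kdst
  f_continuous : ContinuousOn (fun z : Pt d × Pt d => f z.1 z.2)
    (closure Ω ×ˢ Metric.sphere (0 : Pt d) 1)
  f_pos : ∀ x ∈ closure Ω, ∀ a ∈ Metric.sphere (0 : Pt d) 1, 0 < f x a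
  f_bounded : ∃ M : ℝ, ∀ x ∈ closure Ω, ∀ a ∈ Metric.sphere (0 : Pt d) 1, f x a ≤ M
  f_lipschitz_state : ∃ Lf : ℝ, 0 < Lf ∧ ∀ a ∈ Metric.sphere (0 : Pt d) 1, ∀ x ∈ Ω, ∀ x' ∈ Ω,
    |f x a - f x' a| ≤ Lf * ‖x - x'‖
  f_lipschitz_control : ∃ La : ℝ, 0 < La ∧ ∀ x ∈ Ω, ∀ a ∈ Metric.sphere (0 : Pt d) 1,
    ∀ a' ∈ Metric.sphere (0 : Pt d) 1, |f x a - f x a'| ≤ La * ‖a - a'‖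

namespace Problem

variable {d : ℕ} (p : Problem d)

/-- `y` is on `[0, τ]` a trajectory of `y' = σ f(y, α) α`, `y 0 = x`, in `closure Ω`, for some
measurable control `α` with unit vectors as values (`σ = 1`: forward, `σ = -1`: reverse).
The integrand is automatically integrable, as `y` is continuous and `f` continuous, bounded. -/
def IsTrajectory (σ : ℝ) (x : Pt d) (τ : ℝ) (y : ℝ → Pt d) : Prop :=
  ContinuousOn y (Icc 0 τ) ∧ (∀ t ∈ Icc 0 τ, y t ∈ closure p.Ω) ∧
    ∃ α : ℝ → Pt d, Measurable α ∧ (∀ t, ‖α t‖ = 1) ∧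
      ∀ t ∈ Icc 0 τ, y t = x + ∫ s in (0 : ℝ)..t, (σ * p.f (y s) (α s)) • α s

/-- The minimum time to reach `K` from `x` (`∞` if impossible). -/
def minTime (σ : ℝ) (K : Set (Pt d)) (x : Pt d) : ℝ≥0∞ :=
  sInf {T : ℝ≥0∞ | ∃ (τ : ℝ) (y : ℝ → Pt d),
    0 ≤ τ ∧ p.IsTrajectory σ x τ y ∧ y τ ∈ K ∧ T = ENNReal.ofReal τ}

/-- Minimum time from `x` to the destination. -/
def Td (x : Pt d) : ℝ≥0∞ := p.minTime 1 p.Kdst x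

/-- Minimum time from the source to `x` (reverse dynamics). -/
def Ts (x : Pt d) : ℝ≥0∞ := p.minTime (-1) p.Ksrc x

end Problem

/-- The change of variable `T ↦ 1 - e^{-T}`, with `1 - e^{-∞} = 1`. -/
def kruzkov (T : ℝ≥0∞) : ℝ := if T = ⊤ then 1 else 1 - Real.exp (-T.toReal)

namespace Problem

variable {d : ℕ} (p : Problem d)

def vd (x : Pt d) : ℝ := kruzkov (p.Td x)

def vs (x : Pt d) : ℝ := kruzkov (p.Ts x)

/-- The transformed value of the problem: `1 - exp (- minimum time from source to destination)`. -/
def vStar : ℝ := sInf (p.vd '' p.Ksrc)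

/-- `F_v = v_s + v_d - v_s v_d`. -/
def Fv (x : Pt d) : ℝ := p.vs x + p.vd x - p.vs x * p.vd x

def infFv : ℝ := sInf (p.Fv '' p.Ω)

/-- The neighbourhood `O_η` of the optimal trajectories. -/
def nbd (η : ℝ) : Set (Pt d) :=
  {x | x ∈ p.Ω \ (p.Ksrc ∪ p.Kdst) ∧ p.Fv x < p.infFv + η}

/-- The optimal starting points. -/
def Xsrc : Set (Pt d) := {x | x ∈ p.Ksrc ∧ ∀ z ∈ p.Ksrc, p.vd x ≤ p.vd z}

/-- An optimal path from the source to the destination, with its travel time `τ`. -/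
def IsOptimalPath (y : ℝ → Pt d) (τ : ℝ) : Prop :=
  0 ≤ τ ∧ y 0 ∈ p.Xsrc ∧ p.IsTrajectory 1 (y 0) τ y ∧ y τ ∈ p.Kdst ∧
    ENNReal.ofReal τ = p.Td (y 0)

/-- The set `Γ*` of geodesic points. -/
def geodesicPoints : Set (Pt d) :=
  {z | ∃ (y : ℝ → Pt d) (τ : ℝ), p.IsOptimalPath y τ ∧ ∃ t ∈ Icc 0 τ, y t = z}

/-! ### Grids -/

/-- The nodes in `Ω` of the Cartesian grid of mesh step `H` through the point `o`. -/
def gridSet (o : Pt d) (H : ℝ) : Set (Pt d) :=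
  {x | x ∈ p.Ω ∧ ∀ i, ∃ k : ℤ, x i = o i + H * k}

theorem gridSet_finite (o : Pt d) {H : ℝ} (hH : 0 < H) : (p.gridSet o H).Finite := by
  obtain ⟨R, hR⟩ := p.isBounded.exists_norm_le
  let M : ℤ := ⌈(R + ‖o‖) / H⌉
  have hfin : (Set.pi univ (fun _ : Fin d => Set.Icc (-M) M)).Finite :=
    Set.Finite.pi (fun _ => Set.finite_Icc _ _)
  refine (hfin.image (fun k : Fin d → ℤ =>
    (WithLp.toLp 2 (fun i => o i + H * (k i : ℝ)) : Pt d))).subset ?_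
  rintro x ⟨hx, hk⟩
  choose k hk using hk
  refine ⟨k, ?_, ?_⟩
  · intro i _
    have h1 : |x i| ≤ R := by
      have := (PiLp.norm_apply_le x i).trans (hR x hx)
      rwa [Real.norm_eq_abs] at this
    have h2 : |o i| ≤ ‖o‖ := by
      have := PiLp.norm_apply_le o i
      rwa [Real.norm_eq_abs] at this
    have h3 : |H * (k i : ℝ)| ≤ R + ‖o‖ := by
      have : H * (k i : ℝ) = x i - o i := by rw [hk i]; ring
      rw [this]
      exact (abs_sub _ _).trans (add_le_add h1 h2)
    rw [abs_mul, abs_of_pos hH] at h3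
    have h4 : |(k i : ℝ)| ≤ (R + ‖o‖) / H := by
      rw [le_div_iff₀ hH]; linarith
    have h5 : |(k i : ℝ)| ≤ (M : ℝ) := h4.trans (Int.le_ceil _)
    have h6 : |k i| ≤ M := by exact_mod_cast h5
    exact abs_le.mp h6
  · ext i
    simp [hk i]

open scoped Classical in
/-- The grid as a finite set; see `mem_grid`. -/
def grid (o : Pt d) (H : ℝ) : Finset (Pt d) :=
  if h : (p.gridSet o H).Finite then h.toFinset else ∅

theorem mem_grid (o : Pt d) {H : ℝ} (hH : 0 < H) (x : Pt d) :
    x ∈ p.grid o H ↔ x ∈ p.Ω ∧ ∀ i, ∃ k : ℤ, x i = o i + H * k := by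
  have h := p.gridSet_finite o hH
  rw [grid, dif_pos h, Set.Finite.mem_toFinset]
  rfl

end Problem

/-! ### Update operators and the fast marching method -/

/-- A family, indexed by the mesh step `H`, of update operators on functions of the nodes
(value `∞` where nothing has been computed, in particular outside of the grid in use) that are
local (on discrete neighbourhoods of grid offsets at most `L` in each coordinate), monotone and
causal (`U V y` only depends on the values of `V` that are smaller than `U V y`), that give `∞`
where no neighbour has a finite value, and otherwise values in `[0, 1]`, or `∞`. -/
structure UpdateOperator (d L : ℕ) where
  U : ℝ → (Pt d → ℝ≥0∞) → Pt d → ℝ≥0∞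
  neighbors : ℝ → Pt d → Finset (Pt d)
  neighbors_offset : ∀ H, 0 < H → ∀ y, ∀ z ∈ neighbors H y,
    ∀ i, ∃ k : ℤ, |k| ≤ (L : ℤ) ∧ z i = y i + H * k
  isLocal : ∀ H, 0 < H → ∀ V V' y, (∀ z ∈ neighbors H y, V z = V' z) → U H V y = U H V' y
  monotone : ∀ H, 0 < H → ∀ V V' : Pt d → ℝ≥0∞, V ≤ V' → U H V ≤ U H V'
  causal : ∀ H, 0 < H → ∀ (V W : Pt d → ℝ≥0∞) (y : Pt d),
    (∀ z, V z < U H V y → W z = V z) → (∀ z, U H V y ≤ V z → W z = ⊤) → U H W y = U H V y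
  top : ∀ H, 0 < H → ∀ y, U H (fun _ => ⊤) y = ⊤
  range : ∀ H, 0 < H → ∀ V y, U H V y ≤ 1 ∨ U H V y = ⊤

/-- State of the fast marching method: accepted nodes, narrow band, current values, and the
number of elementary operations performed. -/
structure MarchState (d : ℕ) where
  accepted : Finset (Pt d)
  narrow : Finset (Pt d)
  V : Pt d → ℝ≥0∞
  ops : ℕ

/-- Cost of one operation in a heap (or balanced search tree) with `m` elements. -/
def heapCost (m : ℕ) : ℕ := Nat.log 2 m + 1

namespace UpdateOperator

variable {d L : ℕ} (A : UpdateOperator d L)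

/-- Cost of the update of the nodes in `Y` with a narrow band of size `m`: an evaluation of the
update operator costs the number of neighbours, plus one, and is followed by a heap operation. -/
def updateCost (H : ℝ) (Y : Finset (Pt d)) (m : ℕ) : ℕ :=
  ∑ y ∈ Y, ((A.neighbors H y).card + 1 + heapCost m)

open scoped Classical in
/-- Initialization on the node set `X`: the nodes of `start` get the value `0` and are accepted,
their neighbours form the narrow band. -/
def initState (H : ℝ) (X start : Finset (Pt d)) : MarchState d :=
  let V₀ : Pt d → ℝ≥0∞ := fun x => if x ∈ start then 0 else ⊤
  let Y := X.filter (fun y => y ∉ start ∧ ∃ x ∈ start, x ∈ A.neighbors H y)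
  { accepted := start
    narrow := Y
    V := fun x => if x ∈ Y then A.U H V₀ x else V₀ x
    ops := X.card + A.updateCost H Y Y.card }

open scoped Classical in
/-- One pass through the loop (nothing happens once the narrow band is empty or all nodes of
`ending` are accepted): a node of the narrow band with minimal value is accepted, and the
nodes, not accepted yet, that have it as a neighbour are updated and put into the narrow band. -/
def step (H : ℝ) (X ending : Finset (Pt d)) (s : MarchState d) : MarchState d :=
  if h : s.narrow.Nonempty ∧ ¬ ending ⊆ s.accepted then
    let x := (s.narrow.exists_min_image s.V h.1).choose
    let acc := insert x s.accepted
    let Y := X.filter (fun y => y ∉ acc ∧ x ∈ A.neighbors H y)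
    let nar := (s.narrow.erase x) ∪ Y
    { accepted := acc
      narrow := nar
      V := fun y => if y ∈ Y then A.U H s.V y else s.V y
      ops := s.ops + 1 + heapCost s.narrow.card + A.updateCost H Y nar.card }
  else s

/-- The partial fast marching method on the node set `X`. Each pass through the loop accepts a
new node of `X`, so that `X.card` passes are enough. -/
def march (H : ℝ) (X start ending : Finset (Pt d)) : MarchState d :=
  (A.step H X ending)^[X.card] (A.initState H X start)

end UpdateOperator

/-- `F_V = V_s + V_d - V_s V_d`, with value `∞` where one of the two is `∞`. -/
def combine (a b : ℝ≥0∞) : ℝ≥0∞ := if a = ⊤ ∨ b = ⊤ then ⊤ else a + b - a * b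

/-! ### The multi-level fast marching method -/

/-- The data of the method: the problem, update operators for both directions, and a
point of the Cartesian grid of each mesh step. -/
structure Setup (d L : ℕ) extends Problem d where
  Ud : UpdateOperator d L
  Us : UpdateOperator d L
  origin : ℝ → Pt d

namespace Setup

variable {d L : ℕ} (S : Setup d L)

/-- The grid `X^H`. -/
def X (H : ℝ) : Finset (Pt d) := S.grid (S.origin H) H

open scoped Classical in
/-- The nodes of a finite set `G` that belong to `K`. -/
def inter (G : Finset (Pt d)) (K : Set (Pt d)) : Finset (Pt d) := G.filter (fun x => x ∈ K)

/-- Fast marching "to destination" in the node set `G`, until the nodes of `G` in `K` are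
accepted. -/
def marchD (H : ℝ) (G : Finset (Pt d)) (K : Set (Pt d)) : MarchState d :=
  S.Ud.march H G (inter G S.Kdst) (inter G K)

/-- Fast marching "from source" in the node set `G`, until the nodes of `G` in `K` are
accepted. -/
def marchS (H : ℝ) (G : Finset (Pt d)) (K : Set (Pt d)) : MarchState d :=
  S.Us.march H G (inter G S.Ksrc) (inter G K)

/-- The values `V_d^{H,Ω'}` of the full fast marching method in the grid `X^H ∩ Ω'`. -/
def fullD (H : ℝ) (Ω' : Set (Pt d)) : Pt d → ℝ≥0∞ :=
  (S.marchD H (inter (S.X H) Ω') univ).V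

/-- The values `V_s^{H,Ω'}` of the full fast marching method in the grid `X^H ∩ Ω'`. -/
def fullS (H : ℝ) (Ω' : Set (Pt d)) : Pt d → ℝ≥0∞ :=
  (S.marchS H (inter (S.X H) Ω') univ).V

/-- Search "to destination" at a level with grid `G` and parameter `η`: it ends when the nodes at
distance less than `η` from the source are accepted. -/
def levelD (H η : ℝ) (G : Finset (Pt d)) : MarchState d :=
  S.marchD H G (Metric.thickening η S.Ksrc)

/-- Search "from source" at a level with grid `G` and parameter `η`. -/
def levelS (H η : ℝ) (G : Finset (Pt d)) : MarchState d :=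
  S.marchS H G (Metric.thickening η S.Kdst)

/-- `F_V` for the values computed at a level. -/
def levelF (H η : ℝ) (G : Finset (Pt d)) (x : Pt d) : ℝ≥0∞ :=
  combine ((S.levelS H η G).V x) ((S.levelD H η G).V x)

open scoped Classical in
/-- The active nodes of a level. -/
def active (H η : ℝ) (G : Finset (Pt d)) : Finset (Pt d) :=
  G.filter (fun x => x ∈ (S.levelS H η G).accepted ∧ x ∈ (S.levelD H η G).accepted ∧
    S.levelF H η G x ≤ (⨅ y ∈ G, S.levelF H η G y) + ENNReal.ofReal η)

open scoped Classical in
/-- The nodes of `X^h` that are added to the fine grid on account of the active node `x`. -/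
def around (H h : ℝ) (x : Pt d) : Finset (Pt d) :=
  (S.X h).filter (fun z => SupClose (max (H - h) h) z x)

open scoped Classical in
/-- The fine grid, of mesh step `h`, built from the active nodes of the level of mesh step `H`. -/
def fine (H h η : ℝ) (G : Finset (Pt d)) : Finset (Pt d) :=
  (S.active H η G).biUnion (fun x => S.around H h x)

/-- Operations at a level that is not the last one: the two searches, one pass through the nodes
for the minimum of `F_V` and one for the selection of the active nodes, and for each active node
the insertion of all close nodes into the fine grid (a search tree). -/
def levelCost (H h η : ℝ) (G : Finset (Pt d)) : ℕ :=
  (S.levelD H η G).ops + (S.levelS H η G).ops + 2 * G.card +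
    ∑ x ∈ S.active H η G, (1 + ∑ _z ∈ S.around H h x, heapCost (S.fine H h η G).card)

/-- Last level: search in one direction until all source nodes are accepted. -/
def last (h : ℝ) (G : Finset (Pt d)) : MarchState d := S.marchD h G S.Ksrc

/-- The approximation of the value of the problem: the smallest value at a source node. -/
def computedValue (h : ℝ) (G : Finset (Pt d)) : ℝ≥0∞ :=
  ⨅ x ∈ inter G S.Ksrc, (S.last h G).V x

/-- Two-level method: its fine grid. -/
def twoLevelGrid (H h η : ℝ) : Finset (Pt d) := S.fine H h η (S.X H)

/-- Two-level method: total number of operations. -/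
def twoLevelCost (H h η : ℝ) : ℕ :=
  S.levelCost H h η (S.X H) + (S.last h (S.twoLevelGrid H h η)).ops

/-- Multi-level method with mesh steps `mesh 1, mesh 2, …` and parameters `η 1, η 2, …`:
`levelGrid mesh η k` is the grid of level `k + 1`, of mesh step `mesh (k + 1)`. -/
def levelGrid (mesh η : ℕ → ℝ) : ℕ → Finset (Pt d)
  | 0 => S.X (mesh 1)
  | k + 1 => S.fine (mesh (k + 1)) (mesh (k + 2)) (η (k + 1)) (levelGrid mesh η k)

/-- The final grid of the `N`-level method. -/
def finalGrid (mesh η : ℕ → ℝ) (N : ℕ) : Finset (Pt d) := S.levelGrid mesh η (N - 1)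

/-- Total number of operations of the `N`-level method. -/
def multiLevelCost (mesh η : ℕ → ℝ) (N : ℕ) : ℕ :=
  ∑ k ∈ Finset.range (N - 1),
      S.levelCost (mesh (k + 1)) (mesh (k + 2)) (η (k + 1)) (S.levelGrid mesh η k) +
    (S.last (mesh N) (S.finalGrid mesh η N)).ops

end Setup

/-! ### Assumptions -/

/-- The constants on which the complexity bounds may depend. -/
structure Params where
  γ : ℝ
  β : ℝ
  Cs : ℝ
  Cd : ℝ
  CO : ℝ
  Cβ : ℝ
  fmin : ℝ
  fmax : ℝ
  D : ℝ
  DΩ : ℝ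
  L : ℕ
  γ_pos : 0 < γ
  γ_le : γ ≤ 1
  β_pos : 0 < β
  β_le : β ≤ 1
  Cs_pos : 0 < Cs
  Cd_pos : 0 < Cd
  CO_pos : 0 < CO
  Cβ_pos : 0 < Cβ
  fmin_pos : 0 < fmin

namespace Params

/-- `C_γ = C_s + C_d`. -/
def Cγ (P : Params) : ℝ := P.Cs + P.Cd

/-- `ν = γ β (1 - 1/d)`. -/
def ν (P : Params) (d : ℕ) : ℝ := P.γ * P.β * (1 - 1 / (d : ℝ))

/-- The finest mesh step `h = (ε / C_γ)^{1/γ}`. -/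
def h (P : Params) (ε : ℝ) : ℝ := (ε / P.Cγ) ^ (1 / P.γ)

end Params

namespace Setup

variable {d : ℕ}

/-- The error estimate for the fast marching method, uniform over the restrictions of the domain
that contain the closure of a neighbourhood `O_η`. The upper bound holds at the nodes of the closure
of `O_{η/2}`, and at the nodes of the source and of the destination where `F_v` satisfies the
inequality that defines `O_{η/2}`. -/
structure ErrorEstimate {L : ℕ} (S : Setup d L) (γ Cs Cd CO : ℝ) : Prop where
  lower : ∀ H : ℝ, 0 < H → ∀ x ∈ S.X H,
    ENNReal.ofReal (S.vs x) ≤ S.fullS H S.Ω x + ENNReal.ofReal (Cs * H ^ γ) ∧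
    ENNReal.ofReal (S.vd x) ≤ S.fullD H S.Ω x + ENNReal.ofReal (Cd * H ^ γ)
  upper : ∀ Ω' : Set (Pt d), IsOpen Ω' → IsConnected Ω' → Ω' ⊆ S.Ω →
    S.Ksrc ⊆ Ω' → S.Kdst ⊆ Ω' → ∀ η H : ℝ, 0 < η → 0 < H →
    closure (S.nbd η) ⊆ Ω' → CO * H ^ γ ≤ η → ∀ x ∈ S.X H,
    (x ∈ closure (S.nbd (η / 2)) ∨
      (x ∈ S.Ksrc ∪ S.Kdst ∧ S.Fv x < S.infFv + η / 2)) →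
    S.fullS H Ω' x ≤ ENNReal.ofReal (S.vs x + Cs * H ^ γ) ∧
    S.fullD H Ω' x ≤ ENNReal.ofReal (S.vd x + Cd * H ^ γ)

/-- The standing assumptions, with constants `P` and `n` optimal paths. -/
structure Satisfies (P : Params) (S : Setup d P.L) (n : ℕ) : Prop where
  convex : Convex ℝ (closure S.Ω)
  speed : ∀ x ∈ S.Ω, ∀ a ∈ Metric.sphere (0 : Pt d) 1, P.fmin ≤ S.f x a ∧ S.f x a ≤ P.fmax
  diam_le : Metric.diam (closure S.Ω) ≤ P.DΩ
  dist_le : ∀ x ∈ S.Ksrc, ∀ y ∈ S.Kdst, dist x y ≤ P.D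
  geodesic_nonempty : S.geodesicPoints.Nonempty
  interior : ∃ ηbar : ℝ, 0 < ηbar ∧ closure (S.nbd ηbar) ⊆ S.Ω
  finite_paths : ∃ (y : Fin n → ℝ → Pt d) (τ : Fin n → ℝ),
    (∀ i, S.IsOptimalPath (y i) (τ i)) ∧ S.geodesicPoints = ⋃ i, y i '' Icc 0 (τ i)
  stiffness : ∀ η : ℝ, 0 < η → ∀ x ∈ S.nbd η, ∃ z ∈ S.geodesicPoints, ‖x - z‖ ≤ P.Cβ * η ^ P.β
  error : S.ErrorEstimate P.γ P.Cs P.Cd P.CO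

/-- `V` is finite and differs from `v` by at most `ε`. -/
def Within (V : ℝ≥0∞) (v ε : ℝ) : Prop := V ≠ ⊤ ∧ |V.toReal - v| ≤ ε

/-- Error at most `ε` for the result of the method with finest mesh step `h` and final grid `G`,
in the neighbourhood `F_v < inf F_v + δ` of the optimal trajectories. -/
structure Accurate {L : ℕ} (S : Setup d L) (h ε δ ε' : ℝ) (G : Finset (Pt d)) : Prop where
  /-- The final grid contains all nodes of the neighbourhood. -/
  covers : ∀ x ∈ S.X h, S.Fv x < S.infFv + δ → x ∈ G
  /-- The error is at most `ε` at the accepted nodes of the neighbourhood. -/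
  error : ∀ x ∈ S.X h, S.Fv x < S.infFv + δ → x ∈ (S.last h G).accepted →
    Within ((S.last h G).V x) (S.vd x) ε
  /-- The nodes of the neighbourhood in the source, and those closer to the destination than the
  source is (up to the error), are accepted. -/
  accepts : ∀ x ∈ S.X h, S.Fv x < S.infFv + δ → (x ∈ S.Ksrc ∨ S.vd x + 2 * ε < S.vStar) →
    x ∈ (S.last h G).accepted
  /-- The error on the value is at most `ε` compared with the best source node. -/
  value_nodes : ∃ x₀ ∈ S.X h, x₀ ∈ S.Ksrc ∧ (∀ x ∈ S.X h, x ∈ S.Ksrc → S.vd x₀ ≤ S.vd x) ∧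
    Within (S.computedValue h G) (S.vd x₀) ε
  /-- The error on the value of the problem is at most `ε` if some optimal starting point is
  a node. -/
  value_exact : (∃ x ∈ S.X h, x ∈ S.Xsrc) → Within (S.computedValue h G) S.vStar ε
  /-- In general, the error on the value of the problem is at most `ε'`. -/
  value : Within (S.computedValue h G) S.vStar ε'

end Setup

/-- The bound `K f |log f|^q` in `g = Õ(f)`. -/
def softO (K : ℝ) (q : ℕ) (f : ℝ) : ℝ := K * (f * |Real.log f| ^ q)

end FastMarching

end

namespace FastMarching

/-! ### Comparison principle and correctness of partial fast marching -/

namespace UpdateOperator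

variable {d L : ℕ} (A : UpdateOperator d L) {H : ℝ}

/-! Monotonicity and causality of the update operator give a comparison principle for the discrete
equation. It shows that a partial search returns the exact solution at the accepted nodes, in
increasing order (`march_spec`), and that discarding nodes with large values leaves the small values
unchanged (`IsSolution.le_of_cut`).

The assumed error estimate concerns connected open subdomains, while the method works on irregular
finite grids. As `d ≥ 2`, removing from `Ω` the finitely many nodes outside the source, the
destination and the closure of `O_η` leaves a connected open set (`exists_subdomain`). The estimate
there and the cutting argument bound the error on every grid that contains all nodes with `F_v`
slightly above its infimum (`upper_of_cover`).

With `η = C_η H^γ`, each error at mesh step `H` is at most `θ₀ η / 100`. Hence each point with `F_v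
< inf F_v + θ₀ η` has an active node within sup-distance `H / 2`, and all active nodes have `F_v <
inf F_v + 2 η`. The first fact makes the next grid contain a full neighbourhood of the optimal
trajectories; if `mesh ^ γ` shrinks at least by the factor `2 / 5`, this carries over from level to
level (`IsMeshSeq.level`), and the last search is accurate (`accurate_last`).

The second fact and the stiffness assumption put the active nodes in tubes of radius of order `√d
H^{γβ}` around `n` Lipschitz paths. Such a tube is covered by about `H^{-γβ}` balls, and a Gaussian
weight argument bounds the nodes of a ball by `(C H^{γβ} / H)^d` with `C` independent of `d`. This
gives `n (C H^ν / H)^d` active nodes, and `n (C H^ν / h)^d` nodes of the next grid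
(`sum_around_le`).

The cost is the number of nodes times a logarithm, up to factors `C^d`. The mesh steps of the
`N`-level method make `1 / H_1` and all the quotients `H_l^ν / H_{l+1}` equal; with `N` of order
`log (1 / ε)`, the ratio `h^{1/N}` of consecutive steps tends to the constant `e^{-1/c}`. -/

theorem update_le_of_neighbors (hH : 0 < H) {V V' : Pt d → ℝ≥0∞} {y : Pt d}
    (h : ∀ z ∈ A.neighbors H y, V z ≤ V' z) : A.U H V y ≤ A.U H V' y := by
  classical
  have h1 : A.U H V y = A.U H (fun z => if z ∈ A.neighbors H y then V z else V' z) y :=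
    A.isLocal H hH _ _ _ (fun z hz => by simp [hz])
  rw [h1]
  refine A.monotone H hH _ _ (fun z => ?_) y
  by_cases hz : z ∈ A.neighbors H y
  · simpa [hz] using h z hz
  · simp [hz]

/-- By causality, only the values below `U V y` matter. -/
theorem update_le_of_forall_lt (hH : 0 < H) {V V' : Pt d → ℝ≥0∞} {y : Pt d}
    (h : ∀ z ∈ A.neighbors H y, V z < A.U H V y → V' z ≤ V z) : A.U H V' y ≤ A.U H V y := by
  classical
  rw [← A.causal H hH V (fun z => if V z < A.U H V y then V z else ⊤) y
    (fun z hz => by simp [hz]) (fun z hz => by simp [not_lt.mpr hz])]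
  refine A.update_le_of_neighbors hH (fun z hz => ?_)
  by_cases hz' : V z < A.U H V y
  · simpa [hz'] using h z hz hz'
  · simp [hz']

/-- Comparison principle between a supersolution `W` and a subsolution `W'`. -/
theorem comparison (hH : 0 < H) (X : Finset (Pt d)) {W W' : Pt d → ℝ≥0∞}
    (htop : ∀ y, y ∉ X → W y = ⊤)
    (h : ∀ y ∈ X, W y < ⊤ → W' y ≤ W y ∨ (A.U H W y ≤ W y ∧ W' y ≤ A.U H W' y)) :
    W' ≤ W := by
  classical
  by_contra hcon
  have hne : (X.filter (fun y => W y < W' y)).Nonempty := by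
    simp only [Pi.le_def, not_forall, not_le] at hcon
    obtain ⟨y, hy⟩ := hcon
    refine ⟨y, Finset.mem_filter.mpr ⟨?_, hy⟩⟩
    by_contra hyX
    rw [htop y hyX] at hy
    exact not_top_lt hy
  -- Take the violating node `y` with the smallest `W`. By causality only neighbours with a value
  -- below `A.U H W y ≤ W y` count, and these do not violate the inequality.
  obtain ⟨y, hy, hmin⟩ := Finset.exists_min_image _ W hne
  obtain ⟨hyX, hlt⟩ := Finset.mem_filter.mp hy
  rcases h y hyX (lt_of_lt_of_le hlt le_top) with h1 | ⟨h1, h2⟩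
  · exact absurd hlt (not_lt.mpr h1)
  · have h3 : A.U H W' y ≤ A.U H W y := by
      refine A.update_le_of_forall_lt hH (fun z _ hz => ?_)
      by_contra hz'
      have hzX : z ∈ X := by
        by_contra hzX
        rw [htop z hzX] at hz
        exact not_top_lt hz
      have := hmin z (Finset.mem_filter.mpr ⟨hzX, not_le.mp hz'⟩)
      exact absurd (hz.trans_le h1) (not_lt.mpr this)
    exact absurd hlt (not_lt.mpr (h2.trans (h3.trans h1)))

/-- Solutions of the discrete equation on the node set `X`. -/
structure IsSolution (H : ℝ) (X start : Finset (Pt d)) (W : Pt d → ℝ≥0∞) : Prop where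
  zero : ∀ x ∈ start, W x = 0
  top : ∀ x, x ∉ X → W x = ⊤
  eq : ∀ x ∈ X, x ∉ start → W x = A.U H W x

variable {A}

theorem IsSolution.mono {X X' start start' : Finset (Pt d)} {W W' : Pt d → ℝ≥0∞}
    (h : A.IsSolution H X start W) (h' : A.IsSolution H X' start' W') (hH : 0 < H)
    (hX : X ⊆ X') (hs : start ⊆ start') : W' ≤ W := by
  refine A.comparison hH X h.top (fun y hy _ => ?_)
  by_cases hys : y ∈ start'
  · left; rw [h'.zero y hys]; exact zero_le
  · right
    exact ⟨(h.eq y hy (fun hh => hys (hs hh))).ge, (h'.eq y (hX hy) hys).le⟩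

/-- Removing nodes with large values, and starting nodes that are neighbours of no other node,
does not change the small values. -/
theorem IsSolution.le_of_cut {X X' start start' : Finset (Pt d)} {W W' : Pt d → ℝ≥0∞}
    (h : A.IsSolution H X start W) (h' : A.IsSolution H X' start' W') (hH : 0 < H)
    (hss : ∀ z ∈ start', z ∈ X → z ∈ start) {c : ℝ≥0∞}
    (hc : ∀ z ∈ X', z ∉ start' → z ∉ X → c ≤ W' z)
    (hcut : ∀ z ∈ start', z ∉ X → ∀ y ∈ X', y ∉ start' → z ∉ A.neighbors H y) {x : Pt d}
    (hx : x ∈ X) (hxc : W' x < c) : W x ≤ W' x := by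
  classical
  -- `W'`, set to `∞` off `X` and at values not below `c`, is still a supersolution: a neighbour
  -- that matters at `y` has a value below `W' y < c`, so it could be missing from `X` only as a
  -- starting node, which `hcut` excludes.
  have key : W ≤ fun z => if z ∈ X ∧ W' z < c then W' z else ⊤ := by
    refine A.comparison hH X (fun y hy => by simp [hy]) (fun y hy hlt => ?_)
    have hyc : W' y < c := by
      by_contra hh
      simp [hh] at hlt
    have hyX' : y ∈ X' := by
      by_contra hh
      rw [h'.top y hh] at hyc
      exact not_top_lt hyc
    by_cases hys : y ∈ start
    · left; rw [h.zero y hys]; exact zero_le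
    · right
      refine ⟨?_, (h.eq y hy hys).le⟩
      have hys' : y ∉ start' := fun hh => hys (hss y hh hy)
      simp only [hy, hyc, and_self, if_true]
      rw [h'.eq y hyX' hys']
      refine A.update_le_of_forall_lt hH (fun z hz hzlt => ?_)
      rw [← h'.eq y hyX' hys'] at hzlt
      have hzX : z ∈ X := by
        by_contra hzX
        have hzX' : z ∈ X' := by
          by_contra hh
          rw [h'.top z hh] at hzlt
          exact not_top_lt hzlt
        by_cases hzs : z ∈ start'
        · exact hcut z hzs hzX y hyX' hys' hz
        · exact absurd (hzlt.trans hyc) (not_lt.mpr (hc z hzX' hzs hzX))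
      simp [hzX, hzlt.trans hyc]
  have := key x
  simpa [hx, hxc] using this

/-- A finite value outside of the start requires a node outside of the start that has a starting
node as a neighbour. -/
theorem IsSolution.exists_adjacent {X start : Finset (Pt d)} {W : Pt d → ℝ≥0∞}
    (h : A.IsSolution H X start W) (hH : 0 < H) {x : Pt d} (hx : x ∉ start) (hfin : W x < ⊤) :
    ∃ y ∈ X, y ∉ start ∧ ∃ k ∈ start, k ∈ A.neighbors H y := by
  classical
  by_contra hcon
  push Not at hcon
  have hne : (X.filter (fun y => y ∉ start ∧ W y < ⊤)).Nonempty := by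
    refine ⟨x, Finset.mem_filter.mpr ⟨?_, hx, hfin⟩⟩
    by_contra hh
    rw [h.top x hh] at hfin
    exact not_top_lt hfin
  obtain ⟨y, hy, hmin⟩ := Finset.exists_min_image _ W hne
  obtain ⟨hyX, hys, hyf⟩ := Finset.mem_filter.mp hy
  -- At the least finite value outside the start no neighbour is smaller: starting neighbours are
  -- excluded, others would contradict minimality. By causality the update is the one from `∞`
  -- everywhere.
  have h1 : A.U H (fun _ => ⊤) y ≤ A.U H W y := by
    refine A.update_le_of_forall_lt hH (fun z hz hzlt => ?_)
    exfalso
    rw [← h.eq y hyX hys] at hzlt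
    have hzs : z ∉ start := fun hh => hcon y hyX hys z hh hz
    have hzX : z ∈ X := by
      by_contra hh
      rw [h.top z hh] at hzlt
      exact not_top_lt hzlt
    exact absurd hzlt (not_lt.mpr
      (hmin z (Finset.mem_filter.mpr ⟨hzX, hzs, hzlt.trans_le le_top⟩)))
  rw [A.top H hH, ← h.eq y hyX hys] at h1
  exact absurd hyf (not_lt.mpr h1)

variable (A)

/-- The invariants of the fast marching method. -/
structure Invariant (H : ℝ) (X start : Finset (Pt d)) (s : MarchState d) : Prop where
  accepted_subset : s.accepted ⊆ X
  narrow_subset : s.narrow ⊆ X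
  disjoint : ∀ x ∈ s.narrow, x ∉ s.accepted
  start_subset : start ⊆ s.accepted
  zero : ∀ x ∈ start, s.V x = 0
  top : ∀ x, x ∉ s.accepted → x ∉ s.narrow → s.V x = ⊤
  super : ∀ y, y ∉ start → A.U H s.V y ≤ s.V y
  order : ∀ a ∈ s.accepted, ∀ y, y ∉ s.accepted → s.V a ≤ s.V y
  sub : ∀ y ∈ s.accepted, y ∉ start → s.V y ≤ A.U H s.V y
  -- Values of nodes not yet accepted are no larger than what the accepted values alone produce: a
  -- node is updated when one of its neighbours is accepted, and other acceptances do not affect its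
  -- update.
  pending : ∀ y ∈ X, y ∉ s.accepted → ∀ W : Pt d → ℝ≥0∞,
    (∀ z, z ∉ s.accepted → W z = ⊤) → (∀ z ∈ s.accepted, W z = s.V z) → s.V y ≤ A.U H W y

theorem invariant_initState (hH : 0 < H) {X start : Finset (Pt d)} (hs : start ⊆ X) :
    A.Invariant H X start (A.initState H X start) := by
  classical
  have hle : (A.initState H X start).V ≤ fun x => if x ∈ start then 0 else ⊤ := by
    intro x
    by_cases hx : x ∈ start <;> simp [initState, hx]
  constructor
  · exact hs
  · intro x hx
    simp only [initState] at hx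
    exact (Finset.mem_filter.mp hx).1
  · intro x hx
    simp only [initState] at hx ⊢
    exact (Finset.mem_filter.mp hx).2.1
  · exact fun x hx => hx
  · intro x hx
    simp [initState, hx]
  · intro x hx hn
    simp only [initState] at hx hn ⊢
    rw [if_neg (by simpa using hn), if_neg hx]
  · intro y hy
    refine (A.monotone H hH _ _ hle y).trans ?_
    by_cases hY : y ∈ (A.initState H X start).narrow
    · simp only [initState] at hY ⊢
      rw [if_pos (by simpa using hY)]
    · have : (A.initState H X start).V y = ⊤ := by
        simp only [initState] at hY ⊢
        rw [if_neg (by simpa using hY), if_neg hy]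
      rw [this]; exact le_top
  · intro a ha y _
    have : (A.initState H X start).V a = 0 := by
      have ha' : a ∈ start := ha
      simp [initState, ha']
    rw [this]; exact zero_le
  · intro y hy hy'
    exact absurd hy hy'
  · intro y hyX hy W hW hW'
    have hWV : W = fun x => if x ∈ start then 0 else ⊤ := by
      funext z
      by_cases hz : z ∈ start
      · rw [hW' z hz]; simp [initState, hz]
      · rw [hW z hz]; simp [hz]
    by_cases hY : y ∈ (A.initState H X start).narrow
    · rw [hWV]
      simp only [initState] at hY ⊢
      rw [if_pos (by simpa using hY)]
    · have : A.U H W y = ⊤ := by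
        rw [← A.top H hH y]
        refine A.isLocal H hH _ _ _ (fun z hz => hW z (fun hzs => hY ?_))
        simp only [initState]
        exact Finset.mem_filter.mpr ⟨hyX, hy, z, hzs, hz⟩
      rw [this]; exact le_top

theorem step_eq_self {X ending : Finset (Pt d)} {s : MarchState d}
    (h : ¬ (s.narrow.Nonempty ∧ ¬ ending ⊆ s.accepted)) : A.step H X ending s = s := by
  rw [step, dif_neg h]

open scoped Classical in
/-- Description of an effective pass through the loop. -/
theorem exists_step {X ending : Finset (Pt d)} {s : MarchState d}
    (h : s.narrow.Nonempty ∧ ¬ ending ⊆ s.accepted) :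
    ∃ x ∈ s.narrow, (∀ y ∈ s.narrow, s.V x ≤ s.V y) ∧
      ∃ Y : Finset (Pt d), Y = X.filter (fun y => y ∉ insert x s.accepted ∧ x ∈ A.neighbors H y) ∧
      A.step H X ending s =
        { accepted := insert x s.accepted
          narrow := (s.narrow.erase x) ∪ Y
          V := fun y => if y ∈ Y then A.U H s.V y else s.V y
          ops := s.ops + 1 + heapCost s.narrow.card +
            A.updateCost H Y ((s.narrow.erase x) ∪ Y).card } := by
  have hx := (s.narrow.exists_min_image s.V h.1).choose_spec
  refine ⟨_, hx.1, hx.2, _, rfl, ?_⟩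
  rw [step, dif_pos h]

/-- Accepting the minimum of the narrow band is safe by causality: an update below this minimum
would use accepted values only, so by `pending` a node not yet accepted would already have a value
below the minimum. -/
theorem invariant_step (hH : 0 < H) {X start ending : Finset (Pt d)} {s : MarchState d}
    (hs : A.Invariant H X start s) : A.Invariant H X start (A.step H X ending s) := by
  classical
  by_cases h : s.narrow.Nonempty ∧ ¬ ending ⊆ s.accepted
  swap
  · rwa [A.step_eq_self h]
  obtain ⟨x, hx, hxmin, Y, hY, hstep⟩ := A.exists_step (H := H) (X := X) h
  rw [hstep]
  have hxacc : x ∉ s.accepted := hs.disjoint x hx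
  have hxX : x ∈ X := hs.narrow_subset hx
  have hxstart : x ∉ start := fun hh => hxacc (hs.start_subset hh)
  have memY : ∀ y, y ∈ Y ↔ y ∈ X ∧ (y ≠ x ∧ y ∉ s.accepted) ∧ x ∈ A.neighbors H y := by
    intro y; rw [hY]; simp
  have hmin : ∀ y, y ∉ s.accepted → s.V x ≤ s.V y := by
    intro y hy
    by_cases hyn : y ∈ s.narrow
    · exact hxmin y hyn
    · rw [hs.top y hy hyn]; exact le_top
  set V' : Pt d → ℝ≥0∞ := fun y => if y ∈ Y then A.U H s.V y else s.V y with hV'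
  have hV'Y : ∀ y ∈ Y, V' y = A.U H s.V y := fun y hy => by simp [hV', hy]
  have hV'n : ∀ y, y ∉ Y → V' y = s.V y := fun y hy => by simp [hV', hy]
  have hV'acc : ∀ y, (y = x ∨ y ∈ s.accepted) → V' y = s.V y := by
    intro y hy
    refine hV'n y (fun hh => ?_)
    have := ((memY y).mp hh).2.1
    tauto
  have hdec : V' ≤ s.V := by
    intro y
    by_cases hy : y ∈ Y
    · rw [hV'Y y hy]
      exact hs.super y (fun hh => ((memY y).mp hy).2.1.2 (hs.start_subset hh))
    · rw [hV'n y hy]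
  have pend : ∀ y ∈ X, y ∉ s.accepted → ∀ V : Pt d → ℝ≥0∞,
      (∀ z, V z < s.V x → z ∈ s.accepted ∧ V z = s.V z) → A.U H V y < s.V x → False := by
    intro y hyX hy V hV hlt
    have h1 := hs.pending y hyX hy (fun z => if z ∈ s.accepted then s.V z else ⊤)
      (fun z hz => by simp [hz]) (fun z hz => by simp [hz])
    have h2 : A.U H (fun z => if z ∈ s.accepted then s.V z else ⊤) y ≤ A.U H V y := by
      refine A.update_le_of_forall_lt hH (fun z _ hz => ?_)
      obtain ⟨h3, h4⟩ := hV z (hz.trans hlt)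
      simp [h3, h4]
    exact absurd (hmin y hy) (not_le.mpr ((h1.trans h2).trans_lt hlt))
  have hnew : ∀ y, y ∉ s.accepted → s.V x ≤ V' y := by
    intro y hy
    by_cases hyY : y ∈ Y
    · rw [hV'Y y hyY]
      by_contra hcon
      refine pend y ((memY y).mp hyY).1 hy s.V (fun z hz => ⟨?_, rfl⟩) (not_le.mp hcon)
      by_contra hz'
      exact absurd hz (not_lt.mpr (hmin z hz'))
    · rw [hV'n y hyY]; exact hmin y hy
  constructor <;> dsimp only
  · intro y hy
    rcases Finset.mem_insert.mp hy with rfl | hy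
    · exact hxX
    · exact hs.accepted_subset hy
  · intro y hy
    rcases Finset.mem_union.mp hy with hy | hy
    · exact hs.narrow_subset (Finset.mem_of_mem_erase hy)
    · exact ((memY y).mp hy).1
  · intro y hy
    simp only [Finset.mem_insert, not_or]
    rcases Finset.mem_union.mp hy with hy | hy
    · exact ⟨Finset.ne_of_mem_erase hy, hs.disjoint y (Finset.mem_of_mem_erase hy)⟩
    · exact ((memY y).mp hy).2.1
  · exact fun y hy => Finset.mem_insert_of_mem (hs.start_subset hy)
  · intro y hy
    rw [hV'acc y (Or.inr (hs.start_subset hy))]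
    exact hs.zero y hy
  · intro y hy hn
    simp only [Finset.mem_insert, not_or] at hy
    simp only [Finset.mem_union, Finset.mem_erase, not_or, not_and] at hn
    rw [hV'n y hn.2]
    exact hs.top y hy.2 (hn.1 hy.1)
  · intro y hy
    refine (A.monotone H hH _ _ hdec y).trans ?_
    by_cases hyY : y ∈ Y
    · exact (hV'Y y hyY).ge
    · rw [hV'n y hyY]; exact hs.super y hy
  · intro a ha y hy
    simp only [Finset.mem_insert, not_or] at ha hy
    rw [hV'acc a ha]
    refine le_trans ?_ (hnew y hy.2)
    rcases ha with rfl | ha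
    · exact le_rfl
    · exact hs.order a ha x hxacc
  · intro y hy hys
    simp only [Finset.mem_insert] at hy
    rw [hV'acc y hy]
    by_contra hcon
    rw [not_le] at hcon
    have hVz : ∀ z, V' z < s.V y → z ∈ s.accepted ∧ V' z = s.V z := by
      intro z hz
      have hyx : s.V y ≤ s.V x := by
        rcases hy with rfl | hy
        · exact le_rfl
        · exact hs.order y hy x hxacc
      have hzacc : z ∈ s.accepted := by
        by_contra hz'
        exact absurd (hz.trans_le hyx) (not_lt.mpr (hnew z hz'))
      exact ⟨hzacc, hV'acc z (Or.inr hzacc)⟩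
    rcases hy with rfl | hy
    · exact pend y hxX hxacc V' hVz hcon
    · have h2 : A.U H s.V y ≤ A.U H V' y := by
        refine A.update_le_of_forall_lt hH (fun z _ hz => ?_)
        exact (hVz z (hz.trans hcon)).2.ge
      exact absurd (hs.sub y hy hys) (not_le.mpr (h2.trans_lt hcon))
  · intro y hyX hy W hW hW'
    simp only [Finset.mem_insert, not_or] at hy hW hW'
    by_cases hyY : y ∈ Y
    · rw [hV'Y y hyY]
      refine A.monotone H hH _ _ (fun z => ?_) y
      by_cases hz : z = x ∨ z ∈ s.accepted
      · rw [hW' z hz, hV'acc z hz]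
      · rw [hW z (by tauto)]; exact le_top
    · rw [hV'n y hyY]
      have hxy : x ∉ A.neighbors H y := fun hh => hyY ((memY y).mpr ⟨hyX, hy, hh⟩)
      refine (hs.pending y hyX hy.2 (fun z => if z ∈ s.accepted then s.V z else ⊤)
        (fun z hz => by simp [hz]) (fun z hz => by simp [hz])).trans ?_
      refine A.update_le_of_neighbors hH (fun z hz => ?_)
      by_cases hzacc : z ∈ s.accepted
      · simp only [hzacc, if_true]
        rw [hW' z (Or.inr hzacc), hV'acc z (Or.inr hzacc)]
      · rw [hW z ⟨fun hh => hxy (hh ▸ hz), hzacc⟩]; exact le_top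

theorem invariant_march (hH : 0 < H) {X start ending : Finset (Pt d)} (hs : start ⊆ X) :
    A.Invariant H X start (A.march H X start ending) := by
  rw [march]
  generalize X.card = k
  induction k with
  | zero => exact A.invariant_initState hH hs
  | succ k ih => rw [Function.iterate_succ_apply']; exact A.invariant_step hH ih

/-- Each effective pass accepts a new node. After `X.card` of them all of `X` is accepted, and the
narrow band, contained in `X` and disjoint from the accepted nodes, is empty. -/
theorem march_done (hH : 0 < H) {X start ending : Finset (Pt d)} (hs : start ⊆ X) :
    (A.march H X start ending).narrow = ∅ ∨ ending ⊆ (A.march H X start ending).accepted := by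
  classical
  have key : ∀ k, let s := (A.step H X ending)^[k] (A.initState H X start)
      (s.narrow = ∅ ∨ ending ⊆ s.accepted) ∨ k ≤ s.accepted.card := by
    intro k
    induction k with
    | zero => right; exact Nat.zero_le _
    | succ k ih =>
      simp only [Function.iterate_succ_apply']
      have hinv : A.Invariant H X start ((A.step H X ending)^[k] (A.initState H X start)) := by
        clear ih
        induction k with
        | zero => exact A.invariant_initState hH hs
        | succ k ih => rw [Function.iterate_succ_apply']; exact A.invariant_step hH ih
      generalize (A.step H X ending)^[k] (A.initState H X start) = s at ih hinv
      by_cases h : s.narrow.Nonempty ∧ ¬ ending ⊆ s.accepted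
      · obtain ⟨x, hx, -, Y, -, hstep⟩ := A.exists_step (H := H) (X := X) h
        right
        rw [hstep]
        simp only
        rw [Finset.card_insert_of_notMem (hinv.disjoint x hx)]
        rcases ih with ih | ih
        · rcases ih with ih | ih
          · rw [ih] at h; exact absurd h.1 Finset.not_nonempty_empty
          · exact absurd ih h.2
        · omega
      · left
        rw [A.step_eq_self h]
        rw [not_and_or, Finset.not_nonempty_iff_eq_empty, not_not] at h
        exact h
  have hinv := A.invariant_march (ending := ending) hH hs
  rcases key X.card with h | h
  · exact h
  · left
    have : (A.march H X start ending).accepted = X :=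
      Finset.eq_of_subset_of_card_le hinv.accepted_subset h
    refine Finset.eq_empty_of_forall_notMem (fun x hx => ?_)
    exact hinv.disjoint x hx (by rw [this]; exact hinv.narrow_subset hx)

/-- The full fast marching method solves the discrete equation. -/
theorem isSolution_march (hH : 0 < H) {X start ending : Finset (Pt d)} (hs : start ⊆ X)
    (he : X ⊆ ending) : A.IsSolution H X start (A.march H X start ending).V := by
  classical
  have hinv := A.invariant_march (ending := ending) hH hs
  have hdone := A.march_done (ending := ending) hH hs
  generalize A.march H X start ending = s at hinv hdone
  refine ⟨hinv.zero, fun x hx => ?_, fun x hx hxs => ?_⟩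
  · exact hinv.top x (fun hh => hx (hinv.accepted_subset hh))
      (fun hh => hx (hinv.narrow_subset hh))
  · refine le_antisymm ?_ (hinv.super x hxs)
    by_cases hxa : x ∈ s.accepted
    · exact hinv.sub x hxa hxs
    · rcases hdone with h | h
      · refine hinv.pending x hx hxa s.V (fun z hz => ?_) (fun z _ => rfl)
        exact hinv.top z hz (by simp [h])
      · exact absurd (h (he hx)) hxa

/-- The partial fast marching method computes the solution `W` at the accepted nodes, in
increasing order. -/
theorem march_spec (hH : 0 < H) {X start ending : Finset (Pt d)} (hs : start ⊆ X)
    {W : Pt d → ℝ≥0∞} (hW : A.IsSolution H X start W) :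
    W ≤ (A.march H X start ending).V ∧
    (∀ x ∈ (A.march H X start ending).accepted, (A.march H X start ending).V x = W x) ∧
    ∀ x ∈ X, x ∉ (A.march H X start ending).accepted → W x < ⊤ →
      ending ⊆ (A.march H X start ending).accepted ∧
      ∀ a ∈ (A.march H X start ending).accepted, W a ≤ W x := by
  classical
  have hinv := A.invariant_march (ending := ending) hH hs
  have hdone := A.march_done (ending := ending) hH hs
  generalize A.march H X start ending = s at hinv hdone
  have hle : W ≤ s.V := by
    refine A.comparison hH X (fun y hy => ?_) (fun y hy _ => ?_)
    · exact hinv.top y (fun hh => hy (hinv.accepted_subset hh))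
        (fun hh => hy (hinv.narrow_subset hh))
    · by_cases hys : y ∈ start
      · left; rw [hW.zero y hys]; exact zero_le
      · right; exact ⟨hinv.super y hys, (hW.eq y hy hys).le⟩
  -- `M` is the largest accepted value. Replacing the values at all other nodes by `M` gives a
  -- subsolution `W'`; from `W' ≤ W` follow both the equality at accepted nodes and `M ≤ W`
  -- elsewhere.
  set M : ℝ≥0∞ := s.accepted.sup s.V with hM
  have hMle : ∀ a ∈ s.accepted, s.V a ≤ M := fun a ha => Finset.le_sup ha
  have hMnot : ∀ y, y ∉ s.accepted → M ≤ s.V y := fun y hy =>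
    Finset.sup_le (fun a ha => hinv.order a ha y hy)
  set W' : Pt d → ℝ≥0∞ := fun z => if z ∈ s.accepted then s.V z else M with hW'
  have hW'a : ∀ z ∈ s.accepted, W' z = s.V z := fun z hz => by simp [hW', hz]
  have hW'n : ∀ z, z ∉ s.accepted → W' z = M := fun z hz => by simp [hW', hz]
  have hcmp : W' ≤ W := by
    refine A.comparison hH X hW.top (fun y hy _ => ?_)
    by_cases hys : y ∈ start
    · left; rw [hW'a y (hinv.start_subset hys), hinv.zero y hys]; exact zero_le
    · right
      refine ⟨(hW.eq y hy hys).ge, ?_⟩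
      by_contra hcon
      rw [not_le] at hcon
      have hlt : ∀ z, W' z < M → z ∈ s.accepted := by
        intro z hz
        by_contra hz'
        rw [hW'n z hz'] at hz
        exact lt_irrefl _ hz
      by_cases hya : y ∈ s.accepted
      · rw [hW'a y hya] at hcon
        have h2 : A.U H s.V y ≤ A.U H W' y := by
          refine A.update_le_of_forall_lt hH (fun z _ hz => ?_)
          exact (hW'a z (hlt z ((hz.trans hcon).trans_le (hMle y hya)))).ge
        exact absurd (hinv.sub y hya hys) (not_le.mpr (h2.trans_lt hcon))
      · rw [hW'n y hya] at hcon
        have h1 := hinv.pending y hy hya (fun z => if z ∈ s.accepted then s.V z else ⊤)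
          (fun z hz => by simp [hz]) (fun z hz => by simp [hz])
        have h2 : A.U H (fun z => if z ∈ s.accepted then s.V z else ⊤) y ≤ A.U H W' y := by
          refine A.update_le_of_forall_lt hH (fun z _ hz => ?_)
          have hz' := hlt z (hz.trans hcon)
          simp [hz', hW'a z hz']
        exact absurd (hMnot y hya) (not_le.mpr ((h1.trans h2).trans_lt hcon))
  have hacc : ∀ x ∈ s.accepted, s.V x = W x := fun x hx =>
    le_antisymm ((hW'a x hx).ge.trans (hcmp x)) (hle x)
  refine ⟨hle, hacc, fun x hx hxa hfin => ?_⟩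
  have hMx : M ≤ W x := (hW'n x hxa).ge.trans (hcmp x)
  rcases hdone with h | h
  -- With an empty narrow band `s.V` itself is a subsolution, so `s.V ≤ W`, although `s.V x = ⊤` and
  -- `W x` is finite.
  · exfalso
    have hsub : s.V x ≤ W x := by
      have : s.V ≤ W := by
        refine A.comparison hH X hW.top (fun y hy _ => ?_)
        by_cases hys : y ∈ start
        · left; rw [hinv.zero y hys]; exact zero_le
        · right
          refine ⟨(hW.eq y hy hys).ge, ?_⟩
          by_cases hya : y ∈ s.accepted
          · exact hinv.sub y hya hys
          · refine hinv.pending y hy hya s.V (fun z hz => ?_) (fun z _ => rfl)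
            exact hinv.top z hz (by simp [h])
      exact this x
    rw [hinv.top x hxa (by simp [h])] at hsub
    exact absurd hfin (not_lt.mpr hsub)
  · exact ⟨h, fun a ha => (hacc a ha).ge.trans ((hMle a ha).trans hMx)⟩

end UpdateOperator
-- Lattice offsets and operations of one search
theorem card_le_card_of_lattice {d : ℕ} (T : Finset (Pt d)) (o : Pt d) (H : ℝ)
    (K : Finset (Fin d → ℤ)) (h : ∀ z ∈ T, ∃ k ∈ K, ∀ i, z i = o i + H * k i) :
    T.card ≤ K.card := by
  classical
  have hsub : T ⊆ K.image (fun k : Fin d → ℤ =>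
      (WithLp.toLp 2 (fun i => o i + H * (k i : ℝ)) : Pt d)) := by
    intro z hz
    obtain ⟨k, hk, hkz⟩ := h z hz
    refine Finset.mem_image.mpr ⟨k, hk, ?_⟩
    ext i
    simp [hkz i]
  exact (Finset.card_le_card hsub).trans Finset.card_image_le

theorem card_le_of_offset {d : ℕ} (T : Finset (Pt d)) (o : Pt d) (H : ℝ) (L : ℕ)
    (h : ∀ z ∈ T, ∀ i, ∃ k : ℤ, |k| ≤ (L : ℤ) ∧ z i = o i + H * k) :
    T.card ≤ (2 * L + 1) ^ d := by
  classical
  refine (card_le_card_of_lattice T o H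
    (Fintype.piFinset (fun _ : Fin d => Finset.Icc (-(L : ℤ)) L)) (fun z hz => ?_)).trans ?_
  · choose k hk hk' using h z hz
    exact ⟨k, Fintype.mem_piFinset.mpr (fun i => Finset.mem_Icc.mpr (abs_le.mp (hk i))), hk'⟩
  · rw [Fintype.card_piFinset_const, Int.card_Icc]
    refine le_of_eq (congrArg (· ^ d) ?_)
    omega

theorem heapCost_mono {a b : ℕ} (h : a ≤ b) : heapCost a ≤ heapCost b :=
  Nat.succ_le_succ (Nat.log_mono_right h)

theorem one_le_heapCost (a : ℕ) : 1 ≤ heapCost a := Nat.succ_le_succ (Nat.zero_le _)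

namespace UpdateOperator

variable {d L : ℕ} (A : UpdateOperator d L) {H : ℝ}

theorem card_neighbors_le (hH : 0 < H) (y : Pt d) :
    (A.neighbors H y).card ≤ (2 * L + 1) ^ d :=
  card_le_of_offset _ y H L (A.neighbors_offset H hH y)

theorem updateCost_le (hH : 0 < H) (Y : Finset (Pt d)) {m M : ℕ} (hm : m ≤ M) :
    A.updateCost H Y m ≤ Y.card * ((2 * L + 1) ^ d + 1 + heapCost M) := by
  rw [updateCost, ← smul_eq_mul]
  refine Finset.sum_le_card_nsmul _ _ _ (fun y _ => ?_)
  have := A.card_neighbors_le hH y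
  have := heapCost_mono hm
  omega

/-- The number of operations of the fast marching method. -/
theorem ops_march_le (hH : 0 < H) {X start ending : Finset (Pt d)} (hs : start ⊆ X) :
    (A.march H X start ending).ops ≤
      10 * (X.card * (((2 * L + 1) ^ d) ^ 2 * heapCost X.card)) := by
  classical
  set B := (2 * L + 1) ^ d with hB
  set c := heapCost X.card with hc
  have key : ∀ k, A.Invariant H X start ((A.step H X ending)^[k] (A.initState H X start)) ∧
      ((A.step H X ending)^[k] (A.initState H X start)).ops ≤
        X.card + X.card * (B + 1 + c) + k * (1 + c + B * (B + 1 + c)) := by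
    intro k
    induction k with
    | zero =>
      refine ⟨A.invariant_initState hH hs, ?_⟩
      simp only [Function.iterate_zero, id, initState, zero_mul, add_zero]
      refine Nat.add_le_add_left ?_ _
      refine (A.updateCost_le hH _ (Finset.card_filter_le X _)).trans ?_
      exact Nat.mul_le_mul_right _ (Finset.card_filter_le X _)
    | succ k ih =>
      rw [Function.iterate_succ_apply']
      refine ⟨A.invariant_step hH ih.1, ?_⟩
      obtain ⟨hinv, hops⟩ := ih
      generalize (A.step H X ending)^[k] (A.initState H X start) = s at hinv hops
      by_cases h : s.narrow.Nonempty ∧ ¬ ending ⊆ s.accepted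
      · have hinv' := A.invariant_step (ending := ending) hH hinv
        obtain ⟨x, hx, -, Y, hY, hstep⟩ := A.exists_step (H := H) (X := X) h
        rw [hstep] at hinv' ⊢
        have h1 : heapCost s.narrow.card ≤ c :=
          heapCost_mono (Finset.card_le_card hinv.narrow_subset)
        have h2 := A.updateCost_le hH Y (Finset.card_le_card hinv'.narrow_subset)
        -- The nodes that have `x` as a neighbour are at opposite offsets from `x`, so they obey the
        -- same bound as the neighbours of a node.
        have h3 : Y.card ≤ B := by
          refine card_le_of_offset Y x H L (fun z hz i => ?_)
          rw [hY] at hz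
          obtain ⟨k, hk, hk'⟩ := A.neighbors_offset H hH z x (Finset.mem_filter.mp hz).2.2 i
          exact ⟨-k, by rwa [abs_neg], by rw [hk']; push_cast; ring⟩
        have h4 := h2.trans (Nat.mul_le_mul_right _ h3)
        simp only
        simp only at h4
        rw [Nat.succ_mul]
        simp only [← hB, ← hc] at h4
        omega
      · rw [A.step_eq_self h]
        refine hops.trans (Nat.add_le_add_left (Nat.mul_le_mul_right _ (Nat.le_succ k)) _)
  refine (key X.card).2.trans ?_
  have hB1 : 1 ≤ B := Nat.one_le_pow _ _ (by omega)
  have hc1 : 1 ≤ c := one_le_heapCost _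
  have : 1 + (B + 1 + c) + (1 + c + B * (B + 1 + c)) ≤ 10 * (B ^ 2 * c) := by
    have e1 : B ≤ B ^ 2 := by nlinarith
    have e2 : B ^ 2 ≤ B ^ 2 * c := Nat.le_mul_of_pos_right _ hc1
    have e3 : B * c ≤ B ^ 2 * c := Nat.mul_le_mul_right _ e1
    have e4 : c ≤ B * c := Nat.le_mul_of_pos_left _ hB1
    nlinarith
  calc _ = X.card * (1 + (B + 1 + c) + (1 + c + B * (B + 1 + c))) := by ring
    _ ≤ X.card * (10 * (B ^ 2 * c)) := Nat.mul_le_mul_left _ this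
    _ = _ := by ring

end UpdateOperator
end FastMarching

/-! ### Calculus of trajectories -/

namespace FastMarching
namespace Problem

variable {d : ℕ} (p : Problem d)

/-- The velocity of a trajectory is integrable. -/
theorem intervalIntegrable_velocity (σ : ℝ) {τ : ℝ} {y α : ℝ → Pt d}
    (hy : ContinuousOn y (Icc 0 τ)) (hyΩ : ∀ t ∈ Icc 0 τ, y t ∈ closure p.Ω)
    (hα : Measurable α) (hα1 : ∀ t, ‖α t‖ = 1) {a b : ℝ} (ha : a ∈ Icc 0 τ) (hb : b ∈ Icc 0 τ) :
    IntervalIntegrable (fun s => (σ * p.f (y s) (α s)) • α s) volume a b := by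
  obtain ⟨M, hM⟩ := p.f_bounded
  have hτ : 0 ≤ τ := ha.1.trans ha.2
  suffices h : IntegrableOn (fun s => (σ * p.f (y s) (α s)) • α s) (Icc 0 τ) by
    refine IntegrableOn.intervalIntegrable (h.mono_set ?_)
    exact Set.uIcc_subset_Icc ha hb
  -- `projIcc` extends `y` continuously beyond `Icc 0 τ`, and `f` is extended by zero off the closed
  -- set where it is continuous; on `Icc 0 τ` the resulting measurable integrand is the original
  -- one.
  have hy' : Measurable (fun s => y (projIcc 0 τ hτ s)) := by
    refine Continuous.measurable ?_
    exact (continuousOn_iff_continuous_domRestrict.mp hy).comp continuous_projIcc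
  have hC : MeasurableSet (closure p.Ω ×ˢ Metric.sphere (0 : Pt d) 1) :=
    (isClosed_closure.prod Metric.isClosed_sphere).measurableSet
  classical
  have hg := ContinuousOn.measurable_piecewise p.f_continuous
    (continuousOn_const (c := (0 : ℝ))) hC
  have hm : AEStronglyMeasurable (fun s => (σ * p.f (y s) (α s)) • α s)
      (volume.restrict (Icc 0 τ)) := by
    have h1 : Measurable (fun s => (σ * (closure p.Ω ×ˢ Metric.sphere (0 : Pt d) 1).piecewise
        (fun z : Pt d × Pt d => p.f z.1 z.2) (fun _ => 0) (y (projIcc 0 τ hτ s), α s)) • α s) :=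
      ((hg.comp (hy'.prodMk hα)).const_mul σ).smul hα
    refine h1.aestronglyMeasurable.congr ?_
    filter_upwards [ae_restrict_mem measurableSet_Icc] with s hs
    rw [projIcc_of_mem hτ hs]
    have : (y s, α s) ∈ closure p.Ω ×ˢ Metric.sphere (0 : Pt d) 1 := by
      refine ⟨hyΩ s hs, ?_⟩
      simp [hα1 s]
    simp only [Set.piecewise, this, if_true]
  refine Integrable.of_bound hm (|σ| * M) ?_
  filter_upwards [ae_restrict_mem measurableSet_Icc] with s hs
  have hs1 : α s ∈ Metric.sphere (0 : Pt d) 1 := by simp [hα1 s]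
  rw [norm_smul, hα1 s, mul_one, Real.norm_eq_abs, abs_mul,
    abs_of_pos (p.f_pos _ (hyΩ s hs) _ hs1)]
  exact mul_le_mul_of_nonneg_left (hM _ (hyΩ s hs) _ hs1) (abs_nonneg _)

namespace IsTrajectory

variable {p} {σ τ : ℝ} {x : Pt d} {y : ℝ → Pt d}

theorem start (h : p.IsTrajectory σ x τ y) (hτ : 0 ≤ τ) : y 0 = x := by
  obtain ⟨-, -, α, -, -, h⟩ := h
  simpa using h 0 ⟨le_rfl, hτ⟩

theorem tail (h : p.IsTrajectory σ x τ y) {a : ℝ} (ha : a ∈ Icc 0 τ) :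
    p.IsTrajectory σ (y a) (τ - a) (fun t => y (a + t)) := by
  obtain ⟨hc, hΩ, α, hα, hα1, h⟩ := h
  have hmem : ∀ t ∈ Icc 0 (τ - a), a + t ∈ Icc 0 τ := fun t ht =>
    ⟨by linarith [ha.1, ht.1], by linarith [ht.2]⟩
  refine ⟨hc.comp (by fun_prop) hmem, fun t ht => hΩ _ (hmem t ht), fun t => α (a + t),
    hα.comp (measurable_const_add a), fun t => hα1 _, fun t ht => ?_⟩
  have h0 : (0 : ℝ) ∈ Icc 0 τ := ⟨le_rfl, ha.1.trans ha.2⟩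
  have e := intervalIntegral.integral_comp_add_left (a := (0 : ℝ)) (b := t)
    (fun s => (σ * p.f (y s) (α s)) • α s) a
  simp only at e ⊢
  rw [e, h a ha, h (a + t) (hmem t ht), add_zero, add_assoc,
    intervalIntegral.integral_add_adjacent_intervals
      (p.intervalIntegrable_velocity σ hc hΩ hα hα1 h0 ha)
      (p.intervalIntegrable_velocity σ hc hΩ hα hα1 ha (hmem t ht))]

/-- The control at time `a - t` is kept and the sign goes into `σ`. This links times from the
source, defined by the reverse dynamics, with times to the destination. -/
theorem reverse (h : p.IsTrajectory σ x τ y) {a : ℝ} (ha : a ∈ Icc 0 τ) :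
    p.IsTrajectory (-σ) (y a) a (fun t => y (a - t)) := by
  obtain ⟨hc, hΩ, α, hα, hα1, h⟩ := h
  have hmem : ∀ t ∈ Icc 0 a, a - t ∈ Icc 0 τ := fun t ht =>
    ⟨by linarith [ht.2], by linarith [ha.2, ht.1]⟩
  refine ⟨hc.comp (by fun_prop) hmem, fun t ht => hΩ _ (hmem t ht), fun t => α (a - t),
    hα.comp (measurable_const_sub a), fun t => hα1 _, fun t ht => ?_⟩
  have h0 : (0 : ℝ) ∈ Icc 0 τ := ⟨le_rfl, ha.1.trans ha.2⟩
  have e := intervalIntegral.integral_comp_sub_left (a := (0 : ℝ)) (b := t)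
    (fun s => (σ * p.f (y s) (α s)) • α s) a
  have e2 := intervalIntegral.integral_add_adjacent_intervals
      (p.intervalIntegrable_velocity σ hc hΩ hα hα1 h0 (hmem t ht))
      (p.intervalIntegrable_velocity σ hc hΩ hα hα1 (hmem t ht) ha)
  simp only [neg_mul, neg_smul, intervalIntegral.integral_neg] at e ⊢
  rw [e, h a ha, h (a - t) (hmem t ht), sub_zero, ← e2]
  abel

theorem concat (h : p.IsTrajectory σ x τ y) (hτ : 0 ≤ τ) {τ' : ℝ} {y' : ℝ → Pt d}
    (h' : p.IsTrajectory σ (y τ) τ' y') (hτ' : 0 ≤ τ') :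
    p.IsTrajectory σ x (τ + τ') (fun t => if t ≤ τ then y t else y' (t - τ)) := by
  have hy'0 := h'.start hτ'
  obtain ⟨hc, hΩ, α, hα, hα1, h⟩ := h
  obtain ⟨hc', hΩ', α', hα', hα1', h'⟩ := h'
  set Y : ℝ → Pt d := fun t => if t ≤ τ then y t else y' (t - τ) with hY
  set B : ℝ → Pt d := fun t => if t ≤ τ then α t else α' (t - τ) with hB
  have hBm : Measurable B :=
    Measurable.ite measurableSet_Iic hα (hα'.comp (measurable_id.sub_const τ))
  have hB1 : ∀ t, ‖B t‖ = 1 := fun t => by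
    by_cases ht : t ≤ τ <;> simp [hB, ht, hα1, hα1']
  have hYc : ContinuousOn Y (Icc 0 (τ + τ')) := by
    have c1 : Continuous (fun s => y (projIcc 0 τ hτ s)) :=
      (continuousOn_iff_continuous_domRestrict.mp hc).comp continuous_projIcc
    have c2 : Continuous (fun s => y' (projIcc 0 τ' hτ' (s - τ))) :=
      (continuousOn_iff_continuous_domRestrict.mp hc').comp
        (continuous_projIcc.comp (by fun_prop))
    have c3 := Continuous.if_le c1 c2 continuous_id (continuous_const (y := τ))
      (fun s hs => by
        have hs' : s = τ := hs
        rw [hs', sub_self, projIcc_right, projIcc_left]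
        exact hy'0.symm)
    refine c3.continuousOn.congr (fun s hs => ?_)
    simp only [hY, id]
    split_ifs with hs'
    · rw [projIcc_of_mem hτ ⟨hs.1, hs'⟩]
    · rw [projIcc_of_mem hτ' ⟨by linarith, by linarith [hs.2]⟩]
  have hYΩ : ∀ t ∈ Icc 0 (τ + τ'), Y t ∈ closure p.Ω := by
    intro s hs
    simp only [hY]
    split_ifs with hs'
    · exact hΩ s ⟨hs.1, hs'⟩
    · exact hΩ' _ ⟨by linarith, by linarith [hs.2]⟩
  refine ⟨hYc, hYΩ, B, hBm, hB1, fun t ht => ?_⟩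
  have first : ∀ t ∈ Icc 0 τ, y t = x + ∫ s in (0 : ℝ)..t, (σ * p.f (Y s) (B s)) • B s := by
    intro t ht
    rw [h t ht]
    congr 1
    refine intervalIntegral.integral_congr (fun s hs => ?_)
    rw [uIcc_of_le ht.1] at hs
    have : s ≤ τ := hs.2.trans ht.2
    simp [hY, hB, this]
  by_cases htτ : t ≤ τ
  · rw [← first t ⟨ht.1, htτ⟩]; simp [hY, htτ]
  · have hYt : Y t = y' (t - τ) := by simp [hY, htτ]
    rw [not_le] at htτ
    rw [hYt, h' (t - τ) ⟨by linarith, by linarith [ht.2]⟩, first τ ⟨hτ, le_rfl⟩, add_assoc,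
      ← intervalIntegral.integral_add_adjacent_intervals (b := τ)
        (p.intervalIntegrable_velocity σ hYc hYΩ hBm hB1 ⟨le_rfl, by linarith⟩
          ⟨hτ, by linarith⟩)
        (p.intervalIntegrable_velocity σ hYc hYΩ hBm hB1 ⟨hτ, by linarith⟩ ht)]
    congr 2
    have e := intervalIntegral.integral_comp_sub_right (a := τ) (b := t)
      (fun s => (σ * p.f (y' s) (α' s)) • α' s) τ
    rw [sub_self] at e
    rw [← e, intervalIntegral.integral_of_le htτ.le, intervalIntegral.integral_of_le htτ.le]
    refine setIntegral_congr_fun measurableSet_Ioc (fun s hs => ?_)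
    simp [hY, hB, not_le.mpr hs.1]

theorem norm_sub_le (h : p.IsTrajectory σ x τ y) (hσ : |σ| = 1) {M : ℝ}
    (hM : ∀ x ∈ closure p.Ω, ∀ a ∈ Metric.sphere (0 : Pt d) 1, p.f x a ≤ M) {s t : ℝ}
    (hs : s ∈ Icc 0 τ) (ht : t ∈ Icc 0 τ) : ‖y t - y s‖ ≤ M * |t - s| := by
  obtain ⟨hc, hΩ, α, hα, hα1, h⟩ := h
  have h0 : (0 : ℝ) ∈ Icc 0 τ := ⟨le_rfl, hs.1.trans hs.2⟩
  have : y t - y s = ∫ r in s..t, (σ * p.f (y r) (α r)) • α r := by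
    rw [h t ht, h s hs, ← intervalIntegral.integral_add_adjacent_intervals
      (p.intervalIntegrable_velocity σ hc hΩ hα hα1 h0 hs)
      (p.intervalIntegrable_velocity σ hc hΩ hα hα1 hs ht)]
    abel
  rw [this]
  refine intervalIntegral.norm_integral_le_of_norm_le_const (fun r hr => ?_)
  have hr' : r ∈ Icc 0 τ := uIcc_subset_Icc hs ht (uIoc_subset_uIcc hr)
  have hα1' : α r ∈ Metric.sphere (0 : Pt d) 1 := by simp [hα1 r]
  rw [norm_smul, hα1 r, mul_one, Real.norm_eq_abs, abs_mul, hσ, one_mul,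
    abs_of_pos (p.f_pos _ (hΩ r hr') _ hα1')]
  exact hM _ (hΩ r hr') _ hα1'

theorem const (hd : 0 < d) (σ : ℝ) {x : Pt d} (hx : x ∈ closure p.Ω) :
    p.IsTrajectory σ x 0 (fun _ => x) := by
  refine ⟨continuousOn_const, fun _ _ => hx, fun _ => EuclideanSpace.single ⟨0, hd⟩ 1,
    measurable_const, fun _ => by simp, fun t ht => ?_⟩
  have : t = 0 := le_antisymm ht.2 ht.1
  simp [this]

end IsTrajectory

/-- Straight lines are trajectories. -/
theorem exists_segment_trajectory (hd : 0 < d) (hconv : Convex ℝ (closure p.Ω)) {fmin : ℝ}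
    (hfmin : 0 < fmin)
    (hf : ∀ x ∈ closure p.Ω, ∀ a ∈ Metric.sphere (0 : Pt d) 1, fmin ≤ p.f x a)
    {σ : ℝ} (hσ : |σ| = 1) {x x' : Pt d} (hx : x ∈ closure p.Ω) (hx' : x' ∈ closure p.Ω) :
    ∃ (τ : ℝ) (y : ℝ → Pt d), 0 ≤ τ ∧ τ ≤ ‖x' - x‖ / fmin ∧ p.IsTrajectory σ x τ y ∧ y τ = x' := by
  by_cases hxx : x' = x
  · exact ⟨0, fun _ => x, le_rfl, by positivity, IsTrajectory.const hd σ hx, hxx.symm⟩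
  obtain ⟨M, hM⟩ := p.f_bounded
  set ℓ := ‖x' - x‖ with hℓ
  have hℓ0 : 0 < ℓ := norm_pos_iff.mpr (sub_ne_zero.mpr hxx)
  set u : Pt d := ℓ⁻¹ • (x' - x) with hu
  have hu1 : ‖u‖ = 1 := by
    rw [hu, norm_smul, norm_inv, Real.norm_eq_abs, abs_of_pos hℓ0, inv_mul_cancel₀ hℓ0.ne']
  have hσσ : σ * σ = 1 := by rw [← abs_mul_abs_self, hσ, one_mul]
  -- The control is `σ • u`: as `σ * σ = 1`, the velocity then points along `u` for both signs.
  have ha1 : ‖σ • u‖ = 1 := by rw [norm_smul, Real.norm_eq_abs, hσ, hu1, one_mul]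
  have ha : σ • u ∈ Metric.sphere (0 : Pt d) 1 := by simp [ha1]
  have hline : ∀ s ∈ Icc 0 ℓ, x + s • u ∈ closure p.Ω := by
    intro s hs
    have := hconv.add_smul_sub_mem hx hx' (t := s * ℓ⁻¹)
      ⟨mul_nonneg hs.1 (by positivity), by rw [← div_eq_mul_inv]; exact (div_le_one hℓ0).mpr hs.2⟩
    rwa [hu, smul_smul]
  set g : ℝ → ℝ := fun s => p.f (x + ((projIcc 0 ℓ hℓ0.le s : ℝ)) • u) (σ • u) with hg
  have hgc : Continuous g := by
    have h1 : Continuous (fun s => (x + ((projIcc 0 ℓ hℓ0.le s : ℝ)) • u, σ • u)) := by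
      have := continuous_projIcc (h := hℓ0.le)
      fun_prop
    exact p.f_continuous.comp_continuous h1
      (fun s => ⟨hline _ (projIcc 0 ℓ hℓ0.le s).2, ha⟩)
  have hgmin : ∀ s, fmin ≤ g s := fun s => hf _ (hline _ (projIcc 0 ℓ hℓ0.le s).2) _ ha
  have hgM : ∀ s, g s ≤ M := fun s => hM _ (hline _ (projIcc 0 ℓ hℓ0.le s).2) _ ha
  have hgpos : ∀ s, 0 < g s := fun s => hfmin.trans_le (hgmin s)
  have hMpos : 0 < M := (hgpos 0).trans_le (hgM 0)
  have hgi : Continuous (fun s => (g s)⁻¹) := hgc.inv₀ (fun s => (hgpos s).ne')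
  -- `Θ s` is the time needed to cover the length `s`. Its derivative lies between `M⁻¹` and
  -- `fmin⁻¹`, so it is an increasing bijection of `ℝ`; its inverse gives the position as a function
  -- of time.
  set Θ : ℝ → ℝ := fun s => ∫ r in (0 : ℝ)..s, (g r)⁻¹ with hΘ
  have hΘd : ∀ s, HasDerivAt Θ (g s)⁻¹ s := fun s =>
    intervalIntegral.integral_hasDerivAt_right (hgi.intervalIntegrable _ _)
      hgi.stronglyMeasurable.stronglyMeasurableAtFilter hgi.continuousAt
  have hΘdiff : Differentiable ℝ Θ := fun s => (hΘd s).differentiableAt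
  have hlow : ∀ a b, a ≤ b → M⁻¹ * (b - a) ≤ Θ b - Θ a := fun a b hab =>
    mul_sub_le_image_sub_of_le_deriv hΘdiff
      (fun s => by rw [(hΘd s).deriv]; exact inv_anti₀ (hgpos s) (hgM s)) hab
  have hup : ∀ a b, a ≤ b → Θ b - Θ a ≤ fmin⁻¹ * (b - a) := fun a b hab =>
    image_sub_le_mul_sub_of_deriv_le hΘdiff
      (fun s => by rw [(hΘd s).deriv]; exact inv_anti₀ hfmin (hgmin s)) hab
  have hΘ0 : Θ 0 = 0 := by simp [hΘ]
  have hmono : StrictMono Θ := by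
    intro a b hab
    have := hlow a b hab.le
    have : 0 < M⁻¹ * (b - a) := mul_pos (inv_pos.mpr hMpos) (sub_pos.mpr hab)
    linarith
  have hsurj : Function.Surjective Θ := by
    refine hΘdiff.continuous.surjective ?_ ?_
    · refine Filter.tendsto_atTop_mono' _ ?_
        (Filter.tendsto_id.const_mul_atTop (inv_pos.mpr hMpos))
      filter_upwards [Filter.eventually_ge_atTop 0] with s hs
      have := hlow 0 s hs
      simp only [id]
      linarith
    · refine Filter.tendsto_atBot_mono' _ ?_
        (Filter.tendsto_id.const_mul_atBot (inv_pos.mpr hMpos))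
      filter_upwards [Filter.eventually_le_atBot 0] with s hs
      have := hlow s 0 hs
      simp only [id]
      linarith
  set e := hmono.orderIsoOfSurjective Θ hsurj with he
  have hΘe : ∀ t, Θ (e.symm t) = t := fun t => e.apply_symm_apply t
  have heΘ : ∀ s, e.symm (Θ s) = s := fun s => e.symm_apply_apply s
  have hSd : ∀ t, HasDerivAt (fun t => e.symm t) (g (e.symm t)) t := by
    intro t
    have := HasDerivAt.of_local_left_inverse (f := Θ) (g := fun t => e.symm t) (a := t)
      e.symm.continuous.continuousAt (hΘd _) (inv_ne_zero (hgpos _).ne')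
      (Filter.Eventually.of_forall hΘe)
    rwa [inv_inv] at this
  have hSmem : ∀ t ∈ Icc 0 (Θ ℓ), e.symm t ∈ Icc 0 ℓ := by
    intro t ht
    constructor
    · have := e.symm.monotone ht.1
      rwa [← hΘ0, heΘ] at this
    · have := e.symm.monotone ht.2
      rwa [heΘ] at this
  have hτ : 0 ≤ Θ ℓ := by rw [← hΘ0]; exact hmono.monotone hℓ0.le
  refine ⟨Θ ℓ, fun t => x + (e.symm t) • u, hτ, ?_, ⟨?_, ?_, fun _ => σ • u, measurable_const,
    fun _ => ha1, ?_⟩, ?_⟩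
  · have := hup 0 ℓ hℓ0.le
    rw [hΘ0, sub_zero, sub_zero] at this
    rw [div_eq_inv_mul]
    exact this
  · have := e.symm.continuous
    fun_prop
  · exact fun t ht => hline _ (hSmem t ht)
  · intro t ht
    have hyd : ∀ s, HasDerivAt (fun t => x + (e.symm t) • u) (g (e.symm s) • u) s := fun s =>
      ((hSd s).smul_const u).const_add x
    have hint := intervalIntegral.integral_eq_sub_of_hasDerivAt (a := 0) (b := t)
      (fun s _ => hyd s)
      (((hgc.comp e.symm.continuous).smul continuous_const).intervalIntegrable _ _)
    have h0 : e.symm 0 = 0 := by have := heΘ 0; rwa [hΘ0] at this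
    have : (∫ s in (0 : ℝ)..t, (σ * p.f (x + (e.symm s) • u) (σ • u)) • σ • u) =
        ∫ s in (0 : ℝ)..t, g (e.symm s) • u := by
      refine intervalIntegral.integral_congr (fun s hs => ?_)
      rw [uIcc_of_le ht.1] at hs
      simp only [hg]
      rw [projIcc_of_mem hℓ0.le (hSmem s ⟨hs.1, hs.2.trans ht.2⟩), smul_smul]
      congr 1
      rw [mul_right_comm, hσσ, one_mul]
    rw [this, hint, h0]
    simp
  · simp only [heΘ]
    rw [hu, smul_smul, mul_inv_cancel₀ hℓ0.ne', one_smul]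
    abel

end Problem
-- The transform `1 - e^{-T}` and the regularity of the value functions
theorem one_sub_kruzkov (T : ℝ≥0∞) :
    1 - kruzkov T = if T = ⊤ then 0 else Real.exp (-T.toReal) := by
  unfold kruzkov; split_ifs <;> ring

theorem one_sub_kruzkov_nonneg (T : ℝ≥0∞) : 0 ≤ 1 - kruzkov T := by
  rw [one_sub_kruzkov]; split_ifs <;> positivity

theorem kruzkov_le_one (T : ℝ≥0∞) : kruzkov T ≤ 1 := by
  linarith [one_sub_kruzkov_nonneg T]

theorem kruzkov_nonneg (T : ℝ≥0∞) : 0 ≤ kruzkov T := by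
  unfold kruzkov
  split_ifs
  · exact zero_le_one
  · have : Real.exp (-T.toReal) ≤ 1 := Real.exp_le_one_iff.mpr (by simp)
    linarith

/-- `1 - kruzkov T` is `e^{-T}`, so sums of times become products. Hence `1 - F_v = (1 - v_s)(1 -
v_d)`: `F_v` is the transform of `T_s + T_d`. -/
theorem one_sub_kruzkov_add (a b : ℝ≥0∞) :
    1 - kruzkov (a + b) = (1 - kruzkov a) * (1 - kruzkov b) := by
  simp only [one_sub_kruzkov]
  by_cases ha : a = ⊤
  · simp [ha]
  by_cases hb : b = ⊤
  · simp [hb]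
  simp only [ha, hb, ENNReal.add_eq_top, or_self, if_false]
  rw [ENNReal.toReal_add ha hb, neg_add, Real.exp_add]

theorem one_sub_kruzkov_ofReal {t : ℝ} (ht : 0 ≤ t) :
    1 - kruzkov (ENNReal.ofReal t) = Real.exp (-t) := by
  rw [one_sub_kruzkov, if_neg ENNReal.ofReal_ne_top, ENNReal.toReal_ofReal ht]

theorem kruzkov_mono {a b : ℝ≥0∞} (h : a ≤ b) : kruzkov a ≤ kruzkov b := by
  obtain ⟨c, rfl⟩ := exists_add_of_le h
  have h1 := one_sub_kruzkov_add a c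
  have := mul_le_mul_of_nonneg_left (show 1 - kruzkov c ≤ 1 by linarith [kruzkov_nonneg c])
    (one_sub_kruzkov_nonneg a)
  linarith

theorem kruzkov_lt {a b : ℝ≥0∞} (h : a < b) : kruzkov a < kruzkov b := by
  have ha : a ≠ ⊤ := (h.trans_le le_top).ne
  have : 1 - kruzkov b < 1 - kruzkov a := by
    rw [one_sub_kruzkov, one_sub_kruzkov, if_neg ha]
    split_ifs with hb
    · positivity
    · exact Real.exp_lt_exp.mpr (neg_lt_neg ((ENNReal.toReal_lt_toReal ha hb).mpr h))
  linarith

namespace Problem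

variable {d : ℕ} (p : Problem d)

/-- The transformed minimum time to reach `K`. -/
noncomputable def val (σ : ℝ) (K : Set (Pt d)) (x : Pt d) : ℝ := kruzkov (p.minTime σ K x)

theorem vd_eq_val (x : Pt d) : p.vd x = p.val 1 p.Kdst x := rfl

theorem vs_eq_val (x : Pt d) : p.vs x = p.val (-1) p.Ksrc x := rfl

theorem val_nonneg (σ : ℝ) (K : Set (Pt d)) (x : Pt d) : 0 ≤ p.val σ K x := kruzkov_nonneg _

theorem val_le_one (σ : ℝ) (K : Set (Pt d)) (x : Pt d) : p.val σ K x ≤ 1 := kruzkov_le_one _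

variable {p}

theorem minTime_le {σ τ : ℝ} {K : Set (Pt d)} {x : Pt d} {y : ℝ → Pt d} (hτ : 0 ≤ τ)
    (h : p.IsTrajectory σ x τ y) (hK : y τ ∈ K) : p.minTime σ K x ≤ ENNReal.ofReal τ :=
  sInf_le ⟨τ, y, hτ, h, hK, rfl⟩

theorem exists_of_minTime_lt {σ : ℝ} {K : Set (Pt d)} {x : Pt d} {c : ℝ≥0∞}
    (h : p.minTime σ K x < c) : ∃ (τ : ℝ) (y : ℝ → Pt d),
      0 ≤ τ ∧ p.IsTrajectory σ x τ y ∧ y τ ∈ K ∧ ENNReal.ofReal τ < c := by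
  obtain ⟨T, ⟨τ, y, h1, h2, h3, rfl⟩, hT⟩ := sInf_lt_iff.mp h
  exact ⟨τ, y, h1, h2, h3, hT⟩

theorem minTime_le_add {σ τ : ℝ} {K : Set (Pt d)} {x : Pt d} {y : ℝ → Pt d} (hτ : 0 ≤ τ)
    (h : p.IsTrajectory σ x τ y) :
    p.minTime σ K x ≤ ENNReal.ofReal τ + p.minTime σ K (y τ) := by
  rw [← tsub_le_iff_left]
  refine le_sInf ?_
  rintro T ⟨τ', y', h1, h2, h3, rfl⟩
  rw [tsub_le_iff_left, ← ENNReal.ofReal_add hτ h1]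
  refine minTime_le (add_nonneg hτ h1) (h.concat hτ h2 h1) ?_
  -- If `τ' = 0`, the concatenation ends in its first branch, at `y τ`, which is also `y' 0`.
  rcases h1.eq_or_lt with h0 | h0
  · rw [← h0] at h3
    simp only [← h0, add_zero, le_refl, if_true]
    rwa [h2.start h1] at h3
  · simpa [not_le.mpr h0] using h3

variable (p)

/-- Consequences of the standing assumptions, on the closure of the domain. -/
structure Regular (fmin fM R : ℝ) : Prop where
  dim : 0 < d
  convex : Convex ℝ (closure p.Ω)
  fmin_pos : 0 < fmin
  fM_pos : 0 < fM
  le_speed : ∀ x ∈ closure p.Ω, ∀ a ∈ Metric.sphere (0 : Pt d) 1, fmin ≤ p.f x a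
  speed_le : ∀ x ∈ closure p.Ω, ∀ a ∈ Metric.sphere (0 : Pt d) 1, p.f x a ≤ fM
  dist_le : ∀ x ∈ closure p.Ω, ∀ y ∈ closure p.Ω, ‖x - y‖ ≤ R
  geodesic : p.geodesicPoints.Nonempty

variable {p}

theorem minTime_eq_zero (hd : 0 < d) (σ : ℝ) {K : Set (Pt d)} (hK : K ⊆ p.Ω) {x : Pt d}
    (hx : x ∈ K) : p.minTime σ K x = 0 := by
  have := minTime_le (K := K) le_rfl (IsTrajectory.const hd σ (subset_closure (hK hx))) hx
  simpa using this

theorem val_eq_zero (hd : 0 < d) (σ : ℝ) {K : Set (Pt d)} (hK : K ⊆ p.Ω) {x : Pt d}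
    (hx : x ∈ K) : p.val σ K x = 0 := by
  rw [val, minTime_eq_zero hd σ hK hx]; simp [kruzkov]

theorem infFv_le {x : Pt d} (hx : x ∈ p.Ω) : p.infFv ≤ p.Fv x := by
  refine csInf_le ⟨0, ?_⟩ ⟨x, hx, rfl⟩
  rintro _ ⟨z, -, rfl⟩
  have h1 := p.val_nonneg 1 p.Kdst z
  have h2 := p.val_nonneg (-1) p.Ksrc z
  have h3 := p.val_le_one (-1) p.Ksrc z
  have h4 : p.Fv z = p.vs z + p.vd z * (1 - p.vs z) := by simp only [Fv]; ring
  rw [h4]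
  exact add_nonneg h2 (mul_nonneg h1 (by simp only [vs_eq_val]; linarith))

namespace Regular

variable {fmin fM R : ℝ} (hp : p.Regular fmin fM R)
include hp

theorem minTime_le_of_segment {σ : ℝ} (hσ : |σ| = 1) (K : Set (Pt d)) {x x' : Pt d}
    (hx : x ∈ closure p.Ω) (hx' : x' ∈ closure p.Ω) :
    p.minTime σ K x ≤ ENNReal.ofReal (‖x - x'‖ / fmin) + p.minTime σ K x' := by
  obtain ⟨τ, y, h1, h2, h3, h4⟩ := p.exists_segment_trajectory hp.dim hp.convex hp.fmin_pos
    hp.le_speed hσ hx hx'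
  have := minTime_le_add (K := K) h1 h3
  rw [h4] at this
  rw [norm_sub_rev] at h2
  exact this.trans (add_le_add_left (ENNReal.ofReal_le_ofReal h2) _)

/-- A segment of length `r` takes time at most `r / fmin`, so `1 - v` at one end is at least `e^{-r
/ fmin} ≥ 1 - r / fmin` times its value at the other. -/
theorem val_lipschitz {σ : ℝ} (hσ : |σ| = 1) (K : Set (Pt d)) {x x' : Pt d}
    (hx : x ∈ closure p.Ω) (hx' : x' ∈ closure p.Ω) :
    |p.val σ K x - p.val σ K x'| ≤ ‖x - x'‖ / fmin := by
  have key : ∀ x ∈ closure p.Ω, ∀ x' ∈ closure p.Ω,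
      p.val σ K x - p.val σ K x' ≤ ‖x - x'‖ / fmin := by
    intro x hx x' hx'
    have hr : 0 ≤ ‖x - x'‖ / fmin := div_nonneg (norm_nonneg _) hp.fmin_pos.le
    have h1 := kruzkov_mono (hp.minTime_le_of_segment hσ K hx hx')
    have h2 := one_sub_kruzkov_add (ENNReal.ofReal (‖x - x'‖ / fmin)) (p.minTime σ K x')
    rw [one_sub_kruzkov_ofReal hr] at h2
    have h3 := Real.add_one_le_exp (-(‖x - x'‖ / fmin))
    have h4 := one_sub_kruzkov_nonneg (p.minTime σ K x')
    have h5 := kruzkov_nonneg (p.minTime σ K x')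
    have h6 : (1 - ‖x - x'‖ / fmin) * (1 - kruzkov (p.minTime σ K x')) ≤
        Real.exp (-(‖x - x'‖ / fmin)) * (1 - kruzkov (p.minTime σ K x')) :=
      mul_le_mul_of_nonneg_right (by linarith) h4
    have h7 : ‖x - x'‖ / fmin * (1 - kruzkov (p.minTime σ K x')) ≤ ‖x - x'‖ / fmin * 1 :=
      mul_le_mul_of_nonneg_left (by linarith) hr
    simp only [val]
    linarith
  rw [abs_sub_le_iff]
  exact ⟨key x hx x' hx', by rw [norm_sub_rev]; exact key x' hx' x hx⟩

theorem Fv_lipschitz {x x' : Pt d} (hx : x ∈ closure p.Ω) (hx' : x' ∈ closure p.Ω) :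
    |p.Fv x - p.Fv x'| ≤ 2 / fmin * ‖x - x'‖ := by
  have h1 := hp.val_lipschitz (σ := 1) (by simp) p.Kdst hx hx'
  have h2 := hp.val_lipschitz (σ := -1) (by simp) p.Ksrc hx hx'
  simp only [Fv, vd_eq_val, vs_eq_val]
  set a := p.val (-1) p.Ksrc x
  set b := p.val 1 p.Kdst x
  set a' := p.val (-1) p.Ksrc x'
  set b' := p.val 1 p.Kdst x'
  have ha : 0 ≤ a' := p.val_nonneg _ _ _
  have ha1 : a' ≤ 1 := p.val_le_one _ _ _
  have hb : 0 ≤ b := p.val_nonneg _ _ _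
  have hb1 : b ≤ 1 := p.val_le_one _ _ _
  have e : a + b - a * b - (a' + b' - a' * b') = (1 - b) * (a - a') + (1 - a') * (b - b') := by
    ring
  rw [e]
  refine (abs_add_le _ _).trans ?_
  rw [abs_mul, abs_mul, abs_of_nonneg (sub_nonneg.mpr hb1), abs_of_nonneg (sub_nonneg.mpr ha1)]
  have h3 : (1 - b) * |a - a'| ≤ 1 * |a - a'| :=
    mul_le_mul_of_nonneg_right (by linarith) (abs_nonneg _)
  have h4 : (1 - a') * |b - b'| ≤ 1 * |b - b'| :=
    mul_le_mul_of_nonneg_right (by linarith) (abs_nonneg _)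
  have h5 : 2 / fmin * ‖x - x'‖ = ‖x - x'‖ / fmin + ‖x - x'‖ / fmin := by ring
  linarith

/-- A straight segment reaches `K` in time at most `R / fmin`. Keeping `1 - v` away from zero allows
`v'` to be controlled through `F = v + v' (1 - v)`. -/
theorem one_sub_val_ge {σ : ℝ} (hσ : |σ| = 1) {K : Set (Pt d)} (hK : K ⊆ p.Ω)
    (hne : K.Nonempty) {x : Pt d} (hx : x ∈ closure p.Ω) :
    Real.exp (-(R / fmin)) ≤ 1 - p.val σ K x := by
  obtain ⟨z, hz⟩ := hne
  have hz' := subset_closure (hK hz)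
  have h1 := hp.minTime_le_of_segment hσ K hx hz'
  rw [minTime_eq_zero hp.dim σ hK hz, add_zero] at h1
  have h2 := kruzkov_mono h1
  have h3 := one_sub_kruzkov_ofReal (div_nonneg (norm_nonneg (x - z)) hp.fmin_pos.le)
  have h4 : Real.exp (-(R / fmin)) ≤ Real.exp (-(‖x - z‖ / fmin)) :=
    Real.exp_le_exp.mpr (neg_le_neg
      (div_le_div_of_nonneg_right (hp.dist_le x hx z hz') hp.fmin_pos.le))
  simp only [val]
  linarith

/-- Covering the distance `r` takes time at least `t = r / fM`, and `1 - e^{-t} ≥ t e^{-t}`, where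
`t ≤ R / fM`. -/
theorem val_ge_of_dist {σ : ℝ} (hσ : |σ| = 1) {K : Set (Pt d)} (hK : K ⊆ p.Ω)
    (hne : K.Nonempty) {x : Pt d} (hx : x ∈ closure p.Ω) {r : ℝ} (hr : 0 ≤ r)
    (hdist : ∀ z ∈ K, r ≤ ‖z - x‖) :
    Real.exp (-(R / fM)) / fM * r ≤ p.val σ K x := by
  have h1 : ENNReal.ofReal (r / fM) ≤ p.minTime σ K x := by
    refine le_sInf ?_
    rintro T ⟨τ, y, hτ, h2, h3, rfl⟩
    refine ENNReal.ofReal_le_ofReal ?_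
    have h4 := h2.norm_sub_le hσ hp.speed_le (s := 0) (t := τ) ⟨le_rfl, hτ⟩ ⟨hτ, le_rfl⟩
    rw [h2.start hτ, sub_zero, abs_of_nonneg hτ] at h4
    rw [div_le_iff₀ hp.fM_pos, mul_comm]
    exact (hdist _ h3).trans h4
  have hrf : 0 ≤ r / fM := div_nonneg hr hp.fM_pos.le
  have h2 := kruzkov_mono h1
  have h3 := one_sub_kruzkov_ofReal hrf
  obtain ⟨z, hz⟩ := hne
  have hrR : r ≤ R := (hdist z hz).trans (hp.dist_le z (subset_closure (hK hz)) x hx)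
  have h5 : Real.exp (-(R / fM)) ≤ Real.exp (-(r / fM)) :=
    Real.exp_le_exp.mpr (neg_le_neg (div_le_div_of_nonneg_right hrR hp.fM_pos.le))
  have h6 : Real.exp (-(r / fM)) * (r / fM + 1) ≤ 1 := by
    have := mul_le_mul_of_nonneg_left (Real.add_one_le_exp (r / fM))
      (Real.exp_pos (-(r / fM))).le
    rwa [← Real.exp_add, neg_add_cancel, Real.exp_zero] at this
  have h7 : Real.exp (-(R / fM)) * (r / fM) ≤ Real.exp (-(r / fM)) * (r / fM) :=
    mul_le_mul_of_nonneg_right h5 hrf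
  have h8 : Real.exp (-(R / fM)) / fM * r = Real.exp (-(R / fM)) * (r / fM) := by ring
  simp only [val]
  linarith

/-- A reverse trajectory from `z` to the source, run backwards and continued from `z` to the
destination, is an admissible path. So `F_v` is nowhere below the optimal value, and it equals this
value at both ends of an optimal path. -/
theorem exists_optimal : ∃ x ∈ p.Ksrc, ∃ y ∈ p.Kdst, x ∈ p.Xsrc ∧ p.vd x = p.infFv ∧
    p.vStar = p.infFv ∧ p.Fv x = p.infFv ∧ p.Fv y = p.infFv := by
  obtain ⟨-, y, τ, ⟨hτ, hX, htraj, hK, hopt⟩, -⟩ := hp.geodesic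
  set x := y 0 with hx
  have hxK : x ∈ p.Ksrc := hX.1
  have hvs : p.vs x = 0 := val_eq_zero hp.dim (-1) p.src_subset hxK
  have hvdy : p.vd (y τ) = 0 := val_eq_zero hp.dim 1 p.dst_subset hK
  have hFx : p.Fv x = p.vd x := by simp [Fv, hvs]
  have hlow : ∀ z ∈ p.Ω, p.vd x ≤ p.Fv z := by
    intro z hz
    have h1 : p.Td x ≤ p.Ts z + p.Td z := by
      rw [← tsub_le_iff_right]
      refine le_sInf ?_
      rintro T ⟨τ', y', hτ', h2, h3, rfl⟩
      rw [tsub_le_iff_right]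
      have h4 := h2.reverse ⟨hτ', le_rfl⟩
      rw [neg_neg] at h4
      have h5 := minTime_le_add (K := p.Kdst) hτ' h4
      simp only [sub_self] at h5
      rw [h2.start hτ'] at h5
      refine le_trans ?_ h5
      by_contra hcon
      exact absurd (hX.2 _ h3) (not_le.mpr (kruzkov_lt (not_le.mp hcon)))
    have h2 := kruzkov_mono h1
    have h3 := one_sub_kruzkov_add (p.Ts z) (p.Td z)
    have h4 : 1 - p.Fv z = (1 - kruzkov (p.Ts z)) * (1 - kruzkov (p.Td z)) := by
      simp only [Fv, vs, vd]; ring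
    have h5 : p.vd x = kruzkov (p.Td x) := rfl
    linarith
  have hinf : p.infFv = p.vd x := by
    refine IsLeast.csInf_eq ⟨⟨x, p.src_subset hxK, hFx⟩, ?_⟩
    rintro _ ⟨z, hz, rfl⟩
    exact hlow z hz
  have hstar : p.vStar = p.vd x := by
    refine IsLeast.csInf_eq ⟨⟨x, hxK, rfl⟩, ?_⟩
    rintro _ ⟨z, hz, rfl⟩
    exact hX.2 z hz
  refine ⟨x, hxK, y τ, hK, hX, hinf.symm, hstar.trans hinf.symm, hFx.trans hinf.symm,
    le_antisymm ?_ (hinf.le.trans (hlow _ (p.dst_subset hK)))⟩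
  have h1 : p.Fv (y τ) = p.vs (y τ) := by simp [Fv, hvdy]
  rw [h1, hinf]
  have h2 := htraj.reverse ⟨hτ, le_rfl⟩
  have h3 : p.Ts (y τ) ≤ ENNReal.ofReal τ :=
    minTime_le hτ h2 (by simpa only [sub_self] using hxK)
  rw [hopt] at h3
  exact kruzkov_mono h3

theorem infFv_nonneg : 0 ≤ p.infFv := by
  obtain ⟨x, -, -, -, -, h, -⟩ := hp.exists_optimal
  rw [← h]; exact p.val_nonneg _ _ _

/-- A point of `K'` with a small value is close to a boundary point of `K'` with a small value. -/
theorem exists_exit {σ : ℝ} (hσ : |σ| = 1) {K K' : Set (Pt d)} (hK : K ⊆ p.Ω) (hK' : K' ⊆ p.Ω)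
    (hKc : IsCompact K) (hKc' : IsCompact K') (hdisj : Disjoint K K') (hne : K.Nonempty)
    {v₀ κ : ℝ} (hlow : ∀ w ∈ K', v₀ ≤ p.val σ K w) {x : Pt d} (hx : x ∈ K')
    (hxκ : p.val σ K x < v₀ + κ) :
    ∃ w ∈ K', p.val σ K w < v₀ + κ ∧ ‖x - w‖ ≤ 2 * fM * Real.exp (R / fmin) * κ ∧
      w ∈ closure (p.Ω \ (K ∪ K')) := by
  have hκ : 0 < κ := by linarith [hlow x hx]
  have hxΩ := subset_closure (hK' hx)
  have hge := hp.one_sub_val_ge hσ hK hne hxΩ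
  have hT : p.minTime σ K x ≠ ⊤ := by
    intro hT
    rw [val, hT] at hge
    have := Real.exp_pos (-(R / fmin))
    simp only [kruzkov, if_true] at hge
    linarith
  set t := (p.minTime σ K x).toReal with ht
  have ht0 : 0 ≤ t := ENNReal.toReal_nonneg
  have hTt : p.minTime σ K x = ENNReal.ofReal t := (ENNReal.ofReal_toReal hT).symm
  have hvt : 1 - p.val σ K x = Real.exp (-t) := by rw [val, hTt, one_sub_kruzkov_ofReal ht0]
  -- The infimum that defines the minimum time need not be attained; `δ` is the slack of a nearly
  -- optimal trajectory. The cap `1 / 2` is for the bound on `e^τ` below.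
  set δ := min (1 / 2) (v₀ + κ - p.val σ K x) with hδ
  have hδ0 : 0 < δ := lt_min (by norm_num) (by linarith)
  have hδ1 : δ ≤ 1 / 2 := min_le_left _ _
  have hδ2 : δ ≤ v₀ + κ - p.val σ K x := min_le_right _ _
  obtain ⟨τ, y, hτ, htraj, hyK, hlt⟩ := exists_of_minTime_lt (p := p) (σ := σ) (K := K) (x := x)
    (c := ENNReal.ofReal (t + δ)) (by
      rw [hTt]; exact (ENNReal.ofReal_lt_ofReal_iff (by linarith)).mpr (by linarith))
  have hτt : τ < t + δ := (ENNReal.ofReal_lt_ofReal_iff (by linarith)).mp hlt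
  have hy0 : y 0 = x := htraj.start hτ
  have hyc : ContinuousOn y (Icc 0 τ) := htraj.1
  -- the last time in `K'`
  have hS : IsCompact (Icc 0 τ ∩ y ⁻¹' K') := by
    refine isCompact_Icc.of_isClosed_subset
      (hyc.preimage_isClosed_of_isClosed isClosed_Icc hKc'.isClosed) inter_subset_left
  obtain ⟨a, ⟨haI, haK⟩, hmax⟩ := hS.exists_isGreatest ⟨0, ⟨le_rfl, hτ⟩, by
    rw [mem_preimage, hy0]; exact hx⟩
  have haτ : a < τ := by
    refine lt_of_le_of_ne haI.2 (fun h => ?_)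
    rw [h] at haK
    exact Set.disjoint_left.mp hdisj hyK haK
  have hva : p.minTime σ K (y a) ≤ ENNReal.ofReal (τ - a) :=
    minTime_le (by linarith) (htraj.tail haI) (by simpa using hyK)
  have hva' : p.val σ K (y a) ≤ 1 - Real.exp (-(τ - a)) := by
    have h1 := kruzkov_mono hva
    have h2 := one_sub_kruzkov_ofReal (show 0 ≤ τ - a by linarith)
    simp only [val]; linarith
  have hexp : 1 - Real.exp (-τ) < v₀ + κ := by
    have h1 : Real.exp (-(t + δ)) < Real.exp (-τ) := Real.exp_lt_exp.mpr (by linarith)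
    have h2 : Real.exp (-(t + δ)) = Real.exp (-t) * Real.exp (-δ) := by
      rw [neg_add, Real.exp_add]
    have h3 := Real.add_one_le_exp (-δ)
    have h4 : Real.exp (-t) ≤ 1 := Real.exp_le_one_iff.mpr (by linarith)
    have h5 : Real.exp (-t) * (-δ + 1) ≤ Real.exp (-t) * Real.exp (-δ) :=
      mul_le_mul_of_nonneg_left h3 (Real.exp_pos _).le
    have h6 : Real.exp (-t) * δ ≤ 1 * δ := mul_le_mul_of_nonneg_right h4 hδ0.le
    linarith
  refine ⟨y a, haK, ?_, ?_, ?_⟩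
  · have : Real.exp (-τ) ≤ Real.exp (-(τ - a)) := Real.exp_le_exp.mpr (by linarith [haI.1])
    linarith
  -- The time `a` of the last exit is short: the remaining time `τ - a` has a transform of at least
  -- `v₀`, since `y a ∈ K'`, whereas that of `τ` is below `v₀ + κ`. This gives `e^{-τ} (e^a - 1) ≤
  -- κ`.
  · have h1 := htraj.norm_sub_le hσ hp.speed_le (s := a) (t := 0) haI ⟨le_rfl, hτ⟩
    rw [hy0, zero_sub, abs_neg, abs_of_nonneg haI.1] at h1
    refine h1.trans ?_
    have h2 := hlow _ haK
    have h3 : Real.exp (-(τ - a)) = Real.exp (-τ) * Real.exp a := by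
      rw [← Real.exp_add]; congr 1; ring
    have h4 : Real.exp (-τ) * (a + 1) ≤ Real.exp (-τ) * Real.exp a :=
      mul_le_mul_of_nonneg_left (Real.add_one_le_exp a) (Real.exp_pos _).le
    have h5 : Real.exp (-τ) * a ≤ κ := by linarith
    have h6 : a ≤ Real.exp τ * κ := by
      have := mul_le_mul_of_nonneg_left h5 (Real.exp_pos τ).le
      rwa [← mul_assoc, ← Real.exp_add, add_neg_cancel, Real.exp_zero, one_mul] at this
    have h7 : Real.exp τ ≤ 2 * Real.exp (R / fmin) := by
      have e1 : Real.exp τ ≤ Real.exp (1 / 2) * Real.exp t := by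
        rw [← Real.exp_add]; exact Real.exp_le_exp.mpr (by linarith)
      have e2 : Real.exp (1 / 2 : ℝ) ≤ 2 := by
        have := Real.exp_one_lt_d9
        have e3 : Real.exp (1 / 2 : ℝ) ^ 2 = Real.exp 1 := by
          rw [← Real.exp_nat_mul]; norm_num
        nlinarith [Real.exp_pos (1 / 2 : ℝ)]
      have e4 : Real.exp t ≤ Real.exp (R / fmin) := by
        rw [hvt] at hge
        exact Real.exp_le_exp.mpr (by linarith [Real.exp_le_exp.mp hge])
      exact e1.trans (mul_le_mul e2 e4 (Real.exp_pos _).le (by norm_num))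
    calc fM * a ≤ fM * (2 * Real.exp (R / fmin) * κ) :=
          mul_le_mul_of_nonneg_left (h6.trans (mul_le_mul_of_nonneg_right h7 hκ.le)) hp.fM_pos.le
      _ = _ := by ring
  -- Right after its last time in `K'` the path is in `Ω` and off `K` by continuity, so `y a` is a
  -- limit of points outside both sets.
  · have hne' : (nhdsWithin a (Ioo a τ)).NeBot := left_nhdsWithin_Ioo_neBot haτ
    have hcont : Filter.Tendsto y (nhdsWithin a (Ioo a τ)) (nhds (y a)) :=
      (hyc a haI).mono_left (nhdsWithin_mono _ (fun s hs => ⟨haI.1.trans hs.1.le, hs.2.le⟩))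
    refine mem_closure_of_tendsto hcont ?_
    have hU : p.Ω ∩ Kᶜ ∈ nhds (y a) :=
      (p.isOpen.inter hKc.isClosed.isOpen_compl).mem_nhds
        ⟨hK' haK, fun h => Set.disjoint_left.mp hdisj h haK⟩
    filter_upwards [hcont hU, self_mem_nhdsWithin] with s hs hsI
    refine ⟨hs.1, fun h => ?_⟩
    rcases h with h | h
    · exact hs.2 h
    · have := hmax ⟨⟨haI.1.trans hsI.1.le, hsI.2.le⟩, h⟩
      exact absurd hsI.1 (not_lt.mpr this)

end Regular
end Problem
-- Lattice points near Lipschitz paths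
theorem sum_pow_le_of_injOn {ι : Type*} (s : Finset ι) (g : ι → ℕ) (hg : Set.InjOn g s) {r : ℝ}
    (hr : 0 ≤ r) (hr1 : r < 1) : ∑ k ∈ s, r ^ g k ≤ (1 - r)⁻¹ := by
  classical
  rw [← Finset.sum_image (f := fun j => r ^ j) hg, ← tsum_geometric_of_lt_one hr hr1]
  exact (summable_geometric_of_lt_one hr hr1).sum_le_tsum _ (fun _ _ => pow_nonneg hr _)

/-- As `t ^ 2 ≥ 2 * t - 1`, Gaussian tails can be replaced by geometric series. -/
theorem exp_neg_sq_le (t : ℝ) : Real.exp (-t ^ 2) ≤ Real.exp 1 * Real.exp (-(2 * t)) := by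
  rw [← Real.exp_add]
  exact Real.exp_le_exp.mpr (by nlinarith [sq_nonneg (t - 1)])

/-- One-dimensional Gaussian sums over the integers. -/
theorem sum_gaussian_le (s : Finset ℤ) (a : ℝ) {μ : ℝ} (hμ : 0 < μ) :
    ∑ k ∈ s, Real.exp (-(μ * (k - a)) ^ 2) ≤ 2 * Real.exp 1 * (1 + 1 / μ) := by
  classical
  set r := Real.exp (-(2 * μ)) with hr
  have hr0 : 0 ≤ r := (Real.exp_pos _).le
  have hr1 : r < 1 := Real.exp_lt_one_iff.mpr (by linarith)
  have hinv : (1 - r)⁻¹ ≤ 1 + 1 / μ := by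
    have h1 : r * (2 * μ + 1) ≤ 1 := by
      have := mul_le_mul_of_nonneg_left (Real.add_one_le_exp (2 * μ)) hr0
      rwa [hr, ← Real.exp_add, neg_add_cancel, Real.exp_zero] at this
    rw [inv_le_comm₀ (by linarith) (by positivity)]
    have h2 : (1 + 1 / μ)⁻¹ = μ / (μ + 1) := by field_simp
    rw [h2, div_le_iff₀ (by linarith)]
    nlinarith
  have hpow : ∀ j : ℕ, r ^ j = Real.exp (-(2 * (μ * j))) := by
    intro j
    rw [hr, ← Real.exp_nat_mul]
    congr 1; ring
  have hterm : ∀ (k : ℤ) (j : ℕ), (j : ℝ) ≤ |(k : ℝ) - a| →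
      Real.exp (-(μ * (k - a)) ^ 2) ≤ Real.exp 1 * r ^ j := by
    intro k j hj
    have h1 : (μ * ((k : ℝ) - a)) ^ 2 = (μ * |(k : ℝ) - a|) ^ 2 := by
      rw [mul_pow, mul_pow, sq_abs]
    rw [h1, hpow]
    refine (exp_neg_sq_le _).trans (mul_le_mul_of_nonneg_left ?_ (Real.exp_pos _).le)
    exact Real.exp_le_exp.mpr (by nlinarith)
  -- Integers `k ≥ ⌈a⌉` are at distance at least `k - ⌈a⌉` from `a`, smaller ones at distance at
  -- least `⌈a⌉ - 1 - k`; each side is bounded by a geometric series.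
  rw [← Finset.sum_filter_add_sum_filter_not s (fun k : ℤ => ⌈a⌉ ≤ k)]
  have h1 : ∑ k ∈ s.filter (fun k : ℤ => ⌈a⌉ ≤ k), Real.exp (-(μ * (k - a)) ^ 2) ≤
      Real.exp 1 * (1 - r)⁻¹ := by
    refine (Finset.sum_le_sum (g := fun k => Real.exp 1 * r ^ (k - ⌈a⌉).toNat)
      (fun k hk => hterm k _ ?_)).trans ?_
    · have hk' : ⌈a⌉ ≤ k := (Finset.mem_filter.mp hk).2
      have e : (((k - ⌈a⌉).toNat : ℕ) : ℝ) = (k : ℝ) - ⌈a⌉ := by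
        have : (((k - ⌈a⌉).toNat : ℕ) : ℤ) = k - ⌈a⌉ := Int.toNat_of_nonneg (by omega)
        exact_mod_cast this
      rw [e]
      exact (sub_le_sub_left (Int.le_ceil a) _).trans (le_abs_self _)
    · rw [← Finset.mul_sum]
      refine mul_le_mul_of_nonneg_left (sum_pow_le_of_injOn _ _ ?_ hr0 hr1) (Real.exp_pos _).le
      intro k hk k' hk' h
      have h1 := (Finset.mem_filter.mp hk).2
      have h2 := (Finset.mem_filter.mp hk').2
      simp only at h
      omega
  have h2 : ∑ k ∈ s.filter (fun k : ℤ => ¬ ⌈a⌉ ≤ k), Real.exp (-(μ * (k - a)) ^ 2) ≤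
      Real.exp 1 * (1 - r)⁻¹ := by
    refine (Finset.sum_le_sum (g := fun k => Real.exp 1 * r ^ (⌈a⌉ - 1 - k).toNat)
      (fun k hk => hterm k _ ?_)).trans ?_
    · have hk' : ¬ ⌈a⌉ ≤ k := (Finset.mem_filter.mp hk).2
      have e : (((⌈a⌉ - 1 - k).toNat : ℕ) : ℝ) = (⌈a⌉ : ℝ) - 1 - k := by
        have : (((⌈a⌉ - 1 - k).toNat : ℕ) : ℤ) = ⌈a⌉ - 1 - k := Int.toNat_of_nonneg (by omega)
        exact_mod_cast this
      rw [e, abs_sub_comm]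
      exact le_trans (by linarith [Int.ceil_lt_add_one a]) (le_abs_self _)
    · rw [← Finset.mul_sum]
      refine mul_le_mul_of_nonneg_left (sum_pow_le_of_injOn _ _ ?_ hr0 hr1) (Real.exp_pos _).le
      intro k hk k' hk' h
      have h1 := (Finset.mem_filter.mp hk).2
      have h2 := (Finset.mem_filter.mp hk').2
      simp only at h
      omega
  have h3 := mul_le_mul_of_nonneg_left hinv (Real.exp_pos 1).le
  linarith

/-- The number of lattice points in a Euclidean ball of radius `√d r`. -/
theorem card_le_of_ball {d : ℕ} (T : Finset (Pt d)) (o c : Pt d) {H r : ℝ} (hH : 0 < H)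
    (hr : 0 < r) (hT : ∀ z ∈ T, ∀ i, ∃ k : ℤ, z i = o i + H * k)
    (hball : ∀ z ∈ T, ‖z - c‖ ≤ √d * r) : (T.card : ℝ) ≤ (15 * (1 + r / H)) ^ d := by
  classical
  choose! k hk using hT
  set a : Fin d → ℝ := fun i => (c i - o i) / H with ha
  set μ : ℝ := H / r with hμ
  have hμ0 : 0 < μ := div_pos hH hr
  have hinj : Set.InjOn k T := by
    intro z hz z' hz' h
    ext i
    rw [hk z hz i, hk z' hz' i, h]
  -- Each point of the ball has a Gaussian weight of at least `e^{-d}`, and the sum of the weights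
  -- over a product set factors. So a ball of radius `√d * r` contributes only a constant to the
  -- power `d`, while the cube around it would cost an extra factor `d^{d/2}`.
  have hsum : ∀ z ∈ T, Real.exp (-(d : ℝ)) ≤ ∏ i, Real.exp (-(μ * (k z i - a i)) ^ 2) := by
    intro z hz
    rw [← Real.exp_sum]
    refine Real.exp_le_exp.mpr ?_
    rw [Finset.sum_neg_distrib]
    refine neg_le_neg ?_
    have h1 : ∀ i, (μ * (k z i - a i)) ^ 2 = r⁻¹ ^ 2 * (z i - c i) ^ 2 := by
      intro i
      rw [hk z hz i, ha, hμ]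
      field_simp
      ring
    simp only [h1]
    rw [← Finset.mul_sum]
    have h2 : ∑ i, (z i - c i) ^ 2 = ‖z - c‖ ^ 2 := by
      rw [EuclideanSpace.norm_sq_eq]
      simp
    rw [h2]
    have h3 : ‖z - c‖ ^ 2 ≤ (√d * r) ^ 2 := pow_le_pow_left₀ (norm_nonneg _) (hball z hz) 2
    rw [mul_pow, Real.sq_sqrt (Nat.cast_nonneg d)] at h3
    calc r⁻¹ ^ 2 * ‖z - c‖ ^ 2 ≤ r⁻¹ ^ 2 * (d * r ^ 2) :=
          mul_le_mul_of_nonneg_left h3 (by positivity)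
      _ = d := by field_simp
  have h1 : (T.card : ℝ) * Real.exp (-(d : ℝ)) ≤ (2 * Real.exp 1 * (1 + 1 / μ)) ^ d := by
    calc (T.card : ℝ) * Real.exp (-(d : ℝ)) = ∑ z ∈ T, Real.exp (-(d : ℝ)) := by
          rw [Finset.sum_const, nsmul_eq_mul]
      _ ≤ ∑ z ∈ T, ∏ i, Real.exp (-(μ * (k z i - a i)) ^ 2) := Finset.sum_le_sum hsum
      _ = ∑ q ∈ T.image k, ∏ i, Real.exp (-(μ * (q i - a i)) ^ 2) :=
          (Finset.sum_image (f := fun q : Fin d → ℤ => ∏ i, Real.exp (-(μ * (q i - a i)) ^ 2))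
            hinj).symm
      _ ≤ ∑ q ∈ Fintype.piFinset (fun i => (T.image k).image (fun q => q i)),
            ∏ i, Real.exp (-(μ * (q i - a i)) ^ 2) := by
          refine Finset.sum_le_sum_of_subset_of_nonneg (fun q hq => ?_)
            (fun _ _ _ => Finset.prod_nonneg (fun _ _ => (Real.exp_pos _).le))
          exact Fintype.mem_piFinset.mpr (fun i => Finset.mem_image_of_mem _ hq)
      _ = ∏ i, ∑ m ∈ (T.image k).image (fun q => q i), Real.exp (-(μ * (m - a i)) ^ 2) :=
          (Finset.prod_univ_sum (fun i => (T.image k).image (fun q => q i))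
            (fun i (m : ℤ) => Real.exp (-(μ * (m - a i)) ^ 2))).symm
      _ ≤ ∏ _i : Fin d, (2 * Real.exp 1 * (1 + 1 / μ)) :=
          Finset.prod_le_prod (fun _ _ => Finset.sum_nonneg (fun _ _ => (Real.exp_pos _).le))
            (fun i _ => sum_gaussian_le _ _ hμ0)
      _ = _ := by rw [Finset.prod_const, Finset.card_univ, Fintype.card_fin]
  have h2 : (T.card : ℝ) ≤ (Real.exp 1) ^ d * (2 * Real.exp 1 * (1 + 1 / μ)) ^ d := by
    have := mul_le_mul_of_nonneg_left h1 (Real.exp_pos (d : ℝ)).le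
    rw [mul_left_comm, ← Real.exp_add, add_neg_cancel, Real.exp_zero, mul_one] at this
    rwa [← Real.exp_nat_mul, mul_one]
  refine h2.trans ?_
  rw [← mul_pow]
  refine pow_le_pow_left₀ (by positivity) ?_ d
  -- `2 e² < 15`: one `e` comes from the weight `e^{-d}`, the other from the one-dimensional sums.
  have h3 : Real.exp 1 * (2 * Real.exp 1) ≤ 15 := by
    nlinarith [Real.exp_one_lt_d9, Real.exp_pos 1]
  have h4 : 1 / μ = r / H := by rw [hμ, one_div_div]
  rw [h4, ← mul_assoc]
  exact mul_le_mul_of_nonneg_right h3 (by positivity)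

/-- The number of lattice points in a tube around `n` Lipschitz paths. -/
theorem card_le_of_tube {d n : ℕ} (hd : 0 < d) (T : Finset (Pt d)) (o : Pt d) {H r fM Tm : ℝ}
    (hH : 0 < H) (hr : 0 < r) (hfM : 0 < fM)
    (hTm : 0 ≤ Tm)     (y : Fin n → ℝ → Pt d) (τ : Fin n → ℝ)
    (hLip : ∀ i, ∀ s ∈ Icc 0 (τ i), ∀ t ∈ Icc 0 (τ i), ‖y i t - y i s‖ ≤ fM * |t - s|)
    (hτ : ∀ i, τ i ≤ Tm) (hT : ∀ z ∈ T, ∀ i, ∃ k : ℤ, z i = o i + H * k)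
    (hnear : ∀ z ∈ T, ∃ i, ∃ t ∈ Icc 0 (τ i), ‖z - y i t‖ ≤ √d * r) :
    (T.card : ℝ) ≤ n * ((Tm * fM / r + 1) * (15 * (1 + 2 * r / H)) ^ d) := by
  classical
  -- In a time `δ` a path moves by at most `r ≤ √d * r`, so balls of doubled radius around the
  -- points at multiples of `δ` cover the tube.
  set δ := r / fM with hδ
  have hδ0 : 0 < δ := div_pos hr hfM
  set N := ⌊Tm / δ⌋₊ + 1 with hN
  have hd1 : 1 ≤ √(d : ℝ) := Real.one_le_sqrt.mpr (by exact_mod_cast hd)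
  have hsub : T ⊆ (Finset.univ ×ˢ Finset.range N).biUnion (fun q : Fin n × ℕ =>
      T.filter (fun z => ‖z - y q.1 (q.2 * δ)‖ ≤ √d * (2 * r))) := by
    intro z hz
    obtain ⟨i, t, ht, hzt⟩ := hnear z hz
    have hj : (⌊t / δ⌋₊ : ℝ) * δ ≤ t := by
      have := Nat.floor_le (div_nonneg ht.1 hδ0.le)
      rwa [le_div_iff₀ hδ0] at this
    have hj' : t - ⌊t / δ⌋₊ * δ ≤ δ := by
      have := Nat.lt_floor_add_one (t / δ)
      rw [div_lt_iff₀ hδ0] at this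
      linarith
    refine Finset.mem_biUnion.mpr ⟨(i, ⌊t / δ⌋₊), ?_, Finset.mem_filter.mpr ⟨hz, ?_⟩⟩
    · refine Finset.mem_product.mpr ⟨Finset.mem_univ _, Finset.mem_range.mpr ?_⟩
      exact Nat.lt_succ_of_le (Nat.floor_le_floor
        (div_le_div_of_nonneg_right (ht.2.trans (hτ i)) hδ0.le))
    · have h1 := hLip i (⌊t / δ⌋₊ * δ) ⟨by positivity, hj.trans ht.2⟩ t ht
      rw [abs_of_nonneg (by linarith)] at h1
      have h2 : fM * (t - ⌊t / δ⌋₊ * δ) ≤ r :=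
        (mul_le_mul_of_nonneg_left hj' hfM.le).trans (by rw [hδ]; field_simp; exact le_rfl)
      have h3 : r ≤ √d * r := le_mul_of_one_le_left hr.le hd1
      have h4 := norm_add_le (z - y i t) (y i t - y i (⌊t / δ⌋₊ * δ))
      rw [sub_add_sub_cancel] at h4
      simp only
      linarith
  have hcard := (Finset.card_le_card hsub).trans Finset.card_biUnion_le
  have h1 : (T.card : ℝ) ≤ ∑ q ∈ (Finset.univ : Finset (Fin n)) ×ˢ Finset.range N,
      (15 * (1 + 2 * r / H)) ^ d := by
    refine le_trans (Nat.cast_le.mpr hcard) ?_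
    rw [Nat.cast_sum]
    refine Finset.sum_le_sum (fun q _ => ?_)
    exact card_le_of_ball _ o (y q.1 (q.2 * δ)) hH (by linarith : 0 < 2 * r)
      (fun z hz => hT z (Finset.mem_filter.mp hz).1) (fun z hz => (Finset.mem_filter.mp hz).2)
  refine h1.trans ?_
  rw [Finset.sum_const, Finset.card_product, Finset.card_univ, Fintype.card_fin,
    Finset.card_range, nsmul_eq_mul, Nat.cast_mul, mul_assoc]
  refine mul_le_mul_of_nonneg_left (mul_le_mul_of_nonneg_right ?_ (by positivity))
    (Nat.cast_nonneg _)
  rw [hN]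
  push_cast
  have := Nat.floor_le (div_nonneg hTm hδ0.le)
  have e : Tm / δ = Tm * fM / r := by rw [hδ, div_div_eq_mul_div]
  linarith

theorem norm_le_sqrt_mul {d : ℕ} (w : Pt d) {r : ℝ} (hr : 0 ≤ r) (h : ∀ i, |w i| ≤ r) :
    ‖w‖ ≤ √d * r := by
  rw [EuclideanSpace.norm_eq]
  refine Real.sqrt_le_iff.mpr ⟨by positivity, ?_⟩
  rw [mul_pow, Real.sq_sqrt (Nat.cast_nonneg d)]
  calc ∑ i, ‖w i‖ ^ 2 ≤ ∑ _i : Fin d, r ^ 2 :=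
        Finset.sum_le_sum (fun i _ => pow_le_pow_left₀ (norm_nonneg _)
          (by rw [Real.norm_eq_abs]; exact h i) 2)
    _ = d * r ^ 2 := by simp

theorem exists_lattice_near {d : ℕ} (o x : Pt d) {H : ℝ} (hH : 0 < H) :
    ∃ x' : Pt d, (∀ i, ∃ k : ℤ, x' i = o i + H * k) ∧ ∀ i, |x i - x' i| ≤ H / 2 := by
  refine ⟨WithLp.toLp 2 (fun i => o i + H * (round ((x i - o i) / H) : ℝ)), fun i => ⟨_, rfl⟩,
    fun i => ?_⟩
  have h1 := abs_sub_round ((x i - o i) / H)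
  have h2 : x i - (o i + H * (round ((x i - o i) / H) : ℝ)) =
      H * ((x i - o i) / H - round ((x i - o i) / H)) := by
    rw [mul_sub, mul_div_cancel₀ _ hH.ne']; ring
  change |x i - (o i + H * (round ((x i - o i) / H) : ℝ))| ≤ H / 2
  rw [h2, abs_mul, abs_of_pos hH]
  nlinarith

/-! ### Connectedness after the removal of finitely many points -/

theorem isConnected_ball_diff_singleton {E : Type*} [NormedAddCommGroup E]
    [InnerProductSpace ℝ E] (hE : 1 < Module.rank ℝ E) (x : E) {r : ℝ} (hr : 0 < r) :
    IsConnected (Metric.ball x r \ {x}) := by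
  have h1 : IsConnected ({0}ᶜ : Set E) := isConnected_compl_singleton_of_one_lt_rank hE 0
  -- `univBall` maps the whole space injectively and continuously onto the ball, and `0` to its
  -- centre, so the punctured ball is an image of the punctured space.
  have h2 := h1.image (OpenPartialHomeomorph.univBall x r)
    (OpenPartialHomeomorph.continuous_univBall x r).continuousOn
  have hinj : Function.Injective (OpenPartialHomeomorph.univBall x r) := by
    intro a b hab
    refine (OpenPartialHomeomorph.univBall x r).injOn ?_ ?_ hab <;>
      simp
  have h3 : OpenPartialHomeomorph.univBall x r '' univ = Metric.ball x r := by
    have := (OpenPartialHomeomorph.univBall x r).image_source_eq_target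
    rwa [OpenPartialHomeomorph.univBall_source, OpenPartialHomeomorph.univBall_target x hr] at this
  rwa [compl_eq_univ_sdiff, image_sdiff hinj, h3, image_singleton,
    OpenPartialHomeomorph.univBall_apply_zero] at h2

/-- A connected open set stays connected when a point is removed, in dimension at least two. -/
theorem isConnected_diff_singleton {E : Type*} [NormedAddCommGroup E]
    [InnerProductSpace ℝ E] (hE : 1 < Module.rank ℝ E) {Ω : Set E} (ho : IsOpen Ω)
    (hc : IsConnected Ω) (x : E) : IsConnected (Ω \ {x}) := by
  by_cases hx : x ∈ Ω
  swap
  · rwa [Set.sdiff_singleton_eq_self hx]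
  obtain ⟨r, hr, hball⟩ := Metric.isOpen_iff.mp ho x hx
  have hb := isConnected_ball_diff_singleton hE x hr
  have hbs : Metric.ball x r \ {x} ⊆ Ω \ {x} := fun z hz => ⟨hball hz.1, hz.2⟩
  refine ⟨hb.nonempty.mono hbs, ?_⟩
  -- if an open set contains the punctured ball, then it may be enlarged by the centre
  have key : ∀ U V : Set E, IsOpen U → IsOpen V → Ω \ {x} ⊆ U ∪ V →
      Ω \ {x} ∩ (U ∩ V) = ∅ → Metric.ball x r \ {x} ⊆ U → Ω \ {x} ⊆ U := by
    intro U V hU hV hUV hdisj hbU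
    have h1 := isPreconnected_iff_subset_of_disjoint.mp hc.isPreconnected
      ((U ∩ Ω) ∪ Metric.ball x r) ((V ∩ Ω) \ {x}) ((hU.inter ho).union Metric.isOpen_ball)
      ((hV.inter ho).sdiff isClosed_singleton) ?_ ?_
    · rcases h1 with h1 | h1
      · intro z hz
        rcases h1 hz.1 with h | h
        · exact h.1
        · exact hbU ⟨h, hz.2⟩
      · exact absurd rfl (h1 hx).2
    · intro z hz
      by_cases hzx : z = x
      · left; right; rw [hzx]; exact Metric.mem_ball_self hr
      · rcases hUV ⟨hz, hzx⟩ with h | h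
        · left; left; exact ⟨h, hz⟩
        · right; exact ⟨⟨h, hz⟩, hzx⟩
    · refine eq_empty_of_forall_notMem (fun z hz => ?_)
      obtain ⟨hzΩ, h1, ⟨h2, -⟩, hzx⟩ := hz
      have hzU : z ∈ U := by
        rcases h1 with h | h
        · exact h.1
        · exact hbU ⟨h, hzx⟩
      have : z ∈ Ω \ {x} ∩ (U ∩ V) := ⟨⟨hzΩ, hzx⟩, hzU, h2⟩
      rw [hdisj] at this
      exact this
  rw [isPreconnected_iff_subset_of_disjoint]
  intro U V hU hV hUV hdisj
  have hdisj' : Metric.ball x r \ {x} ∩ (U ∩ V) = ∅ :=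
    subset_empty_iff.mp ((inter_subset_inter_left _ hbs).trans hdisj.subset)
  rcases isPreconnected_iff_subset_of_disjoint.mp hb.isPreconnected U V hU hV
    (hbs.trans hUV) hdisj' with h | h
  · exact Or.inl (key U V hU hV hUV hdisj h)
  · exact Or.inr (key V U hV hU (by rwa [union_comm]) (by rwa [inter_comm V U]) h)

theorem isConnected_diff_finset {E : Type*} [NormedAddCommGroup E]
    [InnerProductSpace ℝ E] (hE : 1 < Module.rank ℝ E) {Ω : Set E} (ho : IsOpen Ω)
    (hc : IsConnected Ω) (s : Finset E) : IsConnected (Ω \ (s : Set E)) := by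
  classical
  induction s using Finset.induction_on with
  | empty => simpa using hc
  | insert a s _ ih =>
    have h := isConnected_diff_singleton hE (ho.sdiff s.finite_toSet.isClosed) ih a
    rw [Set.sdiff_sdiff] at h
    rw [Finset.coe_insert, Set.insert_eq, Set.union_comm]
    exact h

/-! ### Solutions on partial grids: error bounds and acceptance -/

namespace UpdateOperator

variable {d L : ℕ} (A : UpdateOperator d L) {H : ℝ}

theorem march_range (hH : 0 < H) (X start ending : Finset (Pt d)) (x : Pt d) :
    (A.march H X start ending).V x ≤ 1 ∨ (A.march H X start ending).V x = ⊤ := by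
  classical
  rw [march]
  generalize X.card = k
  induction k generalizing x with
  | zero =>
    simp only [Function.iterate_zero, id, initState]
    split_ifs
    · exact A.range H hH _ _
    · left; exact zero_le_one
    · right; rfl
  | succ k ih =>
    rw [Function.iterate_succ_apply']
    generalize (A.step H X ending)^[k] (A.initState H X start) = s at ih
    by_cases h : s.narrow.Nonempty ∧ ¬ ending ⊆ s.accepted
    · obtain ⟨_, -, -, Y, -, hstep⟩ := A.exists_step (H := H) (X := X) h
      rw [hstep]
      simp only
      split_ifs
      · exact A.range H hH _ _
      · exact ih x
    · rw [A.step_eq_self h]; exact ih x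

end UpdateOperator

theorem mem_inter {d : ℕ} {G : Finset (Pt d)} {K : Set (Pt d)} {x : Pt d} :
    x ∈ Setup.inter G K ↔ x ∈ G ∧ x ∈ K := by
  simp only [Setup.inter, Finset.mem_filter]

theorem inter_subset {d : ℕ} (G : Finset (Pt d)) (K : Set (Pt d)) : Setup.inter G K ⊆ G :=
  fun _ hx => (mem_inter.mp hx).1

namespace UpdateOperator

variable {d L : ℕ} (A : UpdateOperator d L) {H : ℝ}

/-- The values of the full fast marching method on the node set `G`, started from `K`. -/
noncomputable def sol (H : ℝ) (G : Finset (Pt d)) (K : Set (Pt d)) : Pt d → ℝ≥0∞ :=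
  (A.march H G (Setup.inter G K) (Setup.inter G univ)).V

theorem isSolution_sol (hH : 0 < H) (G : Finset (Pt d)) (K : Set (Pt d)) :
    A.IsSolution H G (Setup.inter G K) (A.sol H G K) :=
  A.isSolution_march hH (inter_subset G K) (fun _ hx => mem_inter.mpr ⟨hx, mem_univ _⟩)

theorem sol_mono (hH : 0 < H) {G G' : Finset (Pt d)} (K : Set (Pt d)) (h : G ⊆ G') :
    A.sol H G' K ≤ A.sol H G K :=
  (A.isSolution_sol hH G K).mono (A.isSolution_sol hH G' K) hH h
    (fun _ hx => mem_inter.mpr ⟨h (mem_inter.mp hx).1, (mem_inter.mp hx).2⟩)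

end UpdateOperator
theorem UpdateOperator.norm_sub_le_of_mem_neighbors {d L : ℕ} (A : UpdateOperator d L) {H : ℝ}
    (hH : 0 < H) {y z : Pt d} (hz : z ∈ A.neighbors H y) : ‖z - y‖ ≤ √d * ((L + 1) * H) := by
  refine norm_le_sqrt_mul _ (by positivity) (fun i => ?_)
  obtain ⟨k, hk, hzk⟩ := A.neighbors_offset H hH y z hz i
  have h1 : (z - y) i = H * k := by
    change z i - y i = H * k
    rw [hzk]; ring
  have h2 : |(k : ℝ)| ≤ L := by exact_mod_cast hk
  rw [h1, abs_mul, abs_of_pos hH]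
  nlinarith

/-- Upper bound for the values on a node set `G` that contains all nodes with a small value of
`F`, from the upper bound on a node set that contains `K` and `K'`. -/
theorem UpdateOperator.sol_le_of_cover {d L : ℕ} (A : UpdateOperator d L) {H : ℝ} (hH : 0 < H)
    {K K' : Set (Pt d)} {v v' F : Pt d → ℝ} {e₁ e₂ I δ η' : ℝ} {X X' G : Finset (Pt d)}
    (hvK : ∀ z ∈ K, v z = 0) (hvK' : ∀ z ∈ K', v' z = 0)
    (hF : ∀ z, F z = v z + v' z - v z * v' z)
    (hv0 : ∀ z, 0 ≤ v z) (hv1 : ∀ z, v z ≤ 1) (hv0' : ∀ z, 0 ≤ v' z)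
    (hv' : ∀ x ∈ X, ∀ y ∈ X, ‖x - y‖ ≤ √d * ((L + 1) * H) → |v' x - v' y| ≤ e₁)
    (hFc : ∀ x ∈ X, ∀ y ∈ X, ‖x - y‖ ≤ √d * ((L + 1) * H) → |F x - F y| ≤ e₁)
    (hX' : X' ⊆ X) (hmem : ∀ z ∈ X', F z ≤ I + η' ∨ z ∈ K ∨ z ∈ K')
    (hcover : ∀ z ∈ X, F z < I + δ → z ∈ G)
    (hlow : ∀ z ∈ X, ENNReal.ofReal (v z) ≤ A.sol H X K z + ENNReal.ofReal e₂)
    (he₁ : 0 ≤ e₁) (he₂ : 0 ≤ e₂) (hI : 0 ≤ I) (h1 : e₁ < δ) (h2 : η' + e₁ < δ)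
    {x : Pt d} (hx : x ∈ G) (hxv : A.sol H X' K x ≤ ENNReal.ofReal (v x + e₂))
    (hxF : F x < I + δ - 2 * e₂) : A.sol H G K x ≤ ENNReal.ofReal (v x + e₂) := by
  refine le_trans ?_ hxv
  have hout : ∀ z ∈ X', z ∉ G → I + δ ≤ F z := fun z hz hzG => by
    by_contra hh
    exact hzG (hcover z (hX' hz) (not_le.mp hh))
  -- A node of `X'` missing from `G` has `F ≥ I + δ`. If it is not in `K`, it is in `K'`, where `F =
  -- v`, and the lower error bound puts its value above the cut `I + δ - e₂`. If it is in `K`, then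
  -- `v' = F ≥ I + δ` there, too large for a neighbour of a node of `X'` outside `K`.
  refine (A.isSolution_sol hH G K).le_of_cut (A.isSolution_sol hH X' K) hH
    (fun z hz hzG => mem_inter.mpr ⟨hzG, (mem_inter.mp hz).2⟩)
    (c := ENNReal.ofReal (I + δ - e₂)) (fun z hz hzK hzG => ?_)
    (fun z hz hzG y hy hyK hzy => ?_) hx (hxv.trans_lt ?_)
  · have hFz := hout z hz hzG
    have hzK' : z ∈ K' := by
      rcases hmem z hz with h | h | h
      · linarith
      · exact absurd (mem_inter.mpr ⟨hz, h⟩) hzK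
      · exact h
    have hFv : F z = v z := by rw [hF, hvK' z hzK']; ring
    have h3 := (hlow z (hX' hz)).trans (add_le_add_left (A.sol_mono hH K hX' z) _)
    rw [← tsub_le_iff_right, ← ENNReal.ofReal_sub _ he₂] at h3
    exact (ENNReal.ofReal_le_ofReal (by linarith)).trans h3
  · obtain ⟨hzX, hzK⟩ := mem_inter.mp hz
    have hFz := hout z hzX hzG
    have hd := A.norm_sub_le_of_mem_neighbors hH hzy
    rcases hmem y hy with h | h | h
    · have := (abs_le.mp (hFc z (hX' hzX) y (hX' hy) hd)).2
      linarith
    · exact hyK (mem_inter.mpr ⟨hy, h⟩)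
    · have := (abs_le.mp (hv' z (hX' hzX) y (hX' hy) hd)).2
      rw [hvK' y h] at this
      have hFv : F z = v' z := by rw [hF, hvK z hzK]; ring
      linarith
  · refine (ENNReal.ofReal_lt_ofReal_iff_of_nonneg (add_nonneg (hv0 x) he₂)).mpr ?_
    have h4 : F x = v x + v' x * (1 - v x) := by rw [hF]; ring
    have := mul_nonneg (hv0' x) (sub_nonneg.mpr (hv1 x))
    linarith

/-- A node with a small value of `F` is accepted in the partial search. -/
theorem UpdateOperator.mem_accepted_of_small {d L : ℕ} (A : UpdateOperator d L) {H : ℝ}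
    (hH : 0 < H) {K K' : Set (Pt d)} {v v' F : Pt d → ℝ} {e₁ e₂ I κ η c₁ m : ℝ}
    {G : Finset (Pt d)} (hF : ∀ z, F z = v z + v' z - v z * v' z)
    (he₂ : 0 ≤ e₂) (hm : 0 ≤ m)
    (hv0 : ∀ z, 0 ≤ v z) (hv0' : ∀ z, 0 ≤ v' z)
    {x z : Pt d} (hx : x ∈ G) (hxv : A.sol H G K x ≤ ENNReal.ofReal (v x + e₂))
    (hxm : m ≤ 1 - v x) (hxF : F x ≤ I + κ)
    (hdist : (∀ w ∈ K', η ≤ ‖w - x‖) → c₁ * η ≤ v' x)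
    (hz : z ∈ G) (hzK' : z ∈ Metric.thickening η K')
    (hzv : ENNReal.ofReal (v z) ≤ A.sol H G K z + ENNReal.ofReal e₂) (hzI : I - e₁ ≤ v z)
    (hκ : κ + e₁ + 2 * e₂ < c₁ * m * η) :
    x ∈ (A.march H G (Setup.inter G K) (Setup.inter G (Metric.thickening η K'))).accepted := by
  by_contra hcon
  have hsol := A.isSolution_sol hH G K
  obtain ⟨-, -, h⟩ := A.march_spec (ending := Setup.inter G (Metric.thickening η K')) hH
    (inter_subset G K) hsol
  -- If `x` is not accepted, the search has reached its end. Then `x` is at distance at least `η`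
  -- from `K'`, so `v' x ≥ c₁ * η`; and the accepted node `z`, with `v z ≥ I - e₁`, has a value at
  -- most that of `x`. Now `F x = v x + v' x (1 - v x)` exceeds `I + κ`.
  obtain ⟨hend, hle⟩ := h x hx hcon (hxv.trans_lt ENNReal.ofReal_lt_top)
  have hxt : x ∉ Metric.thickening η K' := fun hh => hcon (hend (mem_inter.mpr ⟨hx, hh⟩))
  have hd : ∀ w ∈ K', η ≤ ‖w - x‖ := by
    intro w hw
    by_contra hh
    refine hxt (Metric.mem_thickening_iff.mpr ⟨w, hw, ?_⟩)
    rw [dist_comm, dist_eq_norm]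
    exact not_le.mp hh
  have h1 := hdist hd
  have h2 := hzv.trans (add_le_add_left ((hle z (hend (mem_inter.mpr ⟨hz, hzK'⟩))).trans hxv) _)
  rw [← ENNReal.ofReal_add (add_nonneg (hv0 x) he₂) he₂,
    ENNReal.ofReal_le_ofReal_iff (by linarith [hv0 x])] at h2
  have h3 : F x = v x + v' x * (1 - v x) := by rw [hF]; ring
  have h4 : c₁ * η * m ≤ v' x * (1 - v x) := mul_le_mul h1 hxm hm (hv0' x)
  nlinarith

/-- For arguments in `[0, 1]`, both partial derivatives of `s + t - s t` are in `[0, 1]`, so errors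
`e` in the two arguments change it by at most `2 * e`. -/
theorem le_combine {a b : ℝ≥0∞} {s t e : ℝ} (ha : a ≤ 1 ∨ a = ⊤) (hb : b ≤ 1 ∨ b = ⊤)
    (hs : 0 ≤ s) (hs1 : s ≤ 1) (he : 0 ≤ e)
    (hsa : ENNReal.ofReal s ≤ a + ENNReal.ofReal e)
    (htb : ENNReal.ofReal t ≤ b + ENNReal.ofReal e) :
    ENNReal.ofReal (s + t - s * t - 2 * e) ≤ combine a b := by
  unfold combine
  split_ifs with h
  · exact le_top
  · rw [not_or] at h
    have ha1 : a ≤ 1 := ha.resolve_right h.1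
    have hb1 : b ≤ 1 := hb.resolve_right h.2
    lift a to NNReal using h.1
    lift b to NNReal using h.2
    have ha1' : (a : ℝ) ≤ 1 := by exact_mod_cast ha1
    have hb1' : (b : ℝ) ≤ 1 := by exact_mod_cast hb1
    rw [← ENNReal.ofReal_coe_nnreal (p := a)] at hsa ⊢
    rw [← ENNReal.ofReal_coe_nnreal (p := b)] at htb ⊢
    rw [← ENNReal.ofReal_add a.coe_nonneg he, ENNReal.ofReal_le_ofReal_iff (add_nonneg a.coe_nonneg he)] at hsa
    rw [← ENNReal.ofReal_add b.coe_nonneg he, ENNReal.ofReal_le_ofReal_iff (add_nonneg b.coe_nonneg he)] at htb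
    rw [← ENNReal.ofReal_add a.coe_nonneg b.coe_nonneg, ← ENNReal.ofReal_mul a.coe_nonneg,
      ← ENNReal.ofReal_sub _ (mul_nonneg a.coe_nonneg b.coe_nonneg)]
    refine ENNReal.ofReal_le_ofReal ?_
    have hb0 : (0 : ℝ) ≤ b := b.coe_nonneg
    have e1 : (1 - (b : ℝ)) * (s - a) ≤ 1 * e := by
      have h1 : (1 - (b : ℝ)) * (s - a) ≤ (1 - b) * e :=
        mul_le_mul_of_nonneg_left (by linarith) (by linarith)
      have h2 : (1 - (b : ℝ)) * e ≤ 1 * e := mul_le_mul_of_nonneg_right (by linarith) he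
      linarith
    have e2 : (1 - s) * (t - b) ≤ 1 * e := by
      have h1 : (1 - s) * (t - b) ≤ (1 - s) * e :=
        mul_le_mul_of_nonneg_left (by linarith) (by linarith)
      have h2 : (1 - s) * e ≤ 1 * e := mul_le_mul_of_nonneg_right (by linarith) he
      linarith
    nlinarith

theorem combine_le {a b : ℝ≥0∞} {s t e : ℝ} (ha : a ≤ 1 ∨ a = ⊤) (hb : b ≤ 1 ∨ b = ⊤)
    (hs : 0 ≤ s) (hs1 : s ≤ 1) (ht : 0 ≤ t) (he : 0 ≤ e)
    (hsa : a ≤ ENNReal.ofReal (s + e)) (htb : b ≤ ENNReal.ofReal (t + e)) :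
    combine a b ≤ ENNReal.ofReal (s + t - s * t + 2 * e) := by
  have ha0 : a ≠ ⊤ := (hsa.trans_lt ENNReal.ofReal_lt_top).ne
  have hb0 : b ≠ ⊤ := (htb.trans_lt ENNReal.ofReal_lt_top).ne
  unfold combine
  rw [if_neg (by simp [ha0, hb0])]
  have ha1 : a ≤ 1 := ha.resolve_right ha0
  have hb1 : b ≤ 1 := hb.resolve_right hb0
  lift a to NNReal using ha0
  lift b to NNReal using hb0
  have ha1' : (a : ℝ) ≤ 1 := by exact_mod_cast ha1
  have hb1' : (b : ℝ) ≤ 1 := by exact_mod_cast hb1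
  rw [← ENNReal.ofReal_coe_nnreal (p := a)] at hsa ⊢
  rw [← ENNReal.ofReal_coe_nnreal (p := b)] at htb ⊢
  rw [ENNReal.ofReal_le_ofReal_iff (by linarith)] at hsa htb
  rw [← ENNReal.ofReal_add a.coe_nonneg b.coe_nonneg, ← ENNReal.ofReal_mul a.coe_nonneg,
    ← ENNReal.ofReal_sub _ (mul_nonneg a.coe_nonneg b.coe_nonneg)]
  refine ENNReal.ofReal_le_ofReal ?_
  have hb0 : (0 : ℝ) ≤ b := b.coe_nonneg
  have e1 : (1 - (b : ℝ)) * (a - s) ≤ 1 * e := by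
    have h1 : (1 - (b : ℝ)) * (a - s) ≤ (1 - b) * e :=
      mul_le_mul_of_nonneg_left (by linarith) (by linarith)
    have h2 : (1 - (b : ℝ)) * e ≤ 1 * e := mul_le_mul_of_nonneg_right (by linarith) he
    linarith
  have e2 : (1 - s) * (b - t) ≤ 1 * e := by
    have h1 : (1 - s) * (b - t) ≤ (1 - s) * e :=
      mul_le_mul_of_nonneg_left (by linarith) (by linarith)
    have h2 : (1 - s) * e ≤ 1 * e := mul_le_mul_of_nonneg_right (by linarith) he
    linarith
  nlinarith

/-! ### Neighbourhoods of the optimal trajectories and errors at one mesh step -/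

namespace Problem

variable {d : ℕ} {p : Problem d}

theorem nbd_subset (η : ℝ) : p.nbd η ⊆ p.Ω := fun _ hx => hx.1.1

theorem nbd_mono {η η' : ℝ} (h : η ≤ η') : p.nbd η ⊆ p.nbd η' :=
  fun _ hx => ⟨hx.1, hx.2.trans_le (by linarith)⟩

theorem mem_nbd_or {η : ℝ} {x : Pt d} (hx : x ∈ p.Ω) (hF : p.Fv x < p.infFv + η) :
    x ∈ p.nbd η ∨ x ∈ p.Ksrc ∪ p.Kdst := by
  by_cases h : x ∈ p.Ksrc ∪ p.Kdst
  · exact Or.inr h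
  · exact Or.inl ⟨⟨hx, h⟩, hF⟩

theorem Regular.Fv_le_of_mem_closure {fmin fM R : ℝ} (hp : p.Regular fmin fM R) {η : ℝ}
    {x : Pt d} (hx : x ∈ closure (p.nbd η)) : p.Fv x ≤ p.infFv + η := by
  refine le_of_forall_pos_le_add (fun ε hε => ?_)
  have hf := hp.fmin_pos
  obtain ⟨y, hy, hxy⟩ := Metric.mem_closure_iff.mp hx (ε / (2 / fmin)) (by positivity)
  rw [dist_eq_norm] at hxy
  have h1 := (abs_le.mp (hp.Fv_lipschitz (closure_mono (nbd_subset η) hx)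
    (subset_closure hy.1.1))).2
  have h2 : 2 / fmin * ‖x - y‖ ≤ ε := by
    have := mul_le_mul_of_nonneg_left hxy.le (show 0 ≤ 2 / fmin by positivity)
    rwa [mul_div_cancel₀ _ (by positivity)] at this
  linarith [hy.2]

/-- A segment that starts in `Ω` stays in `Ω` as long as `F_v` is small along it. -/
theorem mem_of_segment {η : ℝ} (hη : closure (p.nbd η) ⊆ p.Ω)
    {x x' : Pt d} (hx : x ∈ p.Ω)
    (hF : ∀ z ∈ p.Ω, ‖z - x‖ ≤ ‖x' - x‖ → p.Fv z < p.infFv + η) : x' ∈ p.Ω := by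
  by_contra hx'
  set g : ℝ → Pt d := fun s => x + s • (x' - x) with hg
  have hgc : Continuous g := by fun_prop
  have hS : IsCompact (Icc (0 : ℝ) 1 ∩ g ⁻¹' p.Ωᶜ) :=
    isCompact_Icc.inter_right (p.isOpen.isClosed_compl.preimage hgc)
  -- Just before a first exit from `Ω` the segment is in the neighbourhood, so the exit point would
  -- be in its closure, which lies in `Ω`.
  obtain ⟨a, ⟨haI, ha⟩, hmin⟩ := hS.exists_isLeast ⟨1, ⟨zero_le_one, le_rfl⟩, by
    simpa [hg] using hx'⟩
  have ha0 : 0 < a := by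
    refine lt_of_le_of_ne haI.1 (fun h => ha ?_)
    rw [← h]; simpa [hg] using hx
  have haK : g a ∉ p.Ksrc ∪ p.Kdst := fun h => ha (by
    rcases h with h | h
    · exact p.src_subset h
    · exact p.dst_subset h)
  refine ha (hη ?_)
  have hne : (nhdsWithin a (Ioo 0 a)).NeBot := right_nhdsWithin_Ioo_neBot ha0
  have hcont : Filter.Tendsto g (nhdsWithin a (Ioo 0 a)) (nhds (g a)) :=
    hgc.continuousAt.tendsto.mono_left nhdsWithin_le_nhds
  refine mem_closure_of_tendsto hcont ?_
  have hU : (p.Ksrc ∪ p.Kdst)ᶜ ∈ nhds (g a) :=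
    (p.isCompact_src.union p.isCompact_dst).isClosed.isOpen_compl.mem_nhds haK
  filter_upwards [hcont hU, self_mem_nhdsWithin] with s hs hsI
  have hsΩ : g s ∈ p.Ω := by
    by_contra hh
    exact absurd hsI.2 (not_lt.mpr (hmin ⟨⟨hsI.1.le, hsI.2.le.trans haI.2⟩, hh⟩))
  refine ⟨⟨hsΩ, hs⟩, hF _ hsΩ ?_⟩
  have : g s - x = s • (x' - x) := by simp [hg]
  rw [this, norm_smul, Real.norm_eq_abs, abs_of_pos hsI.1]
  exact mul_le_of_le_one_left (norm_nonneg _) (hsI.2.le.trans haI.2)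

end Problem

namespace Setup

variable {d L : ℕ} (S : Setup d L)

theorem mem_X {H : ℝ} (hH : 0 < H) {x : Pt d} :
    x ∈ S.X H ↔ x ∈ S.Ω ∧ ∀ i, ∃ k : ℤ, x i = S.origin H i + H * k :=
  S.mem_grid (S.origin H) hH x

theorem inter_X_self {H : ℝ} (hH : 0 < H) : inter (S.X H) S.Ω = S.X H := by
  ext x
  rw [mem_inter]
  exact ⟨fun h => h.1, fun h => ⟨h, ((S.mem_X hH).mp h).1⟩⟩

/-- At mesh step `H`, neighbouring values differ by at most `e₁`, the error of the fast marching
method is at most `e₂`, and the error estimate holds for neighbourhoods of size at least `c`. -/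
structure Scale (H e₁ e₂ c : ℝ) : Prop where
  dim : 2 ≤ d
  pos : 0 < H
  e₁_pos : 0 < e₁
  e₂_pos : 0 < e₂
  vs_close : ∀ x ∈ closure S.Ω, ∀ y ∈ closure S.Ω, ‖x - y‖ ≤ √d * ((L + 1) * H) →
    |S.vs x - S.vs y| ≤ e₁
  vd_close : ∀ x ∈ closure S.Ω, ∀ y ∈ closure S.Ω, ‖x - y‖ ≤ √d * ((L + 1) * H) →
    |S.vd x - S.vd y| ≤ e₁
  Fv_close : ∀ x ∈ closure S.Ω, ∀ y ∈ closure S.Ω, ‖x - y‖ ≤ √d * ((L + 1) * H) →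
    |S.Fv x - S.Fv y| ≤ e₁
  lower : ∀ x ∈ S.X H,
    ENNReal.ofReal (S.vs x) ≤ S.Us.sol H (S.X H) S.Ksrc x + ENNReal.ofReal e₂ ∧
    ENNReal.ofReal (S.vd x) ≤ S.Ud.sol H (S.X H) S.Kdst x + ENNReal.ofReal e₂
  upper : ∀ Ω' : Set (Pt d), IsOpen Ω' → IsConnected Ω' → Ω' ⊆ S.Ω →
    S.Ksrc ⊆ Ω' → S.Kdst ⊆ Ω' → ∀ η : ℝ, 0 < η → closure (S.nbd η) ⊆ Ω' → c ≤ η →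
    ∀ x ∈ S.X H, S.Fv x < S.infFv + η / 2 →
    S.Us.sol H (inter (S.X H) Ω') S.Ksrc x ≤ ENNReal.ofReal (S.vs x + e₂) ∧
    S.Ud.sol H (inter (S.X H) Ω') S.Kdst x ≤ ENNReal.ofReal (S.vd x + e₂)

variable {S}

theorem vs_nonneg (x : Pt d) : 0 ≤ S.vs x := S.val_nonneg (-1) S.Ksrc x
theorem vd_nonneg (x : Pt d) : 0 ≤ S.vd x := S.val_nonneg 1 S.Kdst x
theorem vs_le_one (x : Pt d) : S.vs x ≤ 1 := S.val_le_one (-1) S.Ksrc x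
theorem vd_le_one (x : Pt d) : S.vd x ≤ 1 := S.val_le_one 1 S.Kdst x

theorem Fv_eq (x : Pt d) : S.Fv x = S.vs x + S.vd x - S.vs x * S.vd x := rfl

theorem Fv_eq' (x : Pt d) : S.Fv x = S.vd x + S.vs x - S.vd x * S.vs x := by
  rw [Fv_eq]; ring

theorem vd_le_Fv (x : Pt d) : S.vd x ≤ S.Fv x := by
  have := mul_nonneg (S.vs_nonneg x) (sub_nonneg.mpr (S.vd_le_one x))
  rw [Fv_eq]; linarith

namespace Scale

variable {fmin fM R H e₁ e₂ c : ℝ}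

theorem vs_eq_zero (h : S.Scale H e₁ e₂ c) {z : Pt d} (hz : z ∈ S.Ksrc) : S.vs z = 0 :=
  Problem.val_eq_zero (by have := h.dim; omega) (-1) S.src_subset hz

theorem vd_eq_zero (h : S.Scale H e₁ e₂ c) {z : Pt d} (hz : z ∈ S.Kdst) : S.vd z = 0 :=
  Problem.val_eq_zero (by have := h.dim; omega) 1 S.dst_subset hz

/-- Removing from `Ω` the nodes far from the optimal trajectories gives an admissible
subdomain. -/
theorem exists_subdomain (h : S.Scale H e₁ e₂ c) {η : ℝ} (hη : closure (S.nbd η) ⊆ S.Ω) :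
    ∃ Ω' : Set (Pt d), IsOpen Ω' ∧ IsConnected Ω' ∧ Ω' ⊆ S.Ω ∧ S.Ksrc ⊆ Ω' ∧ S.Kdst ⊆ Ω' ∧
      closure (S.nbd η) ⊆ Ω' ∧
      ∀ x ∈ S.X H, x ∈ Ω' → x ∈ closure (S.nbd η) ∨ x ∈ S.Ksrc ∪ S.Kdst := by
  classical
  -- Only the unwanted nodes are removed, a finite set: what remains is open and, in dimension at
  -- least two, connected.
  set Z := (S.X H).filter (fun x => ¬ (x ∈ closure (S.nbd η) ∨ x ∈ S.Ksrc ∪ S.Kdst)) with hZ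
  have hmem : ∀ x ∈ S.Ω, (x ∈ closure (S.nbd η) ∨ x ∈ S.Ksrc ∪ S.Kdst) →
      x ∈ S.Ω \ (Z : Set (Pt d)) := fun x hx h' =>
    ⟨hx, fun hxZ => (Finset.mem_filter.mp hxZ).2 h'⟩
  refine ⟨S.Ω \ (Z : Set (Pt d)), S.isOpen.sdiff Z.finite_toSet.isClosed,
    isConnected_diff_finset ?_ S.isOpen S.isConnected Z, sdiff_subset,
    fun x hx => hmem x (S.src_subset hx) (Or.inr (Or.inl hx)),
    fun x hx => hmem x (S.dst_subset hx) (Or.inr (Or.inr hx)),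
    fun x hx => hmem x (hη hx) (Or.inl hx), fun x hx hx' => ?_⟩
  · rw [← Module.finrank_eq_rank, finrank_euclideanSpace_fin]
    exact_mod_cast h.dim
  · by_contra hcon
    exact hx'.2 (Finset.mem_filter.mpr ⟨hx, hcon⟩)

theorem lower_of_subset (h : S.Scale H e₁ e₂ c) {G : Finset (Pt d)} (hG : G ⊆ S.X H)
    {x : Pt d} (hx : x ∈ S.X H) :
    ENNReal.ofReal (S.vs x) ≤ S.Us.sol H G S.Ksrc x + ENNReal.ofReal e₂ ∧
    ENNReal.ofReal (S.vd x) ≤ S.Ud.sol H G S.Kdst x + ENNReal.ofReal e₂ :=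
  ⟨(h.lower x hx).1.trans (add_le_add_left (S.Us.sol_mono h.pos _ hG x) _),
    (h.lower x hx).2.trans (add_le_add_left (S.Ud.sol_mono h.pos _ hG x) _)⟩

/-- The error estimate on a node set that contains a neighbourhood of the optimal
trajectories. -/
theorem upper_of_cover (hp : S.Regular fmin fM R) (h : S.Scale H e₁ e₂ c) {δ η' : ℝ}
    {G : Finset (Pt d)} (hcover : ∀ z ∈ S.X H, S.Fv z < S.infFv + δ → z ∈ G)
    (hη' : 0 < η') (hc : c ≤ η') (hcl : closure (S.nbd η') ⊆ S.Ω) (h1 : η' + e₁ < δ)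
    (h2 : η' / 2 + 2 * e₂ < δ) {x : Pt d} (hx : x ∈ S.X H) (hxF : S.Fv x < S.infFv + η' / 2) :
    S.Us.sol H G S.Ksrc x ≤ ENNReal.ofReal (S.vs x + e₂) ∧
    S.Ud.sol H G S.Kdst x ≤ ENNReal.ofReal (S.vd x + e₂) := by
  -- The subdomain retains all source and destination nodes, as the assumed estimate requires,
  -- whereas `G` may lack those far from optimal; `sol_le_of_cover` passes from one to the other.
  obtain ⟨Ω', ho, hcon, hsub, hs, hd, hnb, hmem⟩ := h.exists_subdomain hcl
  obtain ⟨hxs, hxd⟩ := h.upper Ω' ho hcon hsub hs hd η' hη' hnb hc x hx hxF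
  have hXΩ : ∀ z ∈ S.X H, z ∈ closure S.Ω := fun z hz =>
    subset_closure ((S.mem_X h.pos).mp hz).1
  have hxG : x ∈ G := hcover x hx (by linarith [h.e₂_pos])
  have hm : ∀ z ∈ inter (S.X H) Ω', S.Fv z ≤ S.infFv + η' ∨ z ∈ S.Ksrc ∨ z ∈ S.Kdst := by
    intro z hz
    rcases hmem z (mem_inter.mp hz).1 (mem_inter.mp hz).2 with h' | h'
    · exact Or.inl (hp.Fv_le_of_mem_closure h')
    · exact Or.inr h'
  have he₁ := h.e₁_pos
  have he₂ := h.e₂_pos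
  constructor
  · exact S.Us.sol_le_of_cover h.pos (v := S.vs) (v' := S.vd) (F := S.Fv) (K' := S.Kdst)
      (fun z hz => h.vs_eq_zero hz) (fun z hz => h.vd_eq_zero hz) Fv_eq vs_nonneg vs_le_one
      vd_nonneg (fun x hx y hy => h.vd_close x (hXΩ x hx) y (hXΩ y hy))
      (fun x hx y hy => h.Fv_close x (hXΩ x hx) y (hXΩ y hy)) (inter_subset _ _) hm hcover
      (fun z hz => (h.lower z hz).1) he₁.le he₂.le hp.infFv_nonneg (by linarith) h1 hxG hxs
      (by linarith)
  · exact S.Ud.sol_le_of_cover h.pos (v := S.vd) (v' := S.vs) (F := S.Fv) (K' := S.Ksrc)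
      (fun z hz => h.vd_eq_zero hz) (fun z hz => h.vs_eq_zero hz) Fv_eq' vd_nonneg vd_le_one
      vs_nonneg (fun x hx y hy => h.vs_close x (hXΩ x hx) y (hXΩ y hy))
      (fun x hx y hy => h.Fv_close x (hXΩ x hx) y (hXΩ y hy)) (inter_subset _ _)
      (fun z hz => (hm z hz).imp_right Or.symm) hcover
      (fun z hz => (h.lower z hz).2) he₁.le he₂.le hp.infFv_nonneg (by linarith) h1 hxG hxd
      (by linarith)

/-- A point with a small value of `F_v` has a node nearby. -/
theorem exists_node_near (h : S.Scale H e₁ e₂ c) {η t : ℝ} (hη : closure (S.nbd η) ⊆ S.Ω)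
    {x : Pt d} (hx : x ∈ S.Ω) (hxF : S.Fv x ≤ S.infFv + t) (ht : t + e₁ < η) :
    ∃ x' ∈ S.X H, (∀ i, |x i - x' i| ≤ H / 2) ∧ ‖x' - x‖ ≤ √d * (H / 2) ∧
      S.Fv x' ≤ S.infFv + t + e₁ ∧ |S.vs x' - S.vs x| ≤ e₁ ∧ |S.vd x' - S.vd x| ≤ e₁ := by
  have hH := h.pos
  obtain ⟨x', hx', hnear⟩ := exists_lattice_near (S.origin H) x hH
  have hn : ‖x' - x‖ ≤ √d * (H / 2) := by
    refine norm_le_sqrt_mul _ (by linarith) (fun i => ?_)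
    change |x' i - x i| ≤ H / 2
    rw [abs_sub_comm]; exact hnear i
  have hn' : ‖x' - x‖ ≤ √d * ((L + 1) * H) := by
    refine hn.trans (mul_le_mul_of_nonneg_left ?_ (Real.sqrt_nonneg _))
    have : 0 ≤ (L : ℝ) * H := by positivity
    linarith
  have hx'Ω : x' ∈ S.Ω := by
    refine Problem.mem_of_segment hη hx (fun z hz hzx => ?_)
    have := (abs_le.mp (h.Fv_close z (subset_closure hz) x (subset_closure hx)
      (hzx.trans hn'))).2
    linarith
  refine ⟨x', (S.mem_X hH).mpr ⟨hx'Ω, hx'⟩, hnear, hn, ?_,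
    h.vs_close _ (subset_closure hx'Ω) _ (subset_closure hx) hn',
    h.vd_close _ (subset_closure hx'Ω) _ (subset_closure hx) hn'⟩
  have := (abs_le.mp (h.Fv_close _ (subset_closure hx'Ω) _ (subset_closure hx) hn')).2
  linarith

/-- The source has nodes with a small value. -/
theorem exists_source_node (hp : S.Regular fmin fM R) (h : S.Scale H e₁ e₂ c) {η : ℝ}
    (hη : closure (S.nbd η) ⊆ S.Ω) (hc : c ≤ η) (h1 : 2 * e₁ < η) :
    ∃ k ∈ S.X H, k ∈ S.Ksrc ∧ S.vd k ≤ S.infFv + η + e₁ := by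
  have he₁ := h.e₁_pos
  obtain ⟨x, hxs, -, -, -, -, -, hFx, -⟩ := hp.exists_optimal
  obtain ⟨x', hx', -, -, hFx', -, -⟩ := h.exists_node_near (t := 0) hη (S.src_subset hxs)
    (by linarith) (by linarith)
  by_cases hk : x' ∈ S.Ksrc
  · exact ⟨x', hx', hk, (vd_le_Fv x').trans (by linarith)⟩
  obtain ⟨Ω', ho, hcon, hsub, hs, hd, hnb, hmem⟩ := h.exists_subdomain hη
  obtain ⟨hu, -⟩ := h.upper Ω' ho hcon hsub hs hd η (by linarith) hnb hc x' hx' (by linarith)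
  -- The value computed from the source is finite at `x'`, a node outside the source. This forces
  -- some source node to be a neighbour of a node of the subdomain outside the source, where `F_v`
  -- is small or `vd` vanishes.
  obtain ⟨y, hy, hyK, k, hkK, hky⟩ := (S.Us.isSolution_sol h.pos (inter (S.X H) Ω')
    S.Ksrc).exists_adjacent h.pos (fun hh => hk (mem_inter.mp hh).2)
    (hu.trans_lt ENNReal.ofReal_lt_top)
  obtain ⟨hkX', hkK⟩ := mem_inter.mp hkK
  obtain ⟨hyX, hyΩ'⟩ := mem_inter.mp hy
  have hn := S.Us.norm_sub_le_of_mem_neighbors h.pos hky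
  have hkΩ := subset_closure (S.src_subset hkK)
  have hyΩ := subset_closure (hsub hyΩ')
  refine ⟨k, (mem_inter.mp hkX').1, hkK, ?_⟩
  rcases hmem y hyX hyΩ' with h' | h' | h'
  · have h2 := hp.Fv_le_of_mem_closure h'
    have h3 := (abs_le.mp (h.Fv_close k hkΩ y hyΩ hn)).2
    have := vd_le_Fv (S := S) k
    linarith
  · exact absurd (mem_inter.mpr ⟨hy, h'⟩) hyK
  · have h3 := (abs_le.mp (h.vd_close k hkΩ y hyΩ hn)).2
    rw [h.vd_eq_zero h'] at h3
    have := hp.infFv_nonneg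
    linarith

end Scale
end Setup
end FastMarching

/-! ### One level: accepted nodes, active nodes, last search -/

namespace FastMarching
namespace Setup

variable {d L : ℕ} (S : Setup d L)

/-- The parameter `η` of a level is large compared with the errors, and its grid `G` contains all
nodes of a neighbourhood of the optimal trajectories. -/
structure Level (fmin fM R θ₀ H e₁ e₂ c η : ℝ) (G : Finset (Pt d)) : Prop where
  scale : S.Scale H e₁ e₂ c
  regular : S.Regular fmin fM R
  θ₀_pos : 0 < θ₀
  θ₀_le : θ₀ ≤ 1 / 4
  -- The right-hand side is the product of the constants of `val_ge_of_dist` and `one_sub_val_ge`;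
  -- times `η` it bounds from below, up to the errors, the excess of `F_v` at a node missed by a
  -- search.
  θ₀_le' : 2 * θ₀ ≤ Real.exp (-(R / fM)) / fM * Real.exp (-(R / fmin))
  η_pos : 0 < η
  e₁_le : 100 * e₁ ≤ θ₀ * η
  e₂_le : 100 * e₂ ≤ θ₀ * η
  c_le : 100 * c ≤ θ₀ * η
  mesh_le : √d * H ≤ η
  interior : closure (S.nbd η) ⊆ S.Ω
  subset : G ⊆ S.X H
  -- In units of `θ₀ * η`: `5 / 2` exceeds the size `9 / 4` of the subdomain, whose error estimate
  -- holds below one half, `9 / 8`; this exceeds the `11 / 10` needed for nodes next to points below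
  -- `1`. The gaps absorb errors of `1 / 100`.
  cover : ∀ z ∈ S.X H, S.Fv z < S.infFv + 5 / 2 * (θ₀ * η) → z ∈ G

variable {S}

namespace Level

variable {fmin fM R θ₀ H e₁ e₂ c η : ℝ} {G : Finset (Pt d)}

theorem upper (h : S.Level fmin fM R θ₀ H e₁ e₂ c η G) {x : Pt d} (hx : x ∈ S.X H)
    (hxF : S.Fv x < S.infFv + 9 / 8 * (θ₀ * η)) :
    S.Us.sol H G S.Ksrc x ≤ ENNReal.ofReal (S.vs x + e₂) ∧
    S.Ud.sol H G S.Kdst x ≤ ENNReal.ofReal (S.vd x + e₂) := by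
  have hpos : 0 < θ₀ * η := mul_pos h.θ₀_pos h.η_pos
  have h1 := h.e₁_le
  have h2 := h.e₂_le
  have h3 := h.c_le
  have hle : θ₀ * η ≤ 1 / 4 * η := mul_le_mul_of_nonneg_right h.θ₀_le h.η_pos.le
  refine h.scale.upper_of_cover h.regular (η' := 9 / 4 * (θ₀ * η)) h.cover (by linarith)
    (by linarith) ?_ (by linarith) (by linarith) hx (by linarith)
  exact (closure_mono (Problem.nbd_mono (by linarith [h.η_pos]))).trans h.interior

/-- Nodes close to the optimal end points. -/
theorem exists_end_nodes (h : S.Level fmin fM R θ₀ H e₁ e₂ c η G) :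
    (∃ z ∈ S.X H, z ∈ Metric.thickening η S.Ksrc ∧ S.Fv z ≤ S.infFv + e₁ ∧
      S.infFv - e₁ ≤ S.vd z) ∧
    (∃ z ∈ S.X H, z ∈ Metric.thickening η S.Kdst ∧ S.Fv z ≤ S.infFv + e₁ ∧
      S.infFv - e₁ ≤ S.vs z) := by
  obtain ⟨x, hx, y, hy, -, -, -, hFx, hFy⟩ := h.regular.exists_optimal
  have hpos : 0 < θ₀ * η := mul_pos h.θ₀_pos h.η_pos
  have hle : θ₀ * η ≤ 1 / 4 * η := mul_le_mul_of_nonneg_right h.θ₀_le h.η_pos.le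
  have h1 := h.e₁_le
  have hη := h.η_pos
  have hlt : √d * (H / 2) < η := by
    have := h.mesh_le
    have h0 : 0 ≤ √d * H := mul_nonneg (Real.sqrt_nonneg _) h.scale.pos.le
    have e : √d * (H / 2) = √d * H / 2 := by ring
    linarith
  constructor
  · obtain ⟨z, hz, -, hn, hF, -, hv⟩ := h.scale.exists_node_near (t := 0) h.interior
      (S.src_subset hx) (by linarith) (by linarith)
    refine ⟨z, hz, Metric.mem_thickening_iff.mpr ⟨x, hx, ?_⟩, by linarith, ?_⟩
    · rw [dist_eq_norm]; exact hn.trans_lt hlt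
    · have h2 : S.Fv x = S.vd x := by rw [Fv_eq, h.scale.vs_eq_zero hx]; ring
      linarith [(abs_le.mp hv).1]
  · obtain ⟨z, hz, -, hn, hF, hv, -⟩ := h.scale.exists_node_near (t := 0) h.interior
      (S.dst_subset hy) (by linarith) (by linarith)
    refine ⟨z, hz, Metric.mem_thickening_iff.mpr ⟨y, hy, ?_⟩, by linarith, ?_⟩
    · rw [dist_eq_norm]; exact hn.trans_lt hlt
    · have h2 : S.Fv y = S.vs y := by rw [Fv_eq, h.scale.vd_eq_zero hy]; ring
      linarith [(abs_le.mp hv).1]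

theorem mem_accepted (h : S.Level fmin fM R θ₀ H e₁ e₂ c η G) {x : Pt d} (hx : x ∈ S.X H)
    (hxF : S.Fv x ≤ S.infFv + 11 / 10 * (θ₀ * η)) :
    x ∈ (S.levelS H η G).accepted ∧ x ∈ (S.levelD H η G).accepted := by
  have hpos : 0 < θ₀ * η := mul_pos h.θ₀_pos h.η_pos
  have h1 := h.e₁_le
  have h2 := h.e₂_le
  have hp := h.regular
  have hxΩ : x ∈ closure S.Ω := subset_closure ((S.mem_X h.scale.pos).mp hx).1
  obtain ⟨hus, hud⟩ := h.upper hx (by linarith)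
  obtain ⟨⟨z, hz, hzt, hzF, hzv⟩, ⟨z', hz', hzt', hzF', hzv'⟩⟩ := h.exists_end_nodes
  obtain ⟨w, hw, w', hw', -⟩ := hp.exists_optimal
  have hκ : 11 / 10 * (θ₀ * η) + e₁ + 2 * e₂ <
      Real.exp (-(R / fM)) / fM * Real.exp (-(R / fmin)) * η := by
    have := mul_le_mul_of_nonneg_right h.θ₀_le' h.η_pos.le
    linarith
  constructor
  · exact S.Us.mem_accepted_of_small h.scale.pos (v := S.vs) (v' := S.vd) (F := S.Fv)
      (K' := S.Kdst) Fv_eq h.scale.e₂_pos.le (Real.exp_pos _).le vs_nonneg vd_nonneg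
      (h.cover x hx (by linarith)) hus
      (hp.one_sub_val_ge (σ := -1) (by simp) S.src_subset ⟨w, hw⟩ hxΩ) hxF
      (fun hd => hp.val_ge_of_dist (σ := 1) (by simp) S.dst_subset ⟨w', hw'⟩ hxΩ h.η_pos.le hd)
      (h.cover z' hz' (by linarith)) hzt' (h.scale.lower_of_subset h.subset hz').1 hzv' hκ
  · exact S.Ud.mem_accepted_of_small h.scale.pos (v := S.vd) (v' := S.vs) (F := S.Fv)
      (K' := S.Ksrc) Fv_eq' h.scale.e₂_pos.le (Real.exp_pos _).le vd_nonneg vs_nonneg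
      (h.cover x hx (by linarith)) hud
      (hp.one_sub_val_ge (σ := 1) (by simp) S.dst_subset ⟨w', hw'⟩ hxΩ) hxF
      (fun hd => hp.val_ge_of_dist (σ := -1) (by simp) S.src_subset ⟨w, hw⟩ hxΩ h.η_pos.le hd)
      (h.cover z hz (by linarith)) hzt (h.scale.lower_of_subset h.subset hz).2 hzv hκ

theorem le_levelF (h : S.Level fmin fM R θ₀ H e₁ e₂ c η G) {x : Pt d} (hx : x ∈ S.X H) :
    ENNReal.ofReal (S.Fv x - 2 * e₂) ≤ S.levelF H η G x := by
  obtain ⟨h1, h2⟩ := h.scale.lower_of_subset h.subset hx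
  have hs := (S.Us.march_spec (ending := inter G (Metric.thickening η S.Kdst)) h.scale.pos
    (inter_subset G S.Ksrc) (S.Us.isSolution_sol h.scale.pos G S.Ksrc)).1 x
  have hd := (S.Ud.march_spec (ending := inter G (Metric.thickening η S.Ksrc)) h.scale.pos
    (inter_subset G S.Kdst) (S.Ud.isSolution_sol h.scale.pos G S.Kdst)).1 x
  exact le_combine (S.Us.march_range h.scale.pos _ _ _ x) (S.Ud.march_range h.scale.pos _ _ _ x)
    (vs_nonneg x) (vs_le_one x) h.scale.e₂_pos.le (h1.trans (add_le_add_left hs _))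
    (h2.trans (add_le_add_left hd _))

theorem levelF_le (h : S.Level fmin fM R θ₀ H e₁ e₂ c η G) {x : Pt d} (hx : x ∈ S.X H)
    (hxF : S.Fv x ≤ S.infFv + 11 / 10 * (θ₀ * η)) :
    S.levelF H η G x ≤ ENNReal.ofReal (S.Fv x + 2 * e₂) := by
  have hpos : 0 < θ₀ * η := mul_pos h.θ₀_pos h.η_pos
  obtain ⟨has, had⟩ := h.mem_accepted hx hxF
  obtain ⟨hus, hud⟩ := h.upper hx (by linarith)
  have hs := (S.Us.march_spec (ending := inter G (Metric.thickening η S.Kdst)) h.scale.pos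
    (inter_subset G S.Ksrc) (S.Us.isSolution_sol h.scale.pos G S.Ksrc)).2.1 x has
  have hd := (S.Ud.march_spec (ending := inter G (Metric.thickening η S.Ksrc)) h.scale.pos
    (inter_subset G S.Kdst) (S.Ud.isSolution_sol h.scale.pos G S.Kdst)).2.1 x had
  exact combine_le (S.Us.march_range h.scale.pos _ _ _ x) (S.Ud.march_range h.scale.pos _ _ _ x)
    (vs_nonneg x) (vs_le_one x) (vd_nonneg x) h.scale.e₂_pos.le (hs.le.trans hus)
    (hd.le.trans hud)

/-- The active nodes cover a neighbourhood of the optimal trajectories. -/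
theorem exists_active_near (h : S.Level fmin fM R θ₀ H e₁ e₂ c η G) {x : Pt d} (hx : x ∈ S.Ω)
    (hxF : S.Fv x < S.infFv + θ₀ * η) :
    ∃ x' ∈ S.active H η G, ∀ i, |x i - x' i| ≤ H / 2 := by
  have hpos : 0 < θ₀ * η := mul_pos h.θ₀_pos h.η_pos
  have hle : θ₀ * η ≤ 1 / 4 * η := mul_le_mul_of_nonneg_right h.θ₀_le h.η_pos.le
  have h1 := h.e₁_le
  have h2 := h.e₂_le
  have hη := h.η_pos
  obtain ⟨x', hx', hnear, -, hF, -⟩ := h.scale.exists_node_near h.interior hx hxF.le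
    (by linarith)
  have hF' : S.Fv x' ≤ S.infFv + 11 / 10 * (θ₀ * η) := by linarith
  obtain ⟨has, had⟩ := h.mem_accepted hx' hF'
  refine ⟨x', ?_, hnear⟩
  rw [active, Finset.mem_filter]
  refine ⟨h.cover x' hx' (by linarith), has, had, ?_⟩
  refine (h.levelF_le hx' hF').trans ?_
  -- The minimum of `F_V` is at least `infFv - 2 * e₂`; so the tolerance `η` covers `θ₀ * η ≤ η / 4`
  -- and the errors.
  have hinf : ENNReal.ofReal (S.infFv - 2 * e₂) ≤ ⨅ y ∈ G, S.levelF H η G y := by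
    refine le_iInf₂ (fun y hy => le_trans (ENNReal.ofReal_le_ofReal ?_)
      (h.le_levelF (h.subset hy)))
    have := Problem.infFv_le ((S.mem_X h.scale.pos).mp (h.subset hy)).1
    linarith
  refine le_trans ?_ (add_le_add_left hinf _)
  refine (ENNReal.ofReal_le_ofReal ?_).trans ENNReal.ofReal_add_le
  linarith

/-- The active nodes are close to the optimal trajectories. -/
theorem Fv_lt_of_active (h : S.Level fmin fM R θ₀ H e₁ e₂ c η G) {x : Pt d}
    (hx : x ∈ S.active H η G) : S.Fv x < S.infFv + 2 * η := by
  have hpos : 0 < θ₀ * η := mul_pos h.θ₀_pos h.η_pos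
  have hle : θ₀ * η ≤ 1 / 4 * η := mul_le_mul_of_nonneg_right h.θ₀_le h.η_pos.le
  have h1 := h.e₁_le
  have h2 := h.e₂_le
  have hη := h.η_pos
  have he₁ := h.scale.e₁_pos
  have he₂ := h.scale.e₂_pos
  have h0 := h.regular.infFv_nonneg
  rw [active, Finset.mem_filter] at hx
  obtain ⟨hxG, -, -, hxF⟩ := hx
  -- A node near an optimal starting point shows that the minimum of `F_V` is at most `infFv` plus
  -- errors.
  obtain ⟨⟨z, hz, -, hzF, -⟩, -⟩ := h.exists_end_nodes
  have hzG : z ∈ G := h.cover z hz (by linarith)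
  have h3 : (⨅ y ∈ G, S.levelF H η G y) ≤ ENNReal.ofReal (S.Fv z + 2 * e₂) :=
    (iInf₂_le z hzG).trans (h.levelF_le hz (by linarith))
  have h4 := (h.le_levelF (h.subset hxG)).trans (hxF.trans (add_le_add_left h3 _))
  have h5 := Problem.infFv_le ((S.mem_X h.scale.pos).mp hz).1
  rw [← ENNReal.ofReal_add (by linarith) hη.le,
    ENNReal.ofReal_le_ofReal_iff (by linarith)] at h4
  linarith

theorem fine_cover (h : S.Level fmin fM R θ₀ H e₁ e₂ c η G) {h' : ℝ} (hh' : 0 < h') {x : Pt d}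
    (hx : x ∈ S.X h') (hxF : S.Fv x < S.infFv + θ₀ * η) : x ∈ S.fine H h' η G := by
  classical
  obtain ⟨x', hx', hnear⟩ := h.exists_active_near ((S.mem_X hh').mp hx).1 hxF
  rw [fine, Finset.mem_biUnion]
  refine ⟨x', hx', ?_⟩
  rw [around, Finset.mem_filter]
  refine ⟨hx, fun i => (hnear i).trans ?_⟩
  -- The radius `max (H - h') h'` is always at least `H / 2`, the distance to the nearest active
  -- node.
  rcases le_or_gt h' (H / 2) with hh | hh
  · exact le_max_of_le_left (by linarith)
  · exact le_max_of_le_right hh.le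

end Level

theorem fine_subset (S : Setup d L) (H h η : ℝ) (G : Finset (Pt d)) :
    S.fine H h η G ⊆ S.X h := by
  classical
  intro x hx
  rw [fine, Finset.mem_biUnion] at hx
  obtain ⟨x', -, hx⟩ := hx
  rw [around, Finset.mem_filter] at hx
  exact hx.1

theorem within_of_le {V : ℝ≥0∞} {v ε : ℝ} (hv : 0 ≤ v) (hε : 0 ≤ ε)
    (h1 : V ≤ ENNReal.ofReal (v + ε)) (h2 : ENNReal.ofReal v ≤ V + ENNReal.ofReal ε) :
    Within V v ε := by
  have hV : V ≠ ⊤ := (h1.trans_lt ENNReal.ofReal_lt_top).ne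
  refine ⟨hV, ?_⟩
  have e : V = ENNReal.ofReal V.toReal := (ENNReal.ofReal_toReal hV).symm
  have hV0 : 0 ≤ V.toReal := ENNReal.toReal_nonneg
  rw [e, ENNReal.ofReal_le_ofReal_iff (by linarith)] at h1
  rw [e, ← ENNReal.ofReal_add hV0 hε, ENNReal.ofReal_le_ofReal_iff (by linarith)] at h2
  rw [abs_le]
  constructor <;> linarith

/-- Accuracy of the last level. -/
theorem accurate_last {S : Setup d L} {fmin fM R h e₁ e₂ c δ η'' ε' : ℝ}
    (hp : S.Regular fmin fM R) (hs : S.Scale h e₁ e₂ c) {G : Finset (Pt d)} (hG : G ⊆ S.X h)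
    (hcover : ∀ z ∈ S.X h, S.Fv z < S.infFv + 4 * δ → z ∈ G)
    (hint : closure (S.nbd (2 * δ)) ⊆ S.Ω) (he₂ : e₂ < δ) (hc : c ≤ 2 * δ)
    (hη'' : 2 * e₁ < η'') (hc'' : c ≤ η'') (hδ'' : η'' + e₁ < δ) (hε' : e₂ + η'' + e₁ ≤ ε') :
    S.Accurate h e₂ δ ε' G := by
  have he₁0 := hs.e₁_pos
  have he₂0 := hs.e₂_pos
  have hI := hp.infFv_nonneg
  have up : ∀ x ∈ S.X h, S.Fv x < S.infFv + δ →
      S.Ud.sol h G S.Kdst x ≤ ENNReal.ofReal (S.vd x + e₂) := fun x hx hxF =>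
    (hs.upper_of_cover hp (η' := 2 * δ) hcover (by linarith) hc hint (by linarith) (by linarith)
      hx (by linarith)).2
  have low : ∀ x ∈ S.X h, ENNReal.ofReal (S.vd x) ≤ S.Ud.sol h G S.Kdst x + ENNReal.ofReal e₂ :=
    fun x hx => (hs.lower_of_subset hG hx).2
  obtain ⟨hle, hacc, hnacc⟩ := S.Ud.march_spec (ending := inter G S.Ksrc) hs.pos
    (inter_subset G S.Kdst) (S.Ud.isSolution_sol hs.pos G S.Kdst)
  change _ ≤ (S.last h G).V at hle
  change ∀ x ∈ (S.last h G).accepted, (S.last h G).V x = _ at hacc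
  change ∀ x ∈ G, x ∉ (S.last h G).accepted → _ < ⊤ → inter G S.Ksrc ⊆ (S.last h G).accepted ∧
    ∀ a ∈ (S.last h G).accepted, _ ≤ _ at hnacc
  -- The parameter `η''` may be taken of the size of the errors at the finest mesh step, so that the
  -- error on the value is governed by `h` and not by the coarser grid.
  obtain ⟨k, hkX, hkK, hkv⟩ := hs.exists_source_node hp (η := η'')
    ((closure_mono (Problem.nbd_mono (by linarith))).trans hint) hc'' hη''
  obtain ⟨x₀, hx₀, hmin⟩ := Finset.exists_min_image (inter (S.X h) S.Ksrc) S.vd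
    ⟨k, mem_inter.mpr ⟨hkX, hkK⟩⟩
  obtain ⟨hx₀X, hx₀K⟩ := mem_inter.mp hx₀
  have hx₀v : S.vd x₀ ≤ S.infFv + η'' + e₁ := (hmin k (mem_inter.mpr ⟨hkX, hkK⟩)).trans hkv
  have hFK : ∀ x ∈ S.Ksrc, S.Fv x = S.vd x := fun x hx => by
    rw [Fv_eq, hs.vs_eq_zero hx]; ring
  have hx₀F : S.Fv x₀ < S.infFv + δ := by rw [hFK x₀ hx₀K]; linarith
  have accK : ∀ x ∈ S.X h, S.Fv x < S.infFv + δ → x ∈ S.Ksrc → x ∈ (S.last h G).accepted := by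
    intro x hx hxF hxK
    have hxG := hcover x hx (by linarith)
    by_contra hcon
    exact hcon ((hnacc x hxG hcon ((up x hx hxF).trans_lt ENNReal.ofReal_lt_top)).1
      (mem_inter.mpr ⟨hxG, hxK⟩))
  have hx₀acc := accK x₀ hx₀X hx₀F hx₀K
  obtain ⟨xs, hxsK, -, -, hxsX, hxsv, hstar, -, -⟩ := hp.exists_optimal
  have hx₀low : S.vStar ≤ S.vd x₀ := by
    rw [hstar, ← hxsv]; exact hxsX.2 x₀ hx₀K
  have hvalue : Within (S.computedValue h G) (S.vd x₀) e₂ := by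
    refine within_of_le (vd_nonneg _) he₂0.le ?_ ?_
    · refine le_trans (iInf₂_le x₀ (mem_inter.mpr ⟨hcover x₀ hx₀X (by linarith), hx₀K⟩)) ?_
      rw [hacc x₀ hx₀acc]
      exact up x₀ hx₀X hx₀F
    · rw [← tsub_le_iff_right]
      refine le_iInf₂ (fun x hx => ?_)
      rw [tsub_le_iff_right]
      obtain ⟨hxG, hxK⟩ := mem_inter.mp hx
      refine le_trans (ENNReal.ofReal_le_ofReal (hmin x (mem_inter.mpr ⟨hG hxG, hxK⟩))) ?_
      exact (low x (hG hxG)).trans (add_le_add_left (hle x) _)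
  refine ⟨fun x hx hxF => hcover x hx (by linarith), fun x hx hxF hxa => ?_,
    fun x hx hxF hxor => ?_, ⟨x₀, hx₀X, hx₀K, fun x hx hxK => hmin x (mem_inter.mpr ⟨hx, hxK⟩),
      hvalue⟩, ?_, ?_⟩
  · rw [hacc x hxa]
    exact within_of_le (vd_nonneg _) he₂0.le (up x hx hxF) (low x hx)
  · rcases hxor with hxK | hxv
    · exact accK x hx hxF hxK
    · by_contra hcon
      -- If `x` were not accepted, the accepted source node `x₀` would have a value at most that of
      -- `x`; then `vd x₀ ≤ vd x + 2 * e₂ < vStar ≤ vd x₀`.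
      obtain ⟨-, h2⟩ := hnacc x (hcover x hx (by linarith)) hcon
        ((up x hx hxF).trans_lt ENNReal.ofReal_lt_top)
      have h3 := (low x₀ hx₀X).trans (add_le_add_left ((h2 x₀ hx₀acc).trans (up x hx hxF)) _)
      have := vd_nonneg (S := S) x
      rw [← ENNReal.ofReal_add (by linarith) he₂0.le,
        ENNReal.ofReal_le_ofReal_iff (by linarith)] at h3
      linarith
  · rintro ⟨x, hxX, hx⟩
    have h1 : S.vd x₀ = S.vStar := by
      refine le_antisymm ?_ hx₀low
      rw [hstar, ← hxsv]
      exact (hmin x (mem_inter.mpr ⟨hxX, hx.1⟩)).trans (hx.2 xs hxsK)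
    rw [← h1]; exact hvalue
  · refine ⟨hvalue.1, ?_⟩
    have h1 := abs_le.mp hvalue.2
    rw [abs_le]
    constructor <;> linarith [h1.1, h1.2]

end Setup
-- Choice of the constants and induction over the levels
namespace Params

variable (P : Params)

/-- A positive upper bound of the speed. -/
noncomputable def fM : ℝ := max P.fmax P.fmin

/-- A nonnegative upper bound of the diameter. -/
noncomputable def R : ℝ := |P.DΩ|

/-- The proportion of `η` that the active nodes are guaranteed to cover. -/
noncomputable def θ₀ : ℝ :=
  min (Real.exp (-(P.R / P.fM)) / P.fM * Real.exp (-(P.R / P.fmin)) / 2) (1 / 4)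

/-- The Lipschitz constant of `F_v` times the width of the discrete neighbourhoods. -/
noncomputable def lip : ℝ := 2 / P.fmin * (P.L + 1)

/-- For `η = √d * Q * H ^ γ`, `θ₀ * η` is `100 * √d * H ^ γ` times the sum `CO + Cγ + lip + 1`, so
that each error is at most a hundredth of it. -/
noncomputable def Q : ℝ := 100 * (P.CO + P.Cγ + P.lip + 1) / P.θ₀

/-- The factor `√d` accounts for the Euclidean diameter of a mesh cell; it is the only dependence on
`d`. -/
noncomputable def Cη (d : ℕ) : ℝ := √d * P.Q

/-- This bounds the sum `e₂ + η'' + e₁` in `accurate_last` in units of `Cγ * h ^ γ`, where `e₁ ≤ lip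
* √d * h ^ γ` and `η'' = (CO + 3 * lip * √d) * h ^ γ`. -/
noncomputable def Cerr (d : ℕ) : ℝ := 1 + (P.CO + 4 * (P.lip * √d)) / P.Cγ

theorem fM_pos : 0 < P.fM := P.fmin_pos.trans_le (le_max_right _ _)

theorem R_nonneg : 0 ≤ P.R := abs_nonneg _

theorem θ₀_pos : 0 < P.θ₀ := by
  have := P.fM_pos
  exact lt_min (by positivity) (by norm_num)

theorem θ₀_le : P.θ₀ ≤ 1 / 4 := min_le_right _ _

theorem lip_pos : 0 < P.lip := by
  have := P.fmin_pos
  unfold lip; positivity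

theorem Cγ_pos : 0 < P.Cγ := add_pos P.Cs_pos P.Cd_pos

theorem θ₀_mul_Q : P.θ₀ * P.Q = 100 * (P.CO + P.Cγ + P.lip + 1) := by
  have := P.θ₀_pos
  unfold Q; field_simp

theorem one_le_Q : 1 ≤ P.Q := by
  have h1 := P.θ₀_mul_Q
  have h2 := P.θ₀_pos
  have h3 := P.θ₀_le
  have := P.CO_pos
  have := P.Cγ_pos
  have := P.lip_pos
  by_contra hcon
  rw [not_le] at hcon
  nlinarith

theorem one_le_sqrt {d : ℕ} (hd : 2 ≤ d) : 1 ≤ √(d : ℝ) :=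
  Real.one_le_sqrt.mpr (by exact_mod_cast (by omega : 1 ≤ d))

theorem Cη_pos {d : ℕ} (hd : 2 ≤ d) : 0 < P.Cη d :=
  mul_pos (by linarith [one_le_sqrt hd]) (by linarith [P.one_le_Q])

theorem Cerr_pos (d : ℕ) : 0 < P.Cerr d := by
  have := P.CO_pos
  have := P.Cγ_pos
  have := P.lip_pos
  unfold Cerr; positivity

theorem le_rpow {H : ℝ} (hH : 0 < H) (hH1 : H ≤ 1) : H ≤ H ^ P.γ := by
  have := Real.rpow_le_rpow_of_exponent_ge hH hH1 P.γ_le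
  rwa [Real.rpow_one] at this

end Params

namespace Setup

variable {d : ℕ} {P : Params} {S : Setup d P.L} {n : ℕ}

theorem Satisfies.regular (hS : Satisfies P S n) (hd : 2 ≤ d) :
    S.Regular P.fmin P.fM P.R := by
  have hc : ∀ a ∈ Metric.sphere (0 : Pt d) 1, ContinuousOn (fun x => S.f x a) (closure S.Ω) :=
    fun a ha => S.f_continuous.comp (f := fun x => (x, a)) (by fun_prop) (fun x hx => ⟨hx, ha⟩)
  refine ⟨by omega, hS.convex, P.fmin_pos, P.fM_pos, fun x hx a ha => ?_, fun x hx a ha => ?_,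
    fun x hx y hy => ?_, hS.geodesic_nonempty⟩
  · exact le_on_closure (f := fun _ => P.fmin) (g := fun x => S.f x a)
      (fun x hx => (hS.speed x hx a ha).1) continuousOn_const (hc a ha) hx
  · exact le_on_closure (f := fun x => S.f x a) (g := fun _ => P.fM)
      (fun x hx => (hS.speed x hx a ha).2.trans (le_max_left _ _)) (hc a ha)
      continuousOn_const hx
  · rw [← dist_eq_norm]
    exact (Metric.dist_le_diam_of_mem S.isBounded.closure hx hy).trans
      (hS.diam_le.trans (le_abs_self _))

theorem Satisfies.scale (hS : Satisfies P S n) (hd : 2 ≤ d) {H : ℝ} (hH : 0 < H) :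
    S.Scale H (P.lip * √d * H) (P.Cγ * H ^ P.γ) (P.CO * H ^ P.γ) := by
  have hp := hS.regular hd
  have hd1 := Params.one_le_sqrt hd
  have hf := P.fmin_pos
  have hHγ : 0 < H ^ P.γ := Real.rpow_pos_of_pos hH _
  have h2 : ∀ r : ℝ, r ≤ √d * ((P.L + 1) * H) → 2 / P.fmin * r ≤ P.lip * √d * H := by
    intro r hr
    have := mul_le_mul_of_nonneg_left hr (show 0 ≤ 2 / P.fmin by positivity)
    refine this.trans (le_of_eq ?_)
    unfold Params.lip; ring
  have h1 : ∀ r : ℝ, 0 ≤ r → r ≤ √d * ((P.L + 1) * H) → r / P.fmin ≤ P.lip * √d * H := by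
    intro r hr0 hr
    refine le_trans ?_ (h2 r hr)
    have : 0 ≤ r / P.fmin := by positivity
    have e : 2 / P.fmin * r = r / P.fmin + r / P.fmin := by ring
    linarith
  have hs : P.Cs * H ^ P.γ ≤ P.Cγ * H ^ P.γ :=
    mul_le_mul_of_nonneg_right (by unfold Params.Cγ; linarith [P.Cd_pos]) hHγ.le
  have hdd : P.Cd * H ^ P.γ ≤ P.Cγ * H ^ P.γ :=
    mul_le_mul_of_nonneg_right (by unfold Params.Cγ; linarith [P.Cs_pos]) hHγ.le
  refine ⟨hd, hH, mul_pos (mul_pos P.lip_pos (by linarith)) hH, mul_pos P.Cγ_pos hHγ,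
    fun x hx y hy hxy => ?_, fun x hx y hy hxy => ?_, fun x hx y hy hxy => ?_, fun x hx => ?_,
    fun Ω' ho hc hsub hsrc hdst η hη hnb hcη x hx hxF => ?_⟩
  · exact (hp.val_lipschitz (σ := -1) (by simp) S.Ksrc hx hy).trans (h1 _ (norm_nonneg _) hxy)
  · exact (hp.val_lipschitz (σ := 1) (by simp) S.Kdst hx hy).trans (h1 _ (norm_nonneg _) hxy)
  · exact (hp.Fv_lipschitz hx hy).trans (h2 _ hxy)
  · have h := hS.error.lower H hH x hx
    have e1 : S.fullS H S.Ω = S.Us.sol H (S.X H) S.Ksrc := by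
      conv_rhs => rw [← S.inter_X_self hH]
      rfl
    have e2 : S.fullD H S.Ω = S.Ud.sol H (S.X H) S.Kdst := by
      conv_rhs => rw [← S.inter_X_self hH]
      rfl
    rw [e1, e2] at h
    exact ⟨h.1.trans (add_le_add_right (ENNReal.ofReal_le_ofReal hs) _),
      h.2.trans (add_le_add_right (ENNReal.ofReal_le_ofReal hdd) _)⟩
  · have h := hS.error.upper Ω' ho hc hsub hsrc hdst η H hη hH hnb hcη x hx
      ((Problem.mem_nbd_or ((S.mem_X hH).mp hx).1 hxF).imp (fun h => subset_closure h)
        (fun h => ⟨h, hxF⟩))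
    exact ⟨h.1.trans (ENNReal.ofReal_le_ofReal (by linarith)),
      h.2.trans (ENNReal.ofReal_le_ofReal (by linarith))⟩

theorem Satisfies.level (hS : Satisfies P S n) (hd : 2 ≤ d) {H : ℝ} (hH : 0 < H) (hH1 : H ≤ 1)
    (hint : closure (S.nbd (P.Cη d * H ^ P.γ)) ⊆ S.Ω) {G : Finset (Pt d)} (hG : G ⊆ S.X H)
    (hcover : ∀ z ∈ S.X H,
      S.Fv z < S.infFv + 5 / 2 * (P.θ₀ * (P.Cη d * H ^ P.γ)) → z ∈ G) :
    S.Level P.fmin P.fM P.R P.θ₀ H (P.lip * √d * H) (P.Cγ * H ^ P.γ) (P.CO * H ^ P.γ)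
      (P.Cη d * H ^ P.γ) G := by
  have hd1 := Params.one_le_sqrt hd
  have hHγ : 0 < H ^ P.γ := Real.rpow_pos_of_pos hH _
  have hle := P.le_rpow hH hH1
  have hCO := P.CO_pos
  have hCγ := P.Cγ_pos
  have hlip := P.lip_pos
  have e : P.θ₀ * (P.Cη d * H ^ P.γ) =
      100 * (√d * P.CO * H ^ P.γ + √d * P.Cγ * H ^ P.γ + P.lip * √d * H ^ P.γ +
        √d * H ^ P.γ) := by
    unfold Params.Cη
    calc _ = (P.θ₀ * P.Q) * (√d * H ^ P.γ) := by ring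
      _ = _ := by rw [P.θ₀_mul_Q]; ring
  have k1 : P.lip * √d * H ≤ P.lip * √d * H ^ P.γ :=
    mul_le_mul_of_nonneg_left hle (by positivity)
  have k2 : P.Cγ * H ^ P.γ ≤ √d * P.Cγ * H ^ P.γ :=
    mul_le_mul_of_nonneg_right (le_mul_of_one_le_left hCγ.le hd1) hHγ.le
  have k3 : P.CO * H ^ P.γ ≤ √d * P.CO * H ^ P.γ :=
    mul_le_mul_of_nonneg_right (le_mul_of_one_le_left hCO.le hd1) hHγ.le
  have p1 : 0 ≤ √d * P.CO * H ^ P.γ := by positivity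
  have p2 : 0 ≤ √d * P.Cγ * H ^ P.γ := by positivity
  have p3 : 0 ≤ P.lip * √d * H ^ P.γ := by positivity
  have p4 : 0 ≤ √d * H ^ P.γ := by positivity
  refine ⟨hS.scale hd hH, hS.regular hd, P.θ₀_pos, P.θ₀_le, ?_, mul_pos (P.Cη_pos hd) hHγ, ?_, ?_,
    ?_, ?_, hint, hG, hcover⟩
  · have : P.θ₀ ≤ Real.exp (-(P.R / P.fM)) / P.fM * Real.exp (-(P.R / P.fmin)) / 2 :=
      min_le_left _ _
    linarith
  · rw [e]; linarith
  · rw [e]; linarith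
  · rw [e]; linarith
  · unfold Params.Cη
    exact mul_le_mul (le_mul_of_one_le_right (by linarith) P.one_le_Q) hle hH.le
      (mul_nonneg (by linarith) (by linarith [P.one_le_Q]))

/-- Admissible mesh steps for the multi-level method. -/
structure IsMeshSeq (P : Params) (S : Setup d P.L) (mesh : ℕ → ℝ) (N : ℕ) : Prop where
  two_le : 2 ≤ N
  pos : ∀ l, 1 ≤ l → l ≤ N → 0 < mesh l
  first : mesh 1 ≤ 1
  ratio : ∀ l, 1 ≤ l → l < N → mesh (l + 1) ^ P.γ ≤ 2 / 5 * mesh l ^ P.γ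
  interior : closure (S.nbd (P.Cη d * mesh 1 ^ P.γ)) ⊆ S.Ω

namespace IsMeshSeq

variable {mesh : ℕ → ℝ} {N : ℕ}

theorem succ_le (hm : IsMeshSeq P S mesh N) {l : ℕ} (h1 : 1 ≤ l) (h2 : l < N) :
    mesh (l + 1) ≤ mesh l := by
  have h3 := hm.ratio l h1 h2
  have h4 := hm.pos l h1 h2.le
  have h5 := hm.pos (l + 1) (by omega) (by omega)
  have h6 : 0 < mesh l ^ P.γ := Real.rpow_pos_of_pos h4 _
  exact (Real.rpow_le_rpow_iff h5.le h4.le P.γ_pos).mp (by linarith)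

theorem le_first (hm : IsMeshSeq P S mesh N) {l : ℕ} (h1 : 1 ≤ l) (h2 : l ≤ N) :
    mesh l ≤ mesh 1 := by
  induction l, h1 using Nat.le_induction with
  | base => exact le_rfl
  | succ l hl ih => exact (hm.succ_le hl (by omega)).trans (ih (by omega))

theorem le_one (hm : IsMeshSeq P S mesh N) {l : ℕ} (h1 : 1 ≤ l) (h2 : l ≤ N) : mesh l ≤ 1 :=
  (hm.le_first h1 h2).trans hm.first

theorem interior' (hm : IsMeshSeq P S mesh N) (hd : 2 ≤ d) {l : ℕ} (h1 : 1 ≤ l) (h2 : l ≤ N) :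
    closure (S.nbd (P.Cη d * mesh l ^ P.γ)) ⊆ S.Ω := by
  refine (closure_mono (Problem.nbd_mono ?_)).trans hm.interior
  exact mul_le_mul_of_nonneg_left (Real.rpow_le_rpow (hm.pos l h1 h2).le (hm.le_first h1 h2)
    P.γ_pos.le) (P.Cη_pos hd).le

theorem level (hm : IsMeshSeq P S mesh N) (hS : Satisfies P S n) (hd : 2 ≤ d) {k : ℕ}
    (hk : k + 1 < N) :
    S.Level P.fmin P.fM P.R P.θ₀ (mesh (k + 1)) (P.lip * √d * mesh (k + 1))
      (P.Cγ * mesh (k + 1) ^ P.γ) (P.CO * mesh (k + 1) ^ P.γ) (P.Cη d * mesh (k + 1) ^ P.γ)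
      (S.levelGrid mesh (fun l => P.Cη d * mesh l ^ P.γ) k) := by
  induction k with
  | zero =>
    exact hS.level hd (hm.pos 1 le_rfl (by omega)) hm.first hm.interior (fun _ hx => hx)
      (fun z hz _ => hz)
  | succ k ih =>
    have ih := ih (by omega)
    have hp := hm.pos (k + 2) (by omega) (by omega)
    refine hS.level hd hp (hm.le_one (by omega) (by omega)) (hm.interior' hd (by omega) (by omega))
      (fine_subset S _ _ _ _) (fun z hz hzF => ih.fine_cover hp hz (hzF.trans_le ?_))
    -- The ratio `2 / 5` is the inverse of the `5 / 2` in `Level.cover`: what the previous level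
    -- covers includes what this level requires.
    have h1 := hm.ratio (k + 1) (by omega) (by omega)
    have h2 := mul_le_mul_of_nonneg_left h1 (mul_pos P.θ₀_pos (P.Cη_pos hd)).le
    linarith

/-- Accuracy of the multi-level method. -/
theorem accurate (hm : IsMeshSeq P S mesh N) (hS : Satisfies P S n) (hd : 2 ≤ d) :
    S.Accurate (mesh N) (P.Cγ * mesh N ^ P.γ)
      (P.θ₀ / 4 * (P.Cη d * mesh (N - 1) ^ P.γ)) (P.Cerr d * (P.Cγ * mesh N ^ P.γ))
      (S.finalGrid mesh (fun l => P.Cη d * mesh l ^ P.γ) N) := by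
  have hN := hm.two_le
  obtain ⟨k, rfl⟩ : ∃ k, N = k + 2 := ⟨N - 2, by omega⟩
  have hlev := hm.level hS hd (k := k) (by omega)
  have hh := hm.pos (k + 2) (by omega) le_rfl
  have hh1 := hm.le_one (l := k + 2) (by omega) le_rfl
  have hH := hm.pos (k + 1) (by omega) (by omega)
  have hratio := hm.ratio (k + 1) (by omega) (by omega)
  have hint := hm.interior' hd (l := k + 1) (by omega) (by omega)
  have hd1 := Params.one_le_sqrt hd
  simp only [finalGrid, show k + 2 - 1 = k + 1 by omega]
  change mesh (k + 2) ^ P.γ ≤ _ at hratio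
  set h := mesh (k + 2) with hh_def
  set H := mesh (k + 1) with hH_def
  have hhγ : 0 < h ^ P.γ := Real.rpow_pos_of_pos hh _
  have hHγ : 0 < H ^ P.γ := Real.rpow_pos_of_pos hH _
  have hle := P.le_rpow hh hh1
  have hCO := P.CO_pos
  have hCγ := P.Cγ_pos
  have hlip := P.lip_pos
  have e : P.θ₀ * (P.Cη d * H ^ P.γ) =
      100 * (√d * P.CO * H ^ P.γ + √d * P.Cγ * H ^ P.γ + P.lip * √d * H ^ P.γ +
        √d * H ^ P.γ) := by
    unfold Params.Cη
    calc _ = (P.θ₀ * P.Q) * (√d * H ^ P.γ) := by ring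
      _ = _ := by rw [P.θ₀_mul_Q]; ring
  have hhH : h ^ P.γ ≤ H ^ P.γ := by linarith
  have k1 : P.lip * √d * h ≤ P.lip * √d * h ^ P.γ :=
    mul_le_mul_of_nonneg_left hle (by positivity)
  have k1' : P.lip * √d * h ^ P.γ ≤ P.lip * √d * H ^ P.γ :=
    mul_le_mul_of_nonneg_left hhH (by positivity)
  have k2 : P.Cγ * h ^ P.γ ≤ √d * P.Cγ * H ^ P.γ :=
    mul_le_mul (le_mul_of_one_le_left hCγ.le hd1) hhH hhγ.le (by positivity)
  have k3 : P.CO * h ^ P.γ ≤ √d * P.CO * H ^ P.γ :=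
    mul_le_mul (le_mul_of_one_le_left hCO.le hd1) hhH hhγ.le (by positivity)
  have p0 : 0 < P.CO * h ^ P.γ := by positivity
  have p1 : 0 < √d * P.CO * H ^ P.γ := by positivity
  have p2 : 0 < √d * P.Cγ * H ^ P.γ := by positivity
  have p3 : 0 < P.lip * √d * H ^ P.γ := by positivity
  have p4 : 0 < √d * H ^ P.γ := by positivity
  have p5 : 0 < P.lip * √d * h ^ P.γ := by positivity
  have hη : P.θ₀ * (P.Cη d * H ^ P.γ) ≤ 1 / 4 * (P.Cη d * H ^ P.γ) :=
    mul_le_mul_of_nonneg_right P.θ₀_le hlev.η_pos.le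
  have hηpos := hlev.η_pos
  refine accurate_last (hS.regular hd) (hS.scale hd hh) (fine_subset S _ _ _ _)
    -- This choice meets both `2 * e₁ < η''` and `c ≤ η''`.
    (η'' := P.CO * h ^ P.γ + 3 * (P.lip * √d * h ^ P.γ))
    (fun z hz hzF => hlev.fine_cover hh hz (hzF.trans_le ?_)) ?_ ?_ ?_ ?_ ?_ ?_ ?_
  · linarith
  · refine (closure_mono (Problem.nbd_mono ?_)).trans hint
    linarith
  · linarith
  · linarith
  · linarith
  · linarith
  · linarith
  · have : P.Cerr d * (P.Cγ * h ^ P.γ) =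
        P.Cγ * h ^ P.γ + (P.CO + 4 * (P.lip * √d)) * h ^ P.γ := by
      unfold Params.Cerr; field_simp
    rw [this]
    linarith

end IsMeshSeq
end Setup
-- Sizes of the active sets and of the grids
theorem card_Icc_ceil_floor_le {a b : ℝ} (h : a ≤ b) :
    ((Finset.Icc ⌈a⌉ ⌊b⌋).card : ℝ) ≤ b - a + 1 := by
  rw [Int.card_Icc]
  have h1 := Int.le_ceil a
  have h2 := Int.floor_le b
  rcases le_or_gt 0 (⌊b⌋ + 1 - ⌈a⌉) with h0 | h0
  · have : (((⌊b⌋ + 1 - ⌈a⌉).toNat : ℕ) : ℝ) = ((⌊b⌋ + 1 - ⌈a⌉ : ℤ) : ℝ) := by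
      exact_mod_cast Int.toNat_of_nonneg h0
    rw [this]; push_cast; linarith
  · rw [Int.toNat_of_nonpos h0.le]; push_cast; linarith

theorem card_le_of_supClose {d : ℕ} (T : Finset (Pt d)) (o x : Pt d) {H r : ℝ} (hH : 0 < H)
    (hr : 0 ≤ r) (hT : ∀ z ∈ T, ∀ i, ∃ k : ℤ, z i = o i + H * k)
    (hclose : ∀ z ∈ T, SupClose r z x) : (T.card : ℝ) ≤ (2 * r / H + 1) ^ d := by
  classical
  have h1 := card_le_card_of_lattice T o H
    (Fintype.piFinset (fun i => Finset.Icc ⌈(x i - r - o i) / H⌉ ⌊(x i + r - o i) / H⌋))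
    (fun z hz => by
      choose k hk using hT z hz
      refine ⟨k, Fintype.mem_piFinset.mpr (fun i => Finset.mem_Icc.mpr ?_), hk⟩
      have h2 := abs_le.mp (hclose z hz i)
      rw [hk i] at h2
      constructor
      · refine Int.ceil_le.mpr ((div_le_iff₀ hH).mpr ?_)
        linarith [h2.1]
      · refine Int.le_floor.mpr ((le_div_iff₀ hH).mpr ?_)
        linarith [h2.2])
  rw [Fintype.card_piFinset] at h1
  refine (Nat.cast_le.mpr h1).trans ?_
  rw [Nat.cast_prod]
  refine (Finset.prod_le_prod (fun _ _ => Nat.cast_nonneg _)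
    (fun i _ => (card_Icc_ceil_floor_le ?_).trans (le_of_eq ?_))).trans
    (le_of_eq (by rw [Finset.prod_const, Finset.card_univ, Fintype.card_fin]))
  · exact div_le_div_of_nonneg_right (by linarith) hH.le
  · field_simp; ring

namespace Setup

variable {d : ℕ} {P : Params} {S : Setup d P.L} {n : ℕ}

/-- Points with a small value of `F_v` are close to the optimal trajectories, also in the source
and in the destination. -/
theorem Satisfies.exists_geodesic_near (hS : Satisfies P S n) (hd : 2 ≤ d) {κ : ℝ}
    {x : Pt d} (hx : x ∈ S.Ω) (hxF : S.Fv x < S.infFv + κ) :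
    ∃ g ∈ S.geodesicPoints,
      ‖x - g‖ ≤ P.Cβ * κ ^ P.β + 3 * P.fM * Real.exp (P.R / P.fmin) * κ := by
  have hp := hS.regular hd
  have hκ : 0 < κ := by linarith [Problem.infFv_le hx]
  have hd0 : 0 < d := by omega
  obtain ⟨xs, hxs, ys, hys, -⟩ := hp.exists_optimal
  have hE : 0 < P.fM * Real.exp (P.R / P.fmin) * κ :=
    mul_pos (mul_pos P.fM_pos (Real.exp_pos _)) hκ
  -- The stiffness assumption says nothing about points of the source and destination. Such a point
  -- is moved to the point `w` of `exists_exit`, then slightly out of these sets; the two moves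
  -- account for `2 + 1 = 3` in the constant.
  have finish : ∀ w : Pt d, w ∈ closure (S.Ω \ (S.Ksrc ∪ S.Kdst)) → S.Fv w < S.infFv + κ →
      ‖x - w‖ ≤ 2 * P.fM * Real.exp (P.R / P.fmin) * κ →
      ∃ g ∈ S.geodesicPoints,
        ‖x - g‖ ≤ P.Cβ * κ ^ P.β + 3 * P.fM * Real.exp (P.R / P.fmin) * κ := by
    intro w hw hwF hxw
    have hf := P.fmin_pos
    have hgap : 0 < S.infFv + κ - S.Fv w := by linarith
    obtain ⟨x', hx', hd'⟩ := Metric.mem_closure_iff.mp hw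
      (min ((S.infFv + κ - S.Fv w) / (2 / P.fmin)) (P.fM * Real.exp (P.R / P.fmin) * κ))
      (lt_min (by positivity) hE)
    rw [dist_eq_norm] at hd'
    have h1 := hd'.trans_le (min_le_left _ _)
    have h2 := hd'.trans_le (min_le_right _ _)
    rw [lt_div_iff₀ (by positivity), mul_comm] at h1
    have h3 := (abs_le.mp (hp.Fv_lipschitz (closure_mono sdiff_subset hw)
      (subset_closure hx'.1))).1
    obtain ⟨g, hg, hgx⟩ := hS.stiffness κ hκ x' ⟨hx', by linarith⟩
    refine ⟨g, hg, ?_⟩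
    have h4 : ‖x - g‖ ≤ ‖x - w‖ + ‖w - x'‖ + ‖x' - g‖ := by
      have e : x - g = (x - w) + (w - x') + (x' - g) := by abel
      rw [e]; exact norm_add₃_le
    linarith
  rcases Problem.mem_nbd_or hx hxF with h | h | h
  · obtain ⟨g, hg, hgx⟩ := hS.stiffness κ hκ x h
    exact ⟨g, hg, by linarith⟩
  · have hK : ∀ w ∈ S.Ksrc, S.Fv w = S.val 1 S.Kdst w := fun w hw => by
      rw [Fv_eq, S.vs_eq_val, Problem.val_eq_zero hd0 (-1) S.src_subset hw]
      simp [S.vd_eq_val]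
    obtain ⟨w, hwK, hwv, hxw, hwc⟩ := hp.exists_exit (σ := 1) (by simp) S.dst_subset
      S.src_subset S.isCompact_dst S.isCompact_src S.disjoint.symm ⟨ys, hys⟩ (v₀ := S.infFv)
      (κ := κ) (fun w hw => by
        rw [← hK w hw]; exact Problem.infFv_le (S.src_subset hw)) h (by rwa [← hK x h])
    exact finish w (by rwa [union_comm]) (by rwa [hK w hwK]) hxw
  · have hK : ∀ w ∈ S.Kdst, S.Fv w = S.val (-1) S.Ksrc w := fun w hw => by
      rw [Fv_eq, S.vd_eq_val, Problem.val_eq_zero hd0 1 S.dst_subset hw]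
      simp [S.vs_eq_val]
    obtain ⟨w, hwK, hwv, hxw, hwc⟩ := hp.exists_exit (σ := -1) (by simp) S.src_subset
      S.dst_subset S.isCompact_src S.isCompact_dst S.disjoint ⟨xs, hxs⟩ (v₀ := S.infFv)
      (κ := κ) (fun w hw => by
        rw [← hK w hw]; exact Problem.infFv_le (S.dst_subset hw)) h (by rwa [← hK x h])
    exact finish w hwc (by rwa [hK w hwK]) hxw

end Setup

namespace Params

variable (P : Params)

/-- The width of the tubes around the optimal trajectories, in units of `√d H^{γβ}`. -/
noncomputable def Ctube : ℝ :=
  2 * P.Q * (P.Cβ + 3 * P.fM * Real.exp (P.R / P.fmin)) + 1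

/-- The first factor counts the sample balls along a path in units of `H^{-γβ}`; `45 = 15 * 3` is
the constant of one ball of doubled radius. -/
noncomputable def Cactive : ℝ := (P.R / P.fmin * P.fM + 1) * (45 * P.Ctube)

theorem one_le_Ctube : 1 ≤ P.Ctube := by
  have := P.one_le_Q
  have := P.Cβ_pos
  have := P.fM_pos
  have : 0 ≤ 2 * P.Q * (P.Cβ + 3 * P.fM * Real.exp (P.R / P.fmin)) := by positivity
  unfold Ctube; linarith

theorem one_le_Cactive : 1 ≤ P.Cactive := by
  have h1 := P.one_le_Ctube
  have h2 : 0 ≤ P.R / P.fmin * P.fM :=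
    mul_nonneg (div_nonneg P.R_nonneg P.fmin_pos.le) P.fM_pos.le
  unfold Cactive
  nlinarith

theorem γβ_le_one : P.γ * P.β ≤ 1 :=
  (mul_le_mul P.γ_le P.β_le P.β_pos.le zero_le_one).trans (by norm_num)

end Params

/-- The origin of `ν`: for `s = H^{γβ}`, a tube consists of about `1 / s` balls with about `(s /
H)^d` nodes each, and the single factor `1 / s` is spread over the `d` factors. -/
theorem rpow_pow_div {H a : ℝ} (hH : 0 < H) {d : ℕ} (hd : 0 < d) :
    (H ^ a / H) ^ d / H ^ a = (H ^ (a * (1 - 1 / (d : ℝ))) / H) ^ d := by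
  have hd' : (d : ℝ) ≠ 0 := by exact_mod_cast hd.ne'
  rw [div_pow, div_pow, div_right_comm]
  congr 1
  rw [← Real.rpow_mul_natCast hH.le, ← Real.rpow_mul_natCast hH.le, ← Real.rpow_sub hH]
  congr 1
  field_simp

namespace Setup

variable {d : ℕ} {P : Params} {S : Setup d P.L} {n : ℕ}

/-- The number of nodes of mesh step `H` in the neighbourhood of size `2 Cη H^γ` of the optimal
trajectories. -/
theorem Satisfies.card_le_of_Fv_lt (hS : Satisfies P S n) (hd : 2 ≤ d) {H : ℝ} (hH : 0 < H)
    (hH1 : H ≤ 1) (T : Finset (Pt d)) (hT : T ⊆ S.X H)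
    (hF : ∀ x ∈ T, S.Fv x < S.infFv + 2 * (P.Cη d * H ^ P.γ)) :
    (T.card : ℝ) ≤ n * (P.Cactive * (H ^ P.ν d / H)) ^ d := by
  have hp := hS.regular hd
  have hd1 := Params.one_le_sqrt hd
  have hQ := P.one_le_Q
  have hC1 := P.one_le_Ctube
  have hCβ := P.Cβ_pos
  have hfM := P.fM_pos
  have hfmin := P.fmin_pos
  have hRf : 0 ≤ P.R / P.fmin := div_nonneg P.R_nonneg hfmin.le
  set s := H ^ (P.γ * P.β) with hs
  have hs0 : 0 < s := Real.rpow_pos_of_pos hH _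
  have hs1 : s ≤ 1 := Real.rpow_le_one hH.le hH1 (mul_pos P.γ_pos P.β_pos).le
  have hsH : H ≤ s := by
    have := Real.rpow_le_rpow_of_exponent_ge hH hH1 P.γβ_le_one
    rwa [Real.rpow_one] at this
  have hHγs : H ^ P.γ ≤ s := Real.rpow_le_rpow_of_exponent_ge hH hH1
    (mul_le_of_le_one_right P.γ_pos.le P.β_le)
  have hHγ : 0 < H ^ P.γ := Real.rpow_pos_of_pos hH _
  obtain ⟨y, τ, hopt, hgeo⟩ := hS.finite_paths
  have hτ : ∀ i, τ i ≤ P.R / P.fmin := by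
    intro i
    obtain ⟨hτ0, hX, -, hK, hT⟩ := hopt i
    have h1 := hp.one_sub_val_ge (σ := 1) (by simp) S.dst_subset ⟨_, hK⟩
      (subset_closure (S.src_subset hX.1))
    have h2 : S.minTime 1 S.Kdst (y i 0) = ENNReal.ofReal (τ i) := hT.symm
    rw [Problem.val, h2, one_sub_kruzkov_ofReal hτ0] at h1
    linarith [Real.exp_le_exp.mp h1]
  have hnear : ∀ z ∈ T, ∃ i, ∃ t ∈ Icc 0 (τ i), ‖z - y i t‖ ≤ √d * (P.Ctube * s) := by
    intro z hz
    obtain ⟨g, hg, hzg⟩ := hS.exists_geodesic_near hd ((S.mem_X hH).mp (hT hz)).1 (hF z hz)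
    rw [hgeo] at hg
    obtain ⟨i, t, ht, rfl⟩ := mem_iUnion.mp hg
    refine ⟨i, t, ht, hzg.trans ?_⟩
    have hb1 : 1 ≤ 2 * (√d * P.Q) := by nlinarith
    have e1 : (2 * (P.Cη d * H ^ P.γ)) ^ P.β ≤ 2 * (√d * P.Q) * s := by
      have e : 2 * (P.Cη d * H ^ P.γ) = 2 * (√d * P.Q) * H ^ P.γ := by unfold Params.Cη; ring
      rw [e, Real.mul_rpow (by linarith) hHγ.le, ← Real.rpow_mul hH.le]
      refine mul_le_mul_of_nonneg_right ?_ hs0.le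
      have := Real.rpow_le_rpow_of_exponent_le hb1 P.β_le
      rwa [Real.rpow_one] at this
    have e2 : 2 * (P.Cη d * H ^ P.γ) ≤ 2 * (√d * P.Q) * s := by
      have : 2 * (P.Cη d * H ^ P.γ) = 2 * (√d * P.Q) * H ^ P.γ := by unfold Params.Cη; ring
      rw [this]
      exact mul_le_mul_of_nonneg_left hHγs (by linarith)
    have hE : 0 ≤ 3 * P.fM * Real.exp (P.R / P.fmin) := by positivity
    have e3 := mul_le_mul_of_nonneg_left e1 hCβ.le
    have e4 := mul_le_mul_of_nonneg_left e2 hE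
    have e5 : √d * (P.Ctube * s) = P.Cβ * (2 * (√d * P.Q) * s) +
        3 * P.fM * Real.exp (P.R / P.fmin) * (2 * (√d * P.Q) * s) + √d * s := by
      unfold Params.Ctube; ring
    have e6 : 0 ≤ √d * s := by positivity
    linarith
  have h1 := card_le_of_tube (by omega) T (S.origin H) hH
    (mul_pos (by linarith) hs0 : 0 < P.Ctube * s) hfM hRf y τ
    (fun i r hr t ht => (hopt i).2.2.1.norm_sub_le (by simp) hp.speed_le hr ht) hτ
    (fun z hz => ((S.mem_X hH).mp (hT hz)).2) hnear
  refine h1.trans (mul_le_mul_of_nonneg_left ?_ (Nat.cast_nonneg n))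
  have hA : 0 ≤ P.R / P.fmin * P.fM := mul_nonneg hRf hfM.le
  have k1 : P.R / P.fmin * P.fM / (P.Ctube * s) + 1 ≤ (P.R / P.fmin * P.fM + 1) / s := by
    rw [add_div]
    refine add_le_add ?_ ?_
    · exact div_le_div_of_nonneg_left hA hs0 (le_mul_of_one_le_left hs0.le hC1)
    · rw [le_div_iff₀ hs0]; linarith
  have k2 : 15 * (1 + 2 * (P.Ctube * s) / H) ≤ 45 * P.Ctube * (s / H) := by
    have : 1 ≤ P.Ctube * (s / H) := by
      have := (one_le_div hH).mpr hsH
      nlinarith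
    have e : 2 * (P.Ctube * s) / H = 2 * (P.Ctube * (s / H)) := by ring
    rw [e]; linarith
  have hsd : 0 ≤ s / H := div_nonneg hs0.le hH.le
  calc (P.R / P.fmin * P.fM / (P.Ctube * s) + 1) * (15 * (1 + 2 * (P.Ctube * s) / H)) ^ d
      ≤ (P.R / P.fmin * P.fM + 1) / s * (45 * P.Ctube * (s / H)) ^ d :=
        mul_le_mul k1 (pow_le_pow_left₀ (by positivity) k2 d) (by positivity) (by positivity)
    _ = (P.R / P.fmin * P.fM + 1) * (45 * P.Ctube) ^ d * ((s / H) ^ d / s) := by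
        rw [mul_pow]; ring
    -- The prefactor is at least one, so it may be raised to the power `d` to fit the form `C^d`.
    _ ≤ (P.R / P.fmin * P.fM + 1) ^ d * (45 * P.Ctube) ^ d * ((s / H) ^ d / s) := by
        refine mul_le_mul_of_nonneg_right (mul_le_mul_of_nonneg_right ?_ (by positivity))
          (by positivity)
        exact le_self_pow₀ (by linarith) (by omega)
    _ = _ := by
        rw [rpow_pow_div hH (by omega : 0 < d), ← mul_pow, ← mul_pow]
        rfl

theorem card_around_le (S : Setup d P.L) {H h : ℝ} (hh : 0 < h) (hhH : h ≤ H) (x : Pt d) :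
    ((S.around H h x).card : ℝ) ≤ (3 * (H / h)) ^ d := by
  classical
  have hm : max (H - h) h ≤ H := max_le (by linarith) hhH
  have h1 := card_le_of_supClose (S.around H h x) (S.origin h) x hh (r := H) (by linarith)
    (fun z hz => ((S.mem_X hh).mp (by rw [around, Finset.mem_filter] at hz; exact hz.1)).2)
    (fun z hz i => by
      rw [around, Finset.mem_filter] at hz
      exact (hz.2 i).trans hm)
  have hH : 0 < H := hh.trans_le hhH
  refine h1.trans (pow_le_pow_left₀ (by positivity) ?_ d)
  have := (one_le_div hh).mpr hhH
  have e : 2 * H / h = 2 * (H / h) := by ring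
  rw [e]; linarith

theorem Satisfies.card_X_le (hS : Satisfies P S n) (hd : 2 ≤ d) {H : ℝ} (hH : 0 < H)
    (hH1 : H ≤ 1) : ((S.X H).card : ℝ) ≤ ((2 * P.R + 1) * (1 / H)) ^ d := by
  have hp := hS.regular hd
  obtain ⟨x, hx⟩ := S.isConnected.nonempty
  have h1 := card_le_of_supClose (S.X H) (S.origin H) x hH P.R_nonneg
    (fun z hz => ((S.mem_X hH).mp hz).2)
    (fun z hz i => by
      have h2 := PiLp.norm_apply_le (z - x) i
      rw [Real.norm_eq_abs] at h2
      exact h2.trans (hp.dist_le z (subset_closure ((S.mem_X hH).mp hz).1) x (subset_closure hx)))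
  have hR := P.R_nonneg
  refine h1.trans (pow_le_pow_left₀ (by positivity) ?_ d)
  have := (one_le_div hH).mpr hH1
  have e : 2 * P.R / H = 2 * P.R * (1 / H) := by ring
  rw [e]; linarith

end Setup
-- Cost of a level and total cost
theorem heapCost_le {m : ℕ} {Z : ℝ} (hm : (m : ℝ) ≤ Z) (hZ : 1 ≤ Z) :
    (heapCost m : ℝ) ≤ Real.logb 2 Z + 1 := by
  unfold heapCost
  push_cast
  refine add_le_add_left ?_ 1
  rcases Nat.eq_zero_or_pos m with rfl | h0
  · simpa using Real.logb_nonneg one_lt_two hZ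
  · refine (Real.natLog_le_logb m 2).trans ?_
    exact Real.logb_le_logb_of_le one_lt_two (by exact_mod_cast h0) hm

namespace Params

variable (P : Params)

/-- It suffices both for the first grid (`2 * R + 1`) and for the finer ones (`3 * Cactive`). -/
noncomputable def Cgrid : ℝ := 2 * P.R + 1 + 3 * P.Cactive

/-- The square reflects at most `(2 L + 1)^d` updates per accepted node, each with at most as many
neighbours. -/
noncomputable def Ccost : ℝ := P.Cgrid * (2 * P.L + 1) ^ 2

theorem one_le_Cgrid : 1 ≤ P.Cgrid := by
  have := P.R_nonneg
  have := P.one_le_Cactive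
  unfold Cgrid; linarith

theorem Cgrid_le_Ccost : P.Cgrid ≤ P.Ccost := by
  have := P.one_le_Cgrid
  refine le_mul_of_one_le_right (by linarith) (one_le_pow₀ ?_)
  have : (0 : ℝ) ≤ P.L := Nat.cast_nonneg _
  linarith

end Params

theorem UpdateOperator.ops_march_le_real {d L : ℕ} (A : UpdateOperator d L) {H : ℝ} (hH : 0 < H)
    {G start ending : Finset (Pt d)} (hs : start ⊆ G) {Z : ℝ} (hG : (G.card : ℝ) ≤ Z)
    (hZ : 1 ≤ Z) : ((A.march H G start ending).ops : ℝ) ≤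
      10 * (Z * ((2 * L + 1 : ℝ) ^ 2) ^ d * (Real.logb 2 Z + 1)) := by
  have h1 : ((A.march H G start ending).ops : ℝ) ≤
      ((10 * (G.card * (((2 * L + 1) ^ d) ^ 2 * heapCost G.card)) : ℕ) : ℝ) :=
    Nat.cast_le.mpr (A.ops_march_le hH hs)
  refine h1.trans ?_
  push_cast
  rw [← pow_mul, mul_comm d 2, pow_mul, ← mul_assoc (G.card : ℝ)]
  have h2 : 0 ≤ Real.logb 2 Z := Real.logb_nonneg one_lt_two hZ
  gcongr
  exact heapCost_le hG hZ

namespace Setup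

variable {d : ℕ} {P : Params} {S : Setup d P.L} {n : ℕ}

theorem card_fine_le (S : Setup d P.L) (H h η : ℝ) (G : Finset (Pt d)) :
    (S.fine H h η G).card ≤ ∑ x ∈ S.active H η G, (S.around H h x).card := by
  classical
  exact Finset.card_biUnion_le

/-- `24`: ten for each search, two for the two passes through the nodes, and two for the active
nodes and the insertions. `Z` also bounds the number of insertions, repeated ones included. -/
theorem levelCost_le (S : Setup d P.L) {H h η : ℝ} (hH : 0 < H) {G : Finset (Pt d)} {Z : ℝ}
    (hG : (G.card : ℝ) ≤ Z) (hZ : 1 ≤ Z)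
    (hR : ((∑ x ∈ S.active H η G, (S.around H h x).card : ℕ) : ℝ) ≤ Z) :
    (S.levelCost H h η G : ℝ) ≤
      24 * (Z * ((2 * P.L + 1 : ℝ) ^ 2) ^ d * (Real.logb 2 Z + 1)) := by
  classical
  have h2 : 0 ≤ Real.logb 2 Z := Real.logb_nonneg one_lt_two hZ
  have hD := S.Ud.ops_march_le_real hH (inter_subset G S.Kdst)
    (ending := inter G (Metric.thickening η S.Ksrc)) hG hZ
  have hS := S.Us.ops_march_le_real hH (inter_subset G S.Ksrc)
    (ending := inter G (Metric.thickening η S.Kdst)) hG hZ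
  have hact : ((S.active H η G).card : ℝ) ≤ Z :=
    (Nat.cast_le.mpr (Finset.card_filter_le _ _)).trans hG
  have hfine : (heapCost (S.fine H h η G).card : ℝ) ≤ Real.logb 2 Z + 1 :=
    heapCost_le ((Nat.cast_le.mpr (S.card_fine_le H h η G)).trans hR) hZ
  have hsum : ((∑ x ∈ S.active H η G,
      (1 + ∑ _z ∈ S.around H h x, heapCost (S.fine H h η G).card) : ℕ) : ℝ) ≤
      Z + Z * (Real.logb 2 Z + 1) := by
    rw [Finset.sum_add_distrib, Finset.sum_const, smul_eq_mul, mul_one]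
    simp only [Finset.sum_const, smul_eq_mul]
    rw [← Finset.sum_mul]
    push_cast
    push_cast at hR
    exact add_le_add hact (mul_le_mul hR hfine (Nat.cast_nonneg _) (by linarith))
  unfold levelCost
  push_cast
  push_cast at hsum
  have hB : (1 : ℝ) ≤ ((2 * P.L + 1 : ℝ) ^ 2) ^ d := by
    refine one_le_pow₀ (one_le_pow₀ ?_)
    have : (0 : ℝ) ≤ P.L := Nat.cast_nonneg _
    linarith
  have k1 : Z * (Real.logb 2 Z + 1) ≤
      Z * ((2 * P.L + 1 : ℝ) ^ 2) ^ d * (Real.logb 2 Z + 1) :=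
    mul_le_mul_of_nonneg_right (le_mul_of_one_le_right (by linarith) hB) (by linarith)
  have k2 : Z ≤ Z * (Real.logb 2 Z + 1) := le_mul_of_one_le_right (by linarith) (by linarith)
  change ((S.levelD H η G).ops : ℝ) ≤ _ at hD
  change ((S.levelS H η G).ops : ℝ) ≤ _ at hS
  linarith

theorem Satisfies.one_le (hS : Satisfies P S n) : (1 : ℝ) ≤ n := by
  obtain ⟨y, τ, -, hgeo⟩ := hS.finite_paths
  obtain ⟨g, hg⟩ := hS.geodesic_nonempty
  rw [hgeo] at hg
  obtain ⟨i, -⟩ := mem_iUnion.mp hg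
  have : 0 < n := i.pos
  exact_mod_cast this

namespace IsMeshSeq

variable {mesh : ℕ → ℝ} {N : ℕ}

/-- The number of active nodes is multiplied by the `(3 H / h)^d` fine nodes around each; the powers
of `H` combine to `(H^ν / h)^d`. Repetitions are counted because every insertion has a cost. -/
theorem sum_around_le (hm : IsMeshSeq P S mesh N) (hS : Satisfies P S n) (hd : 2 ≤ d) {ψ : ℝ}
    (hψ : ∀ l, 1 ≤ l → l < N → mesh l ^ P.ν d / mesh (l + 1) ≤ ψ) {k : ℕ} (hk : k + 1 < N) :
    ((∑ x ∈ S.active (mesh (k + 1)) (P.Cη d * mesh (k + 1) ^ P.γ)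
      (S.levelGrid mesh (fun l => P.Cη d * mesh l ^ P.γ) k),
      (S.around (mesh (k + 1)) (mesh (k + 2)) x).card : ℕ) : ℝ) ≤ n * (P.Cgrid * ψ) ^ d := by
  have hH := hm.pos (k + 1) (by omega) hk.le
  have hh := hm.pos (k + 2) (by omega) (by omega)
  have hlev := hm.level hS hd hk
  have hle := hm.succ_le (l := k + 1) (by omega) hk
  have hψk := hψ (k + 1) (by omega) hk
  change _ / mesh (k + 2) ≤ ψ at hψk
  change mesh (k + 2) ≤ mesh (k + 1) at hle
  have hact := hS.card_le_of_Fv_lt hd hH (hm.le_one (by omega) hk.le) (S.active (mesh (k + 1))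
    (P.Cη d * mesh (k + 1) ^ P.γ) (S.levelGrid mesh (fun l => P.Cη d * mesh l ^ P.γ) k))
    ((Finset.filter_subset _ _).trans hlev.subset) (fun x hx => hlev.Fv_lt_of_active hx)
  set H := mesh (k + 1)
  set h := mesh (k + 2)
  have hHν : 0 < H ^ P.ν d := Real.rpow_pos_of_pos hH _
  have hCa := P.one_le_Cactive
  have hR := P.R_nonneg
  push_cast
  calc _ ≤ ∑ x ∈ S.active H (P.Cη d * H ^ P.γ)
        (S.levelGrid mesh (fun l => P.Cη d * mesh l ^ P.γ) k), (3 * (H / h)) ^ d :=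
        Finset.sum_le_sum (fun x _ => S.card_around_le hh hle x)
    _ ≤ n * (P.Cactive * (H ^ P.ν d / H)) ^ d * (3 * (H / h)) ^ d := by
        rw [Finset.sum_const, nsmul_eq_mul]
        exact mul_le_mul_of_nonneg_right hact (by positivity)
    _ = n * (3 * P.Cactive * (H ^ P.ν d / h)) ^ d := by
        rw [mul_assoc, ← mul_pow]
        congr 2
        field_simp
    _ ≤ _ := by
        refine mul_le_mul_of_nonneg_left (pow_le_pow_left₀ (by positivity) ?_ d)
          (Nat.cast_nonneg n)
        refine mul_le_mul ?_ hψk (by positivity) (by linarith [P.one_le_Cgrid])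
        unfold Params.Cgrid; linarith

theorem card_levelGrid_le (hm : IsMeshSeq P S mesh N) (hS : Satisfies P S n) (hd : 2 ≤ d) {ψ : ℝ}
    (hψ1 : 1 / mesh 1 ≤ ψ)
    (hψ : ∀ l, 1 ≤ l → l < N → mesh l ^ P.ν d / mesh (l + 1) ≤ ψ) {k : ℕ} (hk : k < N) :
    ((S.levelGrid mesh (fun l => P.Cη d * mesh l ^ P.γ) k).card : ℝ) ≤
      n * (P.Cgrid * ψ) ^ d := by
  rcases k with _ | k
  · have h1 := hm.pos 1 le_rfl (by omega)
    refine (hS.card_X_le hd h1 hm.first).trans ?_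
    have hR := P.R_nonneg
    have hCa := P.one_le_Cactive
    have h2 : ((2 * P.R + 1) * (1 / mesh 1)) ^ d ≤ (P.Cgrid * ψ) ^ d := by
      refine pow_le_pow_left₀ (by positivity) ?_ d
      refine mul_le_mul ?_ hψ1 (by positivity) (by linarith [P.one_le_Cgrid])
      unfold Params.Cgrid; linarith
    have h3 : 0 ≤ ((2 * P.R + 1) * (1 / mesh 1)) ^ d := by positivity
    exact h2.trans (le_mul_of_one_le_left (h3.trans h2) hS.one_le)
  · exact (Nat.cast_le.mpr (S.card_fine_le _ _ _ _)).trans (hm.sum_around_le hS hd hψ hk)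

/-- The number of operations of the multi-level method. -/
theorem cost_le (hm : IsMeshSeq P S mesh N) (hS : Satisfies P S n) (hd : 2 ≤ d) {ψ : ℝ}
    (hψ1 : 1 / mesh 1 ≤ ψ)
    (hψ : ∀ l, 1 ≤ l → l < N → mesh l ^ P.ν d / mesh (l + 1) ≤ ψ) :
    (S.multiLevelCost mesh (fun l => P.Cη d * mesh l ^ P.γ) N : ℝ) ≤
      24 * (N * (n * (P.Ccost * ψ) ^ d) *
        (Real.logb 2 (n * (P.Cgrid * ψ) ^ d) + 1)) := by
  have hN := hm.two_le
  have h1 := hm.pos 1 le_rfl (by omega)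
  have hψ0 : 1 ≤ ψ := le_trans ((one_le_div h1).mpr hm.first) hψ1
  set Z : ℝ := n * (P.Cgrid * ψ) ^ d with hZdef
  have hZ : 1 ≤ Z := one_le_mul_of_one_le_of_one_le hS.one_le
    (one_le_pow₀ (one_le_mul_of_one_le_of_one_le P.one_le_Cgrid hψ0))
  set c : ℝ := Z * ((2 * P.L + 1 : ℝ) ^ 2) ^ d * (Real.logb 2 Z + 1) with hc
  have hc0 : 0 ≤ c := by
    have := Real.logb_nonneg one_lt_two hZ
    positivity
  have hsum : ((∑ k ∈ Finset.range (N - 1),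
      S.levelCost (mesh (k + 1)) (mesh (k + 2)) (P.Cη d * mesh (k + 1) ^ P.γ)
        (S.levelGrid mesh (fun l => P.Cη d * mesh l ^ P.γ) k) : ℕ) : ℝ) ≤ (N - 1 : ℕ) * (24 * c) := by
    push_cast
    refine (Finset.sum_le_card_nsmul _ _ (24 * c) (fun k hk => ?_)).trans
      (le_of_eq (by rw [Finset.card_range, nsmul_eq_mul]))
    rw [Finset.mem_range] at hk
    exact S.levelCost_le (hm.pos (k + 1) (by omega) (by omega))
      (hm.card_levelGrid_le hS hd hψ1 hψ (by omega)) hZ (hm.sum_around_le hS hd hψ (by omega))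
  have hlast : ((S.last (mesh N)
      (S.finalGrid mesh (fun l => P.Cη d * mesh l ^ P.γ) N)).ops : ℝ) ≤ 10 * c :=
    S.Ud.ops_march_le_real (hm.pos N (by omega) le_rfl) (inter_subset _ _)
      (hm.card_levelGrid_le hS hd hψ1 hψ (by omega)) hZ
  have hNc : ((N - 1 : ℕ) : ℝ) = N - 1 := by
    rw [Nat.cast_sub (by omega), Nat.cast_one]
  have hfin : (N : ℝ) * (n * (P.Ccost * ψ) ^ d) * (Real.logb 2 Z + 1) = N * c := by
    rw [hc, hZdef]
    unfold Params.Ccost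
    rw [mul_pow, mul_pow, mul_pow]
    ring
  rw [hfin]
  unfold multiLevelCost
  rw [Nat.cast_add]
  rw [hNc] at hsum
  linarith

end IsMeshSeq
end Setup
-- Small `ε` and the three choices of mesh steps
open Filter Topology

theorem exists_pos_of_eventually {p : ℝ → Prop} (h : ∀ᶠ ε in 𝓝[>] (0 : ℝ), p ε) :
    ∃ ε₀ : ℝ, 0 < ε₀ ∧ ∀ ε : ℝ, 0 < ε → ε < ε₀ → p ε := by
  obtain ⟨ε₀, h0, hsub⟩ := mem_nhdsGT_iff_exists_Ioo_subset.mp h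
  exact ⟨ε₀, h0, fun ε h1 h2 => hsub ⟨h1, h2⟩⟩

theorem tendsto_one_div_rpow_atTop {s : ℝ} (hs : 0 < s) :
    Tendsto (fun ε : ℝ => (1 / ε) ^ s) (𝓝[>] 0) atTop := by
  simp only [one_div]
  exact (tendsto_rpow_atTop hs).comp tendsto_inv_nhdsGT_zero

namespace Params

variable (P : Params)

/-- The factor that compares `1 / h` and `(1 / ε) ^ (1 / γ)`. -/
noncomputable def Cmesh : ℝ := max 1 P.Cγ ^ (1 / P.γ)

theorem one_le_Cmesh : 1 ≤ P.Cmesh :=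
  Real.one_le_rpow (le_max_left _ _) (one_div_pos.mpr P.γ_pos).le

theorem one_le_Ccost : 1 ≤ P.Ccost := P.one_le_Cgrid.trans P.Cgrid_le_Ccost

theorem h_pos {ε : ℝ} (hε : 0 < ε) : 0 < P.h ε :=
  Real.rpow_pos_of_pos (div_pos hε P.Cγ_pos) _

theorem Cγ_mul_h {ε : ℝ} (hε : 0 < ε) : P.Cγ * P.h ε ^ P.γ = ε := by
  have hC := P.Cγ_pos
  unfold h
  rw [← Real.rpow_mul (div_pos hε hC).le, one_div_mul_cancel P.γ_pos.ne', Real.rpow_one,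
    mul_div_cancel₀ _ hC.ne']

theorem tendsto_h : Tendsto P.h (𝓝[>] 0) (𝓝 0) := by
  have h1 : Tendsto (fun ε : ℝ => ε / P.Cγ) (𝓝[>] 0) (𝓝 0) := by
    have := (tendsto_id (α := ℝ) (x := 𝓝 0)).div_const P.Cγ
    rw [zero_div] at this
    exact this.mono_left nhdsWithin_le_nhds
  have hpos : 0 < 1 / P.γ := one_div_pos.mpr P.γ_pos
  have h2 := h1.rpow_const (p := 1 / P.γ) (Or.inr hpos.le)
  rwa [Real.zero_rpow hpos.ne'] at h2

theorem eventually_h_rpow_lt {a b : ℝ} (ha : 0 < a) (hb : 0 < b) :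
    ∀ᶠ ε in 𝓝[>] (0 : ℝ), P.h ε ^ a < b := by
  have h2 := P.tendsto_h.rpow_const (p := a) (Or.inr ha.le)
  rw [Real.zero_rpow ha.ne'] at h2
  exact h2.eventually_lt_const hb

theorem eventually_h_lt_one : ∀ᶠ ε in 𝓝[>] (0 : ℝ), P.h ε < 1 :=
  P.tendsto_h.eventually_lt_const one_pos

theorem h_rpow_neg_le {ε e : ℝ} (hε : 0 < ε) (he : 0 ≤ e) (he1 : e ≤ 1) :
    P.h ε ^ (-e) ≤ P.Cmesh * (1 / ε) ^ (e / P.γ) := by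
  have hC := P.Cγ_pos
  have hγ := P.γ_pos
  have hq : 0 < ε / P.Cγ := div_pos hε hC
  have h1 : P.h ε ^ (-e) = P.Cγ ^ (e / P.γ) * (1 / ε) ^ (e / P.γ) := by
    unfold h
    rw [← Real.rpow_mul hq.le, ← Real.mul_rpow hC.le (by positivity),
      show 1 / P.γ * -e = -(e / P.γ) by ring, Real.rpow_neg hq.le, ← Real.inv_rpow hq.le]
    congr 1
    field_simp
  rw [h1]
  gcongr
  unfold Cmesh
  calc P.Cγ ^ (e / P.γ) ≤ max 1 P.Cγ ^ (e / P.γ) :=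
        Real.rpow_le_rpow hC.le (le_max_right _ _) (by positivity)
    _ ≤ _ := Real.rpow_le_rpow_of_exponent_le (le_max_left _ _) (by gcongr)

theorem ν_pos {d : ℕ} (hd : 2 ≤ d) : 0 < P.ν d := by
  have hd' : (2 : ℝ) ≤ d := by exact_mod_cast hd
  have : 1 / (d : ℝ) < 1 := by rw [div_lt_one (by linarith)]; linarith
  exact mul_pos (mul_pos P.γ_pos P.β_pos) (by linarith)

theorem ν_lt_one {d : ℕ} (hd : 2 ≤ d) : P.ν d < 1 := by
  have hd' : (2 : ℝ) ≤ d := by exact_mod_cast hd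
  have h1 : 0 < 1 / (d : ℝ) := by positivity
  have h2 := P.γβ_le_one
  have h3 := mul_pos P.γ_pos P.β_pos
  unfold ν
  nlinarith

theorem one_sub_ν_mul {d : ℕ} (hd : 2 ≤ d) :
    (1 - P.ν d) * d = 1 + ((d : ℝ) - 1) * (1 - P.γ * P.β) := by
  have hd' : (d : ℝ) ≠ 0 := by positivity
  unfold ν
  field_simp
  ring

theorem one_le_one_sub_ν_mul {d : ℕ} (hd : 2 ≤ d) : 1 ≤ (1 - P.ν d) * d := by
  rw [P.one_sub_ν_mul hd]
  have hd' : (2 : ℝ) ≤ d := by exact_mod_cast hd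
  have := mul_nonneg (by linarith : (0 : ℝ) ≤ d - 1) (sub_nonneg.mpr P.γβ_le_one)
  linarith

/-- The number of levels of the third method. -/
noncomputable def levels (c ε : ℝ) : ℕ := ⌊c / P.γ * Real.log (1 / ε)⌋₊

theorem tendsto_log_one_div : Tendsto (fun ε : ℝ => Real.log (1 / ε)) (𝓝[>] 0) atTop := by
  simp only [one_div]
  exact Real.tendsto_log_atTop.comp tendsto_inv_nhdsGT_zero

theorem tendsto_levels {c : ℝ} (hc : 0 < c) :
    Tendsto (P.levels c) (𝓝[>] 0) atTop :=
  tendsto_nat_floor_atTop.comp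
    (tendsto_log_one_div.const_mul_atTop (div_pos hc P.γ_pos))

theorem log_h {ε : ℝ} (hε : 0 < ε) :
    Real.log (P.h ε) = -((Real.log (1 / ε) + Real.log P.Cγ) / P.γ) := by
  unfold h
  rw [Real.log_rpow (div_pos hε P.Cγ_pos), Real.log_div hε.ne' P.Cγ_pos.ne', one_div ε,
    Real.log_inv]
  ring

/-- `log h` is equivalent to `-log (1 / ε) / γ`, and the number of levels to `(c / γ) log (1 / ε)`;
the quotient of the two tends to `-1 / c`. -/
theorem tendsto_h_rpow_div_levels {c : ℝ} (hc : 0 < c) (a : ℝ) :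
    Tendsto (fun ε => P.h ε ^ (a / (P.levels c ε : ℝ))) (𝓝[>] 0) (𝓝 (Real.exp (-(a / c)))) := by
  have hγ := P.γ_pos
  have hcγ : 0 < c / P.γ := div_pos hc hγ
  have h1 : Tendsto (fun ε => (P.levels c ε : ℝ) / Real.log (1 / ε)) (𝓝[>] 0) (𝓝 (c / P.γ)) :=
    (tendsto_nat_floor_mul_div_atTop hcγ.le).comp tendsto_log_one_div
  have h2 : Tendsto (fun ε => 1 + Real.log P.Cγ / Real.log (1 / ε)) (𝓝[>] 0) (𝓝 (1 + 0)) :=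
    tendsto_const_nhds.add (tendsto_const_nhds.div_atTop tendsto_log_one_div)
  have h3 := ((h2.div h1 hcγ.ne').const_mul (-(a / P.γ))).rexp
  have h4 : -(a / P.γ) * ((1 + 0) / (c / P.γ)) = -(a / c) := by field_simp; ring
  rw [h4] at h3
  refine h3.congr' ?_
  filter_upwards [self_mem_nhdsWithin, tendsto_log_one_div.eventually_gt_atTop 0,
    (P.tendsto_levels hc).eventually_gt_atTop 0] with ε hε hlog hN
  have hN' : (0 : ℝ) < P.levels c ε := by exact_mod_cast hN
  rw [Real.rpow_def_of_pos (P.h_pos hε), P.log_h hε]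
  congr 1
  simp only [Pi.div_apply]
  field_simp

end Params

namespace Setup

variable {d : ℕ} {P : Params} {S : Setup d P.L} {n : ℕ}

/-- Since `n ≤ φ`, the logarithm of the grid size is at most `2 log φ`, which gives `96 = 24 * 4`.
The factor `N` may be absorbed by `φ` or by a further `log φ`, whence the exponent `2`. -/
theorem IsMeshSeq.cost_le_softO {mesh : ℕ → ℝ} {N : ℕ} (hm : IsMeshSeq P S mesh N)
    (hS : Satisfies P S n) (hd : 2 ≤ d) {ψ φ : ℝ} (hψ1 : 1 / mesh 1 ≤ ψ)
    (hψ : ∀ l, 1 ≤ l → l < N → mesh l ^ P.ν d / mesh (l + 1) ≤ ψ)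
    (hn : (n : ℝ) ≤ φ) (he : Real.exp 1 ≤ φ) (hφ : (P.Ccost * ψ) ^ d ≤ φ)
    (hφN : N * (P.Ccost * ψ) ^ d ≤ φ * Real.log φ) :
    (S.multiLevelCost mesh (fun l => P.Cη d * mesh l ^ P.γ) N : ℝ) ≤ n * softO 96 2 φ := by
  have hφ0 : 0 < φ := (Real.exp_pos 1).trans_le he
  have hlog : 1 ≤ Real.log φ := (Real.le_log_iff_exp_le hφ0).mpr he
  have hψ0 : 1 ≤ ψ :=
    le_trans ((one_le_div (hm.pos 1 le_rfl (by have := hm.two_le; omega))).mpr hm.first) hψ1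
  have hn1 := hS.one_le
  have hG := P.one_le_Cgrid
  have hGC := P.Cgrid_le_Ccost
  set Z : ℝ := n * (P.Cgrid * ψ) ^ d with hZ
  have hZ0 : 0 < Z := by positivity
  have hZle : Z ≤ φ * φ := by
    refine mul_le_mul hn (le_trans ?_ hφ) (by positivity) hφ0.le
    gcongr
  have hlogZ : Real.log Z ≤ 2 * Real.log φ := by
    have := Real.log_le_log hZ0 hZle
    rw [Real.log_mul hφ0.ne' hφ0.ne'] at this
    linarith
  have hlogb : Real.logb 2 Z + 1 ≤ 4 * Real.log φ := by
    have h2 := Real.log_two_gt_d9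
    have : Real.logb 2 Z ≤ 3 * Real.log φ := by
      unfold Real.logb
      rw [div_le_iff₀ (by linarith)]
      nlinarith
    linarith
  have hC0 : 0 ≤ (P.Ccost * ψ) ^ d := by
    have := P.one_le_Ccost
    positivity
  refine (hm.cost_le hS hd hψ1 hψ).trans ?_
  unfold softO
  rw [abs_of_pos (by linarith)]
  calc 24 * ((N : ℝ) * (n * (P.Ccost * ψ) ^ d) * (Real.logb 2 Z + 1))
      ≤ 24 * ((N : ℝ) * (n * (P.Ccost * ψ) ^ d) * (4 * Real.log φ)) := by gcongr
    _ = 96 * n * Real.log φ * (N * (P.Ccost * ψ) ^ d) := by ring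
    _ ≤ 96 * n * Real.log φ * (φ * Real.log φ) := by gcongr
    _ = _ := by ring

theorem IsMeshSeq.accurate_of_eq {mesh : ℕ → ℝ} {N : ℕ} (hm : IsMeshSeq P S mesh N)
    (hS : Satisfies P S n) (hd : 2 ≤ d) {ε : ℝ} (hε : 0 < ε) (hN : mesh N = P.h ε) :
    S.Accurate (P.h ε) ε (P.θ₀ / 4 * (P.Cη d * mesh (N - 1) ^ P.γ)) (P.Cerr d * ε)
      (S.finalGrid mesh (fun l => P.Cη d * mesh l ^ P.γ) N) := by
  have := hm.accurate hS hd
  rwa [hN, P.Cγ_mul_h hε] at this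

theorem closure_nbd_subset_of_le (S : Setup d P.L) {η η' : ℝ} (h : η ≤ η')
    (hη' : closure (S.nbd η') ⊆ S.Ω) : closure (S.nbd η) ⊆ S.Ω :=
  (closure_mono (S.nbd_mono h)).trans hη'

/-- The exponents balance the levels: `1 / H_1` and every quotient `H_l^ν / H_{l+1}` equal `h^{-e}`.
The bound `φ` is left free so that the two-level method can absorb its factor `N = 2`. -/
theorem Satisfies.eventually_multiLevel (hS : Satisfies P S n) (hd : 2 ≤ d) {N : ℕ} (hN : 2 ≤ N) :
    ∀ᶠ ε in 𝓝[>] (0 : ℝ), ∀ φ : ℝ,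
      N * (P.Ccost * P.Cmesh) ^ d *
        (1 / ε) ^ ((1 - P.ν d) / (1 - P.ν d ^ N) * ((d : ℝ) / P.γ)) ≤ φ →
      let mesh : ℕ → ℝ := fun l => P.h ε ^ ((1 - P.ν d ^ l) / (1 - P.ν d ^ N))
      let η : ℕ → ℝ := fun l => P.Cη d * mesh l ^ P.γ
      S.Accurate (P.h ε) ε (P.θ₀ / 4 * η (N - 1)) (P.Cerr d * ε) (S.finalGrid mesh η N) ∧
      (S.multiLevelCost mesh η N : ℝ) ≤ n * softO 96 2 φ := by
  have hν0 := P.ν_pos hd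
  have hν1 := P.ν_lt_one hd
  have hγ := P.γ_pos
  have hd0 : (0 : ℝ) < d := by positivity
  set ν := P.ν d with hν
  have hνN : ν ^ N ≤ ν := by
    simpa using pow_le_pow_of_le_one hν0.le hν1.le (by omega : 1 ≤ N)
  have hden : 0 < 1 - ν ^ N := by linarith
  set e : ℝ := (1 - ν) / (1 - ν ^ N) with he
  have he0 : 0 < e := div_pos (by linarith) hden
  have he1 : e ≤ 1 := (div_le_one hden).mpr (by linarith)
  obtain ⟨ηbar, hηbar, hint⟩ := hS.interior
  have hδ : 0 < ν ^ N * e * P.γ := by positivity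
  have hs : 0 < e * ((d : ℝ) / P.γ) := by positivity
  have hCη := P.Cη_pos hd
  filter_upwards [self_mem_nhdsWithin, P.eventually_h_lt_one,
    P.eventually_h_rpow_lt hδ (by norm_num : (0 : ℝ) < 2 / 5),
    P.eventually_h_rpow_lt (mul_pos he0 hγ) (div_pos hηbar hCη),
    (tendsto_one_div_rpow_atTop hs).eventually_ge_atTop (n : ℝ),
    (tendsto_one_div_rpow_atTop hs).eventually_ge_atTop (Real.exp 1)]
    with ε hε h1 hratio hηle hn hexp φ hφ
  have hε : 0 < ε := hε
  have hh := P.h_pos hε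
  set h := P.h ε with hhdef
  have hpow (a b : ℝ) : (h ^ a) ^ b = h ^ (a * b) := (Real.rpow_mul hh.le a b).symm
  intro mesh η
  have hmesh1 : mesh 1 = h ^ e := by simp [mesh, he]
  have hm : IsMeshSeq P S mesh N := by
    refine ⟨hN, fun l _ _ => Real.rpow_pos_of_pos hh _, ?_, fun l hl hlN => ?_, ?_⟩
    · rw [hmesh1]
      exact Real.rpow_le_one hh.le h1.le he0.le
    -- Consecutive exponents differ by `ν ^ l * e`, which is at least `ν ^ N * e`; smallness of `h`
    -- to this power times `γ` serves all levels.
    · have hexpo : (1 - ν ^ (l + 1)) / (1 - ν ^ N) * P.γ =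
          ν ^ l * e * P.γ + (1 - ν ^ l) / (1 - ν ^ N) * P.γ := by
        rw [he]; field_simp; ring
      simp only [mesh, hpow]
      rw [hexpo, Real.rpow_add hh]
      gcongr
      refine le_trans (Real.rpow_le_rpow_of_exponent_ge hh h1.le ?_) hratio.le
      gcongr ?_ * e * P.γ
      exact pow_le_pow_of_le_one hν0.le hν1.le hlN.le
    · refine S.closure_nbd_subset_of_le ?_ hint
      rw [hmesh1, hpow]
      rw [lt_div_iff₀ hCη] at hηle
      linarith
  refine ⟨hm.accurate_of_eq hS hd hε ?_, ?_⟩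
  · simp only [mesh]
    rw [div_self hden.ne', Real.rpow_one]
  have hCc := P.one_le_Ccost
  have hCm := P.one_le_Cmesh
  have hC1 : 1 ≤ (P.Ccost * P.Cmesh) ^ d :=
    one_le_pow₀ (one_le_mul_of_one_le_of_one_le hCc hCm)
  have hN1 : (1 : ℝ) ≤ N := by exact_mod_cast (by omega : 1 ≤ N)
  have hXφ : (1 / ε) ^ (e * ((d : ℝ) / P.γ)) ≤ φ :=
    (le_mul_of_one_le_left (by positivity)
      (one_le_mul_of_one_le_of_one_le hN1 hC1)).trans hφ
  have hψle : N * (P.Ccost * h ^ (-e)) ^ d ≤ φ := by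
    refine le_trans ?_ hφ
    rw [mul_assoc]
    have h2 : (1 / ε) ^ (e * ((d : ℝ) / P.γ)) = ((1 / ε) ^ (e / P.γ)) ^ d := by
      rw [← Real.rpow_mul_natCast (by positivity)]
      congr 1; ring
    rw [h2, ← mul_pow, mul_assoc]
    gcongr
    exact P.h_rpow_neg_le hε he0.le he1
  have hexpφ := hexp.trans hXφ
  have hφ0 : 0 < φ := (Real.exp_pos 1).trans_le hexpφ
  refine hm.cost_le_softO hS hd (ψ := h ^ (-e)) ?_ (fun l hl hlN => ?_) (hn.trans hXφ) hexpφ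
    (le_trans (le_mul_of_one_le_left (by positivity) hN1) hψle) (hψle.trans ?_)
  · rw [hmesh1, Real.rpow_neg hh.le, one_div]
  · simp only [mesh, hpow]
    rw [← Real.rpow_sub hh]
    refine le_of_eq ?_
    congr 1
    rw [he, ← hν]
    field_simp
    ring
  · exact le_mul_of_one_le_right hφ0.le ((Real.le_log_iff_exp_le hφ0).mpr hexpφ)

theorem Satisfies.eventually_logLevel (hS : Satisfies P S n) (hd : 2 ≤ d) {c ηbar : ℝ}
    (hc : 0 < c) (hc1 : c ≤ 1) (hint : closure (S.nbd ηbar) ⊆ S.Ω)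
    (hexpc : 5 / 2 < Real.exp (P.γ / c)) (hη : P.Cη d * Real.exp (-(P.γ / c)) < ηbar) :
    ∀ᶠ ε in 𝓝[>] (0 : ℝ),
      let mesh : ℕ → ℝ := fun l => P.h ε ^ ((l : ℝ) / (P.levels c ε : ℝ))
      let η : ℕ → ℝ := fun l => P.Cη d * mesh l ^ P.γ
      S.Accurate (P.h ε) ε (P.θ₀ / 4 * η (P.levels c ε - 1)) (P.Cerr d * ε)
        (S.finalGrid mesh η (P.levels c ε)) ∧
      (S.multiLevelCost mesh η (P.levels c ε) : ℝ) ≤ n * softO 96 2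
        ((2 * P.Ccost * P.Cmesh * Real.exp (1 / c)) ^ d *
          (1 / ε) ^ ((1 - P.ν d) * ((d : ℝ) / P.γ))) := by
  have hν0 := P.ν_pos hd
  have hν1 := P.ν_lt_one hd
  have hγ := P.γ_pos
  have hd0 : (0 : ℝ) < d := by positivity
  set ν := P.ν d with hν
  have hCη := P.Cη_pos hd
  have hs : 0 < (1 - ν) * ((d : ℝ) / P.γ) := mul_pos (by linarith) (by positivity)
  have hlim : Real.exp (-(P.γ / c)) < 2 / 5 := by
    rw [Real.exp_neg]
    exact (inv_lt_comm₀ (Real.exp_pos _) (by norm_num)).mpr (by linarith)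
  have hlim2 : Real.exp (-(P.γ / c)) < ηbar / P.Cη d := by
    rw [lt_div_iff₀ hCη]; linarith
  -- The factor `2` leaves room above the limit `e^{1/c}` of `h^{-1/N}`.
  have hlim3 : Real.exp (-((-1) / c)) < 2 * Real.exp (1 / c) := by
    have := Real.exp_pos (1 / c)
    rw [neg_div, neg_neg]
    linarith
  filter_upwards [self_mem_nhdsWithin, P.eventually_h_lt_one,
    (P.tendsto_h_rpow_div_levels hc P.γ).eventually_lt_const hlim,
    (P.tendsto_h_rpow_div_levels hc P.γ).eventually_lt_const hlim2,
    (P.tendsto_h_rpow_div_levels hc (-1)).eventually_lt_const hlim3,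
    (P.tendsto_levels hc).eventually_ge_atTop 2,
    Params.tendsto_log_one_div.eventually_ge_atTop 0,
    (tendsto_one_div_rpow_atTop hs).eventually_ge_atTop (n : ℝ),
    (tendsto_one_div_rpow_atTop hs).eventually_ge_atTop (Real.exp 1)]
    with ε hε h1 hratio hηle hroot hN hlog hn hexp
  have hε : 0 < ε := hε
  have hh := P.h_pos hε
  have hNle : (P.levels c ε : ℝ) ≤ c / P.γ * Real.log (1 / ε) :=
    Nat.floor_le (mul_nonneg (by positivity) hlog)
  set h := P.h ε with hhdef
  set N := P.levels c ε with hNdef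
  have hN0 : (0 : ℝ) < N := by exact_mod_cast (by omega : 0 < N)
  have hpow (a b : ℝ) : (h ^ a) ^ b = h ^ (a * b) := (Real.rpow_mul hh.le a b).symm
  intro mesh η
  have hm : IsMeshSeq P S mesh N := by
    refine ⟨hN, fun l _ _ => Real.rpow_pos_of_pos hh _, ?_, fun l hl hlN => ?_, ?_⟩
    · exact Real.rpow_le_one hh.le h1.le (by positivity)
    · have hexpo : ((l + 1 : ℕ) : ℝ) / N * P.γ = P.γ / N + (l : ℝ) / N * P.γ := by
        push_cast; ring
      simp only [mesh, hpow]
      rw [hexpo, Real.rpow_add hh]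
      gcongr
    · refine S.closure_nbd_subset_of_le ?_ hint
      simp only [mesh, hpow]
      rw [lt_div_iff₀ hCη] at hηle
      rw [Nat.cast_one, one_div_mul_eq_div]
      linarith
  refine ⟨hm.accurate_of_eq hS hd hε ?_, ?_⟩
  · simp only [mesh]
    rw [div_self hN0.ne', Real.rpow_one]
  have hCc := P.one_le_Ccost
  have hCm := P.one_le_Cmesh
  have hec : 1 ≤ Real.exp (1 / c) := Real.one_le_exp (by positivity)
  set X : ℝ := (1 / ε) ^ ((1 - ν) * ((d : ℝ) / P.γ)) with hX
  set A : ℝ := 2 * P.Ccost * P.Cmesh * Real.exp (1 / c) with hA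
  have hA1 : 1 ≤ A := by
    refine one_le_mul_of_one_le_of_one_le (one_le_mul_of_one_le_of_one_le ?_ hCm) hec
    linarith
  have hX0 : 0 < X := (Real.exp_pos 1).trans_le hexp
  have hXφ : X ≤ A ^ d * X := le_mul_of_one_le_left hX0.le (one_le_pow₀ hA1)
  -- The number of levels is at most `(c / γ) log (1 / ε) ≤ log X`, as `c ≤ 1 ≤ (1 - ν) d`; it is
  -- paid for by a logarithm.
  have hNlog : (N : ℝ) ≤ Real.log (A ^ d * X) := by
    refine le_trans ?_ (Real.log_le_log hX0 hXφ)
    rw [hX, Real.log_rpow (by positivity)]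
    refine hNle.trans ?_
    gcongr
    rw [← mul_div_assoc]
    gcongr
    exact hc1.trans (P.one_le_one_sub_ν_mul hd)
  have hψle : (P.Ccost * (h ^ (-(1 - ν)) * h ^ ((-1) / (N : ℝ)))) ^ d ≤ A ^ d * X := by
    have h2 : X = ((1 / ε) ^ ((1 - ν) / P.γ)) ^ d := by
      rw [hX, ← Real.rpow_mul_natCast (by positivity)]
      congr 1; ring
    rw [h2, ← mul_pow]
    refine pow_le_pow_left₀ (by positivity) ?_ d
    have h3 := P.h_rpow_neg_le hε (by linarith : 0 ≤ 1 - ν) (by linarith)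
    calc P.Ccost * (h ^ (-(1 - ν)) * h ^ ((-1) / (N : ℝ)))
        ≤ P.Ccost * ((P.Cmesh * (1 / ε) ^ ((1 - ν) / P.γ)) * (2 * Real.exp (1 / c))) := by
          gcongr
      _ = _ := by rw [hA]; ring
  have hroot1 : 1 / mesh 1 = h ^ ((-1) / (N : ℝ)) := by
    simp only [mesh]
    rw [neg_div, Real.rpow_neg hh.le, Nat.cast_one, one_div (h ^ (1 / (N : ℝ)))]
  have hψ1 : 1 ≤ h ^ (-(1 - ν)) :=
    Real.one_le_rpow_of_pos_of_le_one_of_nonpos hh h1.le (by linarith)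
  refine hm.cost_le_softO hS hd (ψ := h ^ (-(1 - ν)) * h ^ ((-1) / (N : ℝ))) ?_
    (fun l hl hlN => ?_) (hn.trans hXφ) (hexp.trans hXφ) hψle ?_
  · rw [hroot1]
    exact le_mul_of_one_le_left (by positivity) hψ1
  · simp only [mesh, hpow]
    rw [← Real.rpow_sub hh, ← Real.rpow_add hh]
    refine Real.rpow_le_rpow_of_exponent_ge hh h1.le ?_
    have hl1 : (l : ℝ) / N ≤ 1 := (div_le_one hN0).mpr (by exact_mod_cast hlN.le)
    have h4 : (l : ℝ) / N * ν - ((l + 1 : ℕ) : ℝ) / N = -(1 - ν) * (l / N) + (-1) / N := by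
      push_cast; ring
    rw [← hν, h4]
    nlinarith
  · rw [mul_comm]
    gcongr

theorem twoLevelGrid_eq (S : Setup d P.L) (mesh η : ℕ → ℝ) :
    S.finalGrid mesh η 2 = S.twoLevelGrid (mesh 1) (mesh 2) (η 1) := rfl

theorem twoLevelCost_eq (S : Setup d P.L) (mesh η : ℕ → ℝ) :
    S.multiLevelCost mesh η 2 = S.twoLevelCost (mesh 1) (mesh 2) (η 1) := by
  unfold multiLevelCost twoLevelCost
  rw [Finset.sum_range_one]
  rfl

theorem Satisfies.eventually_twoLevel (hS : Satisfies P S n) (hd : 2 ≤ d) :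
    ∀ᶠ ε in 𝓝[>] (0 : ℝ),
      let H : ℝ := P.h ε ^ (1 / (P.ν d + 1))
      let η : ℝ := P.Cη d * H ^ P.γ
      S.Accurate (P.h ε) ε (P.θ₀ / 4 * η) (P.Cerr d * ε) (S.twoLevelGrid H (P.h ε) η) ∧
      (S.twoLevelCost H (P.h ε) η : ℝ) ≤ n * softO 96 2
        ((2 * P.Ccost * P.Cmesh) ^ d * (1 / ε) ^ ((d : ℝ) / (P.γ * (P.ν d + 1)))) := by
  have hν0 := P.ν_pos hd
  have hν1 := P.ν_lt_one hd
  have hγ := P.γ_pos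
  have hCc := P.one_le_Ccost
  have hCm := P.one_le_Cmesh
  filter_upwards [self_mem_nhdsWithin, hS.eventually_multiLevel hd le_rfl] with ε hε hmain
  have hε : 0 < ε := hε
  set ν := P.ν d with hν
  have h2 : 1 - ν ^ 2 ≠ 0 := by nlinarith
  have he : (1 - ν) / (1 - ν ^ 2) = 1 / (ν + 1) := by
    rw [div_eq_div_iff h2 (by linarith)]; ring
  have hexpo : (1 - ν) / (1 - ν ^ 2) * ((d : ℝ) / P.γ) = d / (P.γ * (ν + 1)) := by
    rw [he]; field_simp
  have hφ : ((2 : ℕ) : ℝ) * (P.Ccost * P.Cmesh) ^ d *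
      (1 / ε) ^ ((1 - ν) / (1 - ν ^ 2) * ((d : ℝ) / P.γ)) ≤
      (2 * P.Ccost * P.Cmesh) ^ d * (1 / ε) ^ ((d : ℝ) / (P.γ * (ν + 1))) := by
    rw [hexpo, mul_assoc 2 P.Ccost, mul_pow 2]
    gcongr
    exact_mod_cast le_self_pow₀ (one_le_two (α := ℝ)) (by omega)
  have hres := hmain _ hφ
  simp only [twoLevelGrid_eq, twoLevelCost_eq, Nat.add_one_sub_one, pow_one, he, div_self h2, Real.rpow_one] at hres
  exact hres

end Setup
end FastMarching

theorem mainTheorem3 (P : FastMarching.Params) :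
    ∃ (Cm K θ : ℝ) (q : ℕ), 0 < Cm ∧ 0 < K ∧ 0 < θ ∧
    ∀ d : ℕ, 2 ≤ d → ∃ Cη Cerr : ℝ, 0 < Cη ∧ 0 < Cerr ∧
    ∀ (S : FastMarching.Setup d P.L) (n : ℕ), FastMarching.Setup.Satisfies P S n →
      P.ν d < 1 ∧
      -- two levels
      (∃ ε₀ : ℝ, 0 < ε₀ ∧ ∀ ε : ℝ, 0 < ε → ε < ε₀ →
        let h : ℝ := P.h ε
        let H : ℝ := h ^ (1 / (P.ν d + 1))
        let η : ℝ := Cη * H ^ P.γ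
        S.Accurate h ε (θ * η) (Cerr * ε) (S.twoLevelGrid H h η) ∧
        (S.twoLevelCost H h η : ℝ) ≤
          n * FastMarching.softO K q (Cm ^ d * (1 / ε) ^ ((d : ℝ) / (P.γ * (P.ν d + 1))))) ∧
      -- `N` levels
      (∀ N : ℕ, 2 ≤ N → ∃ ε₀ : ℝ, 0 < ε₀ ∧ ∀ ε : ℝ, 0 < ε → ε < ε₀ →
        let h : ℝ := P.h ε
        let mesh : ℕ → ℝ := fun l => h ^ ((1 - P.ν d ^ l) / (1 - P.ν d ^ N))
        let η : ℕ → ℝ := fun l => Cη * mesh l ^ P.γ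
        S.Accurate h ε (θ * η (N - 1)) (Cerr * ε) (S.finalGrid mesh η N) ∧
        (S.multiLevelCost mesh η N : ℝ) ≤
          n * FastMarching.softO K q
            (N * Cm ^ d * (1 / ε) ^ ((1 - P.ν d) / (1 - P.ν d ^ N) * ((d : ℝ) / P.γ)))) ∧
      -- a number of levels proportional to `log (1 / ε)`
      (∀ c ηbar : ℝ, 0 < c → c ≤ 1 → closure (S.nbd ηbar) ⊆ S.Ω →
        5 / 2 < Real.exp (P.γ / c) → Cη * Real.exp (-(P.γ / c)) < ηbar →
        ∃ ε₀ : ℝ, 0 < ε₀ ∧ ∀ ε : ℝ, 0 < ε → ε < ε₀ →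
        let h : ℝ := P.h ε
        let N : ℕ := ⌊c / P.γ * Real.log (1 / ε)⌋₊
        let mesh : ℕ → ℝ := fun l => h ^ ((l : ℝ) / (N : ℝ))
        let η : ℕ → ℝ := fun l => Cη * mesh l ^ P.γ
        S.Accurate h ε (θ * η (N - 1)) (Cerr * ε) (S.finalGrid mesh η N) ∧
        (S.multiLevelCost mesh η N : ℝ) ≤
          n * FastMarching.softO K q
            ((Cm * Real.exp (1 / c)) ^ d * (1 / ε) ^ ((1 - P.ν d) * ((d : ℝ) / P.γ))) ∧
        (1 - P.ν d) * ((d : ℝ) / P.γ) = (1 + ((d : ℝ) - 1) * (1 - P.γ * P.β)) / P.γ ∧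
        (P.γ = 1 → P.β = 1 → (S.multiLevelCost mesh η N : ℝ) ≤
          n * FastMarching.softO K q ((Cm * Real.exp (1 / c)) ^ d * (1 / ε)))) := by
  have hCc := P.one_le_Ccost
  have hCm := P.one_le_Cmesh
  have hθ := P.θ₀_pos
  -- The `2` in `Cm` absorbs the number of levels of the two-level method (`2 ≤ 2 ^ d`) and the
  -- slack in the limit `e^{1/c}` of the third. `θ₀ / 4` occurs because `accurate_last` needs four
  -- times the size of its neighbourhood to be covered.
  refine ⟨2 * P.Ccost * P.Cmesh, 96, P.θ₀ / 4, 2, by positivity, by norm_num, by positivity,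
    fun d hd => ⟨P.Cη d, P.Cerr d, P.Cη_pos hd, P.Cerr_pos d, fun S n hS =>
      ⟨P.ν_lt_one hd, ?_, fun N hN => ?_, fun c ηbar hc hc1 hint hexpc hη => ?_⟩⟩⟩
  · exact FastMarching.exists_pos_of_eventually (hS.eventually_twoLevel hd)
  · obtain ⟨ε₀, h0, hε₀⟩ :=
      FastMarching.exists_pos_of_eventually (hS.eventually_multiLevel hd hN)
    refine ⟨ε₀, h0, fun ε hε hlt => hε₀ ε hε hlt _ ?_⟩
    gcongr
    linarith
  · obtain ⟨ε₀, h0, hε₀⟩ := FastMarching.exists_pos_of_eventually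
      (hS.eventually_logLevel hd hc hc1 hint hexpc hη)
    have hexpo : (1 - P.ν d) * ((d : ℝ) / P.γ) =
        (1 + ((d : ℝ) - 1) * (1 - P.γ * P.β)) / P.γ := by
      rw [← mul_div_assoc, P.one_sub_ν_mul hd]
    refine ⟨ε₀, h0, fun ε hε hlt => ?_⟩
    obtain ⟨hacc, hcost⟩ := hε₀ ε hε hlt
    refine ⟨hacc, hcost, hexpo, fun hγ hβ => ?_⟩
    have h1 : (1 - P.ν d) * ((d : ℝ) / P.γ) = 1 := by rw [hexpo, hγ, hβ]; norm_num
    rw [h1, Real.rpow_one] at hcost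
    exact hcost
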